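/- Let $n\ge 2$ and $r\ge n+3$, let $C\subset\mathbb{P}^n$ be a rational normal curve of degree $n$ over $\mathbb{C}$, and let $p_1,\dots,p_r$ be distinct points of $C$. Let $X$ be the blow-up of $\mathbb{P}^n$ at $p_1,\dots,p_r$, let $E_1,\dots,E_r$ be the exceptional divisors, and let $H$ be the pull-back of the hyperplane class. Let $$\mathrm{Cox}(X)=\bigoplus_{(d,e)\in\mathbb{Z}\times\mathbb{Z}^r}\mathrm{H}^0\Bigl(X,\;dH+\sum_{i=1}^r e_iE_i\Bigr)$$ be the Cox ring of $X$ with respect to the basis $H,E_1,\dots,E_r$ of $\mathrm{Pic}(X)$. Consider the divisors $E_1,\dots,E_r$ and the divisors $$kH-k\sum_{i\in I}E_i-(k-1)\sum_{i\notin I}E_i$$ for all integers $k$ with $1\le k\le 1+n/2$ and all subsets $I\subset\{1,\dots,r\}$ with $|I|=n+2-2k$. Then each of these finitely many divisors $E$ satisfies $\dim_{\mathbb{C}}\mathrm{H}^0(X,E)=1$, and, for any choice of nonzero sections $x_E\in\mathrm{H}^0(X,E)$, the elements $x_E$ generate $\mathrm{Cox}(X)$ as a $\mathbb{C}$-algebra.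 In particular, $\mathrm{Cox}(X)$ is a finitely generated $\mathbb{C}$-algebra. -/

import Mathlib

open scoped DirectSum LinearAlgebra.Projectivization

noncomputable section

namespace BlowUpCox

/-! ### Regular functions -/

/-- Polynomial functions on a complex vector space: the algebra generated by the linear forms. -/
def polyFun (W : Type) [AddCommGroup W] [Module ℂ W] : Subalgebra ℂ (W → ℂ) :=
  Algebra.adjoin ℂ {f | ∃ φ : Module.Dual ℂ W, f = fun w => φ w}

/-- `g` is a regular function on the subvariety `S` of `W`: near every point of `S` it is a
quotient of two polynomial functions. (Only the values of `g` on `S` matter.) -/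
def IsRegularOn {W : Type} [AddCommGroup W] [Module ℂ W] (S : Set W) (g : W → ℂ) : Prop :=
  ∀ z ∈ S, ∃ P ∈ polyFun W, ∃ Q ∈ polyFun W,
    Q z ≠ 0 ∧ ∀ w ∈ S, Q w ≠ 0 → g w = P w / Q w

section Regular

variable {W : Type} [AddCommGroup W] [Module ℂ W] {S : Set W} {f g : W → ℂ}

theorem isRegularOn_const (c : ℂ) : IsRegularOn S (fun _ => c) := fun _ _ =>
  ⟨_, (polyFun W).algebraMap_mem c, 1, (polyFun W).one_mem, one_ne_zero, fun w _ _ => by simp⟩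

theorem IsRegularOn.add (hf : IsRegularOn S f) (hg : IsRegularOn S g) :
    IsRegularOn S (f + g) := by
  intro z hz
  obtain ⟨P, hP, Q, hQ, hQz, h⟩ := hf z hz
  obtain ⟨P', hP', Q', hQ', hQz', h'⟩ := hg z hz
  refine ⟨P * Q' + Q * P', add_mem (mul_mem hP hQ') (mul_mem hQ hP'), Q * Q', mul_mem hQ hQ',
    mul_ne_zero hQz hQz', fun w hw hne => ?_⟩
  have h1 : Q w ≠ 0 := left_ne_zero_of_mul hne
  have h2 : Q' w ≠ 0 := right_ne_zero_of_mul hne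
  simp only [Pi.add_apply, Pi.mul_apply, h w hw h1, h' w hw h2]
  exact div_add_div _ _ h1 h2

theorem IsRegularOn.mul (hf : IsRegularOn S f) (hg : IsRegularOn S g) :
    IsRegularOn S (f * g) := by
  intro z hz
  obtain ⟨P, hP, Q, hQ, hQz, h⟩ := hf z hz
  obtain ⟨P', hP', Q', hQ', hQz', h'⟩ := hg z hz
  refine ⟨P * P', mul_mem hP hP', Q * Q', mul_mem hQ hQ',
    mul_ne_zero hQz hQz', fun w hw hne => ?_⟩
  have h1 : Q w ≠ 0 := left_ne_zero_of_mul hne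
  have h2 : Q' w ≠ 0 := right_ne_zero_of_mul hne
  simp only [Pi.mul_apply, h w hw h1, h' w hw h2]
  exact div_mul_div_comm _ _ _ _

end Regular

/-! ### Projective space and rational normal curves -/

/-- The vector space `ℂ^(n+1)`; its projectivization is `ℙ^n`. -/
abbrev Vec (n : ℕ) : Type := Fin (n + 1) → ℂ

/-- The vector `(s^n, s^(n-1) t, …, t^n)`. -/
def veronese (n : ℕ) (s t : ℂ) : Vec n := fun j => s ^ (n - (j : ℕ)) * t ^ (j : ℕ)

/-- A rational normal curve of degree `n` in `ℙ^n`: the image of the standard curve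
`[s : t] ↦ [s^n : s^(n-1) t : … : t^n]` under a projective linear transformation. -/
def IsRationalNormalCurve {n : ℕ} (C : Set (ℙ ℂ (Vec n))) : Prop :=
  ∃ A : Vec n ≃ₗ[ℂ] Vec n, ∀ P : ℙ ℂ (Vec n), P ∈ C ↔
    ∃ s t : ℂ, (s ≠ 0 ∨ t ≠ 0) ∧ P.submodule = Submodule.span ℂ {A (veronese n s t)}

/-! ### The blow-up of projective space at points -/

variable {n r : ℕ}

/-- The projectivization of `ℂ^(n+1) / p i` is the `ℙ^(n-1)` of lines in `ℙ^n` through `p i`. -/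
abbrev Dir (p : Fin r → ℙ ℂ (Vec n)) (i : Fin r) : Type := Vec n ⧸ (p i).submodule

/-- The blow-up of `ℙ^n` at the points `p i`, as a subvariety of `ℙ^n × ∏ i, ℙ^(n-1)`:
the points `(x, ℓ)`, where `x` is a point of `ℙ^n` and `ℓ i` is a line through `p i` and `x`. -/
def BlowUp (p : Fin r → ℙ ℂ (Vec n)) : Set (ℙ ℂ (Vec n) × ∀ i, ℙ ℂ (Dir p i)) :=
  {ξ | ∀ i, ξ.1.submodule.map (p i).submodule.mkQ ≤ (ξ.2 i).submodule}

/-- The space of multihomogeneous coordinates on `ℙ^n × ∏ i, ℙ^(n-1)`. -/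
abbrev Ambient (p : Fin r → ℙ ℂ (Vec n)) : Type := Vec n × ∀ i, Dir p i

/-- The multicone over the blow-up: all multihomogeneous coordinate vectors of its points. -/
def cone (p : Fin r → ℙ ℂ (Vec n)) : Set (Ambient p) :=
  {z | ∃ (h : z.1 ≠ 0) (h' : ∀ i, z.2 i ≠ 0),
    (Projectivization.mk ℂ z.1 h, fun i => Projectivization.mk ℂ (z.2 i) (h' i)) ∈ BlowUp p}

/-- `t i` is the value at `z = (x, y)` in the multicone of the equation of the exceptional divisor
`E i`, the locus over `p i`: the linear forms on `ℂ^(n+1)` that vanish at `p i` are the `φ (x mod p i)`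
with `φ` a linear form on the quotient, and `φ (x mod p i) = t i * φ (y i)`, where some
`φ (y i)` is nonzero; so `t i` generates the pulled back ideal of `p i` locally. -/
def IsExcEq (p : Fin r → ℙ ℂ (Vec n)) (z : Ambient p) (t : Fin r → ℂ) : Prop :=
  ∀ i, (p i).submodule.mkQ z.1 = t i • z.2 i

/-- Coordinate vectors of the points of `ℙ^n` other than the `p i`, i.e. of the points of the
blow-up outside the exceptional divisors. -/
abbrev Off (p : Fin r → ℙ ℂ (Vec n)) : Type :=
  {x : Vec n // x ≠ 0 ∧ ∀ i, x ∉ (p i).submodule}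

/-- The divisors `d H + ∑ i, e i E i`, written as `(d, e)`. -/
abbrev Div (r : ℕ) : Type := ℤ × (Fin r → ℤ)

/-- The pull-back of the hyperplane class. -/
def H : Div r := (1, 0)

/-- The exceptional divisors. -/
def E (i : Fin r) : Div r := (0, Pi.single i 1)

/-- The space `H⁰(X, d H + ∑ i, e i E i)` on the blow-up `X` of `ℙ^n` at the `p i`. A section is a
section `F` of the pull-back of `𝒪(d)` over the complement of the exceptional divisors
(a homogeneous function of degree `d` there) such that the divisor `div F + ∑ i, e i E i` is effective
on `X`: the product of `F` and of the equation of `∑ i, e i E i` extends to a regular function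
on the whole multicone over `X`. -/
def H0 (p : Fin r → ℙ ℂ (Vec n)) (D : Div r) : Submodule ℂ (Off p → ℂ) where
  carrier := {F |
    (∀ (c : ℂ) (x x' : Off p), c ≠ 0 → x'.1 = c • x.1 → F x' = c ^ D.1 * F x) ∧
    ∃ g : Ambient p → ℂ, IsRegularOn (cone p) g ∧
      ∀ z ∈ cone p, ∀ t, IsExcEq p z t → ∀ x : Off p, z.1 = x.1 →
        g z = F x * ∏ i, t i ^ D.2 i}
  zero_mem' := ⟨fun _ _ _ _ _ => by simp, fun _ => 0, isRegularOn_const 0,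
    fun _ _ _ _ _ _ => by simp⟩
  add_mem' := by
    rintro F F' ⟨hF, g, hg, h⟩ ⟨hF', g', hg', h'⟩
    refine ⟨fun c x x' hc hx => ?_, g + g', hg.add hg', fun z hz t ht x hx => ?_⟩
    · simp only [Pi.add_apply, hF c x x' hc hx, hF' c x x' hc hx]; ring
    · simp only [Pi.add_apply, h z hz t ht x hx, h' z hz t ht x hx]; ring
  smul_mem' := by
    rintro a F ⟨hF, g, hg, h⟩
    refine ⟨fun c x x' hc hx => ?_, (fun _ => a) * g, (isRegularOn_const a).mul hg,
      fun z hz t ht x hx => ?_⟩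
    · simp only [Pi.smul_apply, smul_eq_mul, hF c x x' hc hx]; ring
    · simp only [Pi.smul_apply, smul_eq_mul, Pi.mul_apply, h z hz t ht x hx]; ring

theorem exc_ne_zero {p : Fin r → ℙ ℂ (Vec n)} {z : Ambient p} {t : Fin r → ℂ}
    (ht : IsExcEq p z t) (x : Off p) (hx : z.1 = x.1) (i : Fin r) : t i ≠ 0 := by
  intro h0
  have h := ht i
  rw [h0, zero_smul, hx, Submodule.mkQ_apply, Submodule.Quotient.mk_eq_zero] at h
  exact x.2.2 i h

instance (p : Fin r → ℙ ℂ (Vec n)) : SetLike.GradedMonoid (H0 p) where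
  one_mem := ⟨fun c _ _ _ _ => by simp, fun _ => 1, isRegularOn_const 1,
    fun _ _ _ _ _ _ => by simp⟩
  mul_mem := by
    rintro D D' F F' ⟨hF, g, hg, h⟩ ⟨hF', g', hg', h'⟩
    refine ⟨fun c x x' hc hx => ?_, g * g', hg.mul hg', fun z hz t ht x hx => ?_⟩
    · simp only [Pi.mul_apply, hF c x x' hc hx, hF' c x x' hc hx, Prod.fst_add, zpow_add₀ hc]
      ring
    · have hpr : ∏ i, t i ^ (D + D').2 i = (∏ i, t i ^ D.2 i) * ∏ i, t i ^ D'.2 i := by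
        rw [← Finset.prod_mul_distrib]
        exact Finset.prod_congr rfl fun i _ => zpow_add₀ (exc_ne_zero ht x hx i) _ _
      simp only [Pi.mul_apply, h z hz t ht x hx, h' z hz t ht x hx, hpr]
      ring

/-- The Cox ring of the blow-up of `ℙ^n` at the points `p i`, with respect to the basis
`H, E 1, …, E r` of its Picard group. -/
abbrev Cox (p : Fin r → ℙ ℂ (Vec n)) : Type := ⨁ D : Div r, H0 p D

/-- The divisor `k H - k ∑_{i ∈ I} E i - (k - 1) ∑_{i ∉ I} E i`. -/
def minimalDivisor (k : ℕ) (I : Finset (Fin r)) : Div r :=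
  (k : ℤ) • H - (k : ℤ) • ∑ i ∈ I, E i - ((k : ℤ) - 1) • ∑ i ∈ Iᶜ, E i

/-- The exceptional divisors and the minimal divisors with `|I| = n + 2 - 2k`,
`1 ≤ k ≤ 1 + n/2`. -/
def generatorDivisors (n r : ℕ) : Set (Div r) :=
  {D | (∃ i, D = E i) ∨ ∃ (k : ℕ) (I : Finset (Fin r)),
    1 ≤ k ∧ 2 * k ≤ n + 2 ∧ I.card = n + 2 - 2 * k ∧ D = minimalDivisor k I}

end BlowUpCox

end

/-
In suitable coordinates the `p i` are the points `(1, y, …, y^n)` with distinct parameters `y i`.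
A section of `d H + ∑ e i E i` is a form of degree `d` whose degree along `p i`, the largest order
of a nonzero iterated derivative in the direction of `p i`, is at most `d + e i`. If
`|I| + 2k = n + 2`, then the `k × k` Hankel determinant of the coordinates, weighted by the
polynomial with roots `y i`, `i ∈ I`, has degree at most `1` along every point of the curve and `0`
along the points of `I`, so it is a section of the minimal divisor of `k` and `I`.

The forms of degree `d` with degree at most `b` along finitely many points of the curve are spanned
by products of such determinants, by induction on a bound `N` for the degree along all points of
the curve. The `N`-th derivative along a new point `c` is pulled back by the projection from the
tangent line at `c`, whose image is a moment curve of degree two less. There it is a combination of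
products of Hankel determinants, each of which is the `N`-th derivative of a product of `N` larger
ones. Subtracting these lowers the degree along `c` to `N - 1`. After sufficiently many new points
the degree conditions force the degree along the whole curve to be at most `N - 1`. Finally an
exchange of roots, by the linear dependence of determinants whose weights differ in one root, moves
all roots to the parameters `y i`.
-/

noncomputable section

namespace BlowUpCox

open MvPolynomial

/-! ### Directional derivatives of polynomials -/

section DirDeriv

variable {σ R S : Type*} [CommRing R] [CommRing S]

/-- The directional derivative of polynomials along a constant vector `a`, as a linear
endomorphism, so that its powers are the higher derivatives. -/
def dirDeriv (a : σ → R) : Module.End R (MvPolynomial σ R) :=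
  (mkDerivation R fun i => C (a i)).toLinearMap

@[simp] theorem dirDeriv_X (a : σ → R) (i : σ) : dirDeriv a (X i) = C (a i) :=
  mkDerivation_X R _ i

@[simp] theorem dirDeriv_C (a : σ → R) (c : R) : dirDeriv a (C c) = 0 :=
  Derivation.map_algebraMap _ c

theorem dirDeriv_mul (a : σ → R) (F G : MvPolynomial σ R) :
    dirDeriv a (F * G) = F * dirDeriv a G + dirDeriv a F * G := by
  rw [mul_comm (dirDeriv a F)]
  exact (mkDerivation R fun i => C (a i)).leibniz F G

theorem dirDeriv_C_mul (a : σ → R) (c : R) (F : MvPolynomial σ R) :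
    dirDeriv a (C c * F) = C c * dirDeriv a F := by
  rw [← smul_eq_C_mul, map_smul, smul_eq_C_mul]

theorem dirDeriv_eq_of_derivation {a : σ → R}
    (D : Derivation R (MvPolynomial σ R) (MvPolynomial σ R)) (h : ∀ i, D (X i) = C (a i)) :
    dirDeriv a = D.toLinearMap :=
  congrArg _ (derivation_ext fun i => by rw [mkDerivation_X, h])

theorem dirDeriv_add (a b : σ → R) :
    dirDeriv (fun i => a i + b i) = dirDeriv a + dirDeriv b :=
  dirDeriv_eq_of_derivation (mkDerivation R (fun i => C (a i)) + mkDerivation R fun i => C (b i))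
    fun i => by simp

theorem dirDeriv_smul (c : R) (a : σ → R) : dirDeriv (fun i => c * a i) = c • dirDeriv a :=
  dirDeriv_eq_of_derivation (c • mkDerivation R fun i => C (a i)) fun i => by
    simp [smul_eq_C_mul]

theorem dirDeriv_single [DecidableEq σ] (i : σ) :
    dirDeriv (Pi.single i (1 : R)) = (pderiv i).toLinearMap :=
  dirDeriv_eq_of_derivation _ fun j => by
    rcases eq_or_ne i j with rfl | h <;> simp [*, pderiv_X]

theorem dirDeriv_commute (a b : σ → R) : Commute (dirDeriv a) (dirDeriv b) := by
  have h : ⁅mkDerivation R fun i => C (a i), mkDerivation R fun i => C (b i)⁆ = 0 :=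
    derivation_ext fun i => by
      rw [Derivation.commutator_apply]
      simp
  exact LinearMap.ext fun F => sub_eq_zero.1 <| by
    rw [Module.End.mul_apply, Module.End.mul_apply]
    exact (Derivation.commutator_apply F).symm.trans (DFunLike.congr_fun h F)

theorem map_dirDeriv (φ : R →+* S) (a : σ → R) (F : MvPolynomial σ R) :
    map φ (dirDeriv a F) = dirDeriv (fun i => φ (a i)) (map φ F) := by
  induction F using MvPolynomial.induction_on with
  | C c => simp
  | add F G hF hG => simp [hF, hG]
  | mul_X F i hF => simp [dirDeriv_mul, hF]

theorem map_dirDeriv_pow (φ : R →+* S) (a : σ → R) (j : ℕ) (F : MvPolynomial σ R) :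
    map φ ((dirDeriv a ^ j) F) = (dirDeriv (fun i => φ (a i)) ^ j) (map φ F) := by
  induction j with
  | zero => rfl
  | succ j ih => rw [pow_succ', pow_succ', Module.End.mul_apply, Module.End.mul_apply,
      map_dirDeriv, ih]

theorem dirDeriv_eq_sum_pderiv (a : σ → R) (F : MvPolynomial σ R) :
    dirDeriv a F = ∑ i ∈ F.vars, C (a i) * pderiv i F := by
  classical
  have hsum (G : MvPolynomial σ R) :
      (∑ i ∈ F.vars, a i • pderiv i : Derivation R (MvPolynomial σ R) (MvPolynomial σ R)) G =
        ∑ i ∈ F.vars, C (a i) * pderiv i G := by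
    have := congrFun (map_sum (Derivation.coeFnAddMonoidHom (R := R) (A := MvPolynomial σ R)
      (M := MvPolynomial σ R)) (fun i => a i • pderiv i) F.vars) G
    rw [Finset.sum_apply] at this
    exact this.trans (Finset.sum_congr rfl fun i _ => smul_eq_C_mul _ _)
  rw [← hsum]
  refine derivation_eq_of_forall_mem_vars fun i hi => ?_
  rw [hsum, mkDerivation_X, Finset.sum_eq_single_of_mem i hi fun j _ hj => by
    rw [pderiv_X_of_ne hj.symm, mul_zero], pderiv_X_self, mul_one]

theorem dirDeriv_mem_supported (a : σ → R) {s : Set σ} {F : MvPolynomial σ R}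
    (hF : F ∈ supported R s) : dirDeriv a F ∈ supported R s := by
  rw [supported_eq_adjoin_X] at *
  induction hF using Algebra.adjoin_induction with
  | mem F hF =>
    obtain ⟨i, -, rfl⟩ := hF
    rw [dirDeriv_X]
    exact Subalgebra.algebraMap_mem _ _
  | algebraMap c => rw [algebraMap_eq, dirDeriv_C]; exact zero_mem _
  | add F G _ _ hF hG => rw [map_add]; exact add_mem hF hG
  | mul F G hF hG hF' hG' => rw [dirDeriv_mul]; exact add_mem (mul_mem hF hG') (mul_mem hF' hG)

theorem dirDeriv_pow_mem_supported (a : σ → R) {s : Set σ} {F : MvPolynomial σ R}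
    (hF : F ∈ supported R s) (j : ℕ) : (dirDeriv a ^ j) F ∈ supported R s := by
  induction j with
  | zero => exact hF
  | succ j ih => rw [pow_succ', Module.End.mul_apply]; exact dirDeriv_mem_supported a ih

theorem isHomogeneous_dirDeriv (a : σ → R) {F : MvPolynomial σ R} {d : ℕ}
    (hF : F.IsHomogeneous d) : (dirDeriv a F).IsHomogeneous (d - 1) := by
  rw [dirDeriv_eq_sum_pderiv]
  exact IsHomogeneous.sum _ _ _ fun i _ => hF.pderiv.C_mul (a i)

theorem isHomogeneous_dirDeriv_pow (a : σ → R) {F : MvPolynomial σ R} {d : ℕ}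
    (hF : F.IsHomogeneous d) (j : ℕ) : ((dirDeriv a ^ j) F).IsHomogeneous (d - j) := by
  induction j with
  | zero => exact hF
  | succ j ih =>
    rw [pow_succ', Module.End.mul_apply, ← Nat.sub_sub]
    exact isHomogeneous_dirDeriv a ih

theorem dirDeriv_pow_eq_zero (a : σ → R) {F : MvPolynomial σ R} {d j : ℕ}
    (hF : F.IsHomogeneous d) (hj : d < j) : (dirDeriv a ^ j) F = 0 := by
  obtain ⟨m, rfl⟩ := Nat.exists_eq_add_of_lt hj
  have h0 : ((dirDeriv a ^ (d + m)) F).IsHomogeneous 0 := by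
    simpa using isHomogeneous_dirDeriv_pow a hF (d + m)
  rw [pow_succ', Module.End.mul_apply,
    totalDegree_eq_zero_iff_eq_C.1 ((totalDegree_zero_iff_isHomogeneous σ).2 h0), dirDeriv_C]

theorem notMem_vars_of_pderiv_eq_zero [NoZeroDivisors R] [CharZero R] {i : σ}
    {F : MvPolynomial σ R} (h : pderiv i F = 0) : i ∉ F.vars := by
  intro hi
  obtain ⟨m, hm, him⟩ := (mem_vars_iff_mem_support i).1 hi
  have hcoeff := congrArg (coeff (m - Finsupp.single i 1)) h
  rw [coeff_pderiv, tsub_add_cancel_of_le (Finsupp.single_le_iff.2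
    (Nat.one_le_iff_ne_zero.2 (Finsupp.mem_support_iff.1 him))), coeff_zero] at hcoeff
  exact mul_ne_zero (mem_support_iff.1 hm) (Nat.cast_add_one_ne_zero _) hcoeff

theorem eq_zero_of_forall_pderiv_eq_zero [NoZeroDivisors R] [CharZero R] {F : MvPolynomial σ R}
    {d : ℕ} (hF : F.IsHomogeneous d) (hd : d ≠ 0) (h : ∀ i, pderiv i F = 0) : F = 0 := by
  have hvars : F.vars = ∅ :=
    Finset.eq_empty_of_forall_notMem fun i => notMem_vars_of_pderiv_eq_zero (h i)
  have h0 : F.IsHomogeneous 0 := by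
    rw [← totalDegree_zero_iff_isHomogeneous, totalDegree_eq_zero_iff_eq_C]
    exact vars_eq_empty_iff_eq_C.1 hvars
  by_contra hne
  exact hd (hF.inj_right h0 hne)

end DirDeriv

section MomentCurve

variable {R : Type*} [CommRing R]

/-- The point `(1, y, y ^ 2, …)` of the affine cone over the rational normal curve. Curves of all
degrees are treated at once, with infinitely many coordinates (the moments). -/
def momentCurve (y : R) : ℕ → R := fun i => y ^ i

/-- The derivative along the tangent vector of the moment curve at `y`. -/
def tangentDeriv (y : R) : Module.End R (MvPolynomial ℕ R) :=
  dirDeriv fun i => i * y ^ (i - 1)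

theorem coeff_dirDeriv_momentCurve (y : R) (F : MvPolynomial ℕ R) (m : ℕ →₀ ℕ) :
    coeff m (dirDeriv (momentCurve y) F) =
      (∑ i ∈ F.vars, Polynomial.monomial i (coeff m (pderiv i F))).eval y := by
  simp only [dirDeriv_eq_sum_pderiv, coeff_sum, coeff_C_mul, momentCurve,
    Polynomial.eval_finsetSum, Polynomial.eval_monomial, mul_comm]

theorem pderiv_eq_zero_of_dirDeriv_momentCurve [IsDomain R] {S : Set R} (hS : S.Infinite)
    {F : MvPolynomial ℕ R} (h : ∀ y ∈ S, dirDeriv (momentCurve y) F = 0) (i : ℕ) :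
    pderiv i F = 0 := by
  by_cases hi : i ∈ F.vars
  · ext1 m
    have hp : ∑ j ∈ F.vars, Polynomial.monomial j (coeff m (pderiv j F)) = 0 :=
      Polynomial.eq_zero_of_infinite_isRoot _ <| hS.mono fun y hy => by
        simp only [Set.mem_ofPred_eq, Polynomial.IsRoot.def, ← coeff_dirDeriv_momentCurve,
          h y hy, coeff_zero]
    have hcoeff := congrArg (Polynomial.coeff · i) hp
    simpa [Polynomial.finsetSum_coeff, Polynomial.coeff_monomial, hi] using hcoeff
  · exact pderiv_eq_zero_of_notMem_vars hi

theorem eq_zero_of_dirDeriv_momentCurve [IsDomain R] [CharZero R] {S : Set R} (hS : S.Infinite)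
    {F : MvPolynomial ℕ R} {d : ℕ} (hF : F.IsHomogeneous d) (hd : d ≠ 0)
    (h : ∀ y ∈ S, dirDeriv (momentCurve y) F = 0) : F = 0 :=
  eq_zero_of_forall_pderiv_eq_zero hF hd (pderiv_eq_zero_of_dirDeriv_momentCurve hS h)

end MomentCurve

/-! ### Degrees along the moment curve -/

section GenericDeriv

open Polynomial (evalRingHom)

variable {K : Type*} [Field K]

/-- The derivative along the generic point of the moment curve, after extension of scalars
from `K` to `K[Y]`. -/
def genericDeriv : Module.End (Polynomial K) (MvPolynomial ℕ (Polynomial K)) :=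
  dirDeriv (momentCurve Polynomial.X)

/-- The divided difference of the derivatives along the generic point and along the point `x`
of the moment curve. -/
def dividedDiffDeriv (x : K) : Module.End (Polynomial K) (MvPolynomial ℕ (Polynomial K)) :=
  dirDeriv fun i => ∑ j ∈ Finset.range i, Polynomial.X ^ j * Polynomial.C x ^ (i - 1 - j)

theorem map_C_dirDeriv_momentCurve_pow (x : K) (j : ℕ) (F : MvPolynomial ℕ K) :
    map Polynomial.C ((dirDeriv (momentCurve x) ^ j) F) =
      (dirDeriv (momentCurve (Polynomial.C x)) ^ j) (map Polynomial.C F) := by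
  simp only [map_dirDeriv_pow, momentCurve, map_pow]
  rfl

theorem map_C_dirDeriv_momentCurve (x : K) (F : MvPolynomial ℕ K) :
    map Polynomial.C (dirDeriv (momentCurve x) F) =
      dirDeriv (momentCurve (Polynomial.C x)) (map Polynomial.C F) := by
  simpa only [pow_one] using map_C_dirDeriv_momentCurve_pow x 1 F

theorem map_eval_map_C (y : K) (F : MvPolynomial ℕ K) :
    map (evalRingHom y) (map Polynomial.C F) = F := by
  rw [map_map]
  convert map_id F
  ext
  simp

theorem map_eval_genericDeriv_pow (y : K) (j : ℕ) (F : MvPolynomial ℕ K) :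
    map (evalRingHom y) ((genericDeriv ^ j) (map Polynomial.C F)) =
      (dirDeriv (momentCurve y) ^ j) F := by
  rw [genericDeriv, map_dirDeriv_pow, map_eval_map_C]
  simp only [momentCurve, map_pow, Polynomial.coe_evalRingHom, Polynomial.eval_X]
  rfl

theorem eq_zero_of_map_eval_eq_zero {σ : Type*} {G : MvPolynomial σ (Polynomial K)} {S : Set K}
    (hS : S.Infinite) (h : ∀ y ∈ S, map (evalRingHom y) G = 0) : G = 0 := by
  ext1 m
  refine Polynomial.eq_zero_of_infinite_isRoot _ (hS.mono fun y hy => ?_)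
  simpa [coeff_map] using congrArg (coeff m) (h y hy)

theorem genericDeriv_pow_eq_zero {F : MvPolynomial ℕ K} {j : ℕ} {S : Set K} (hS : S.Infinite)
    (h : ∀ y ∈ S, (dirDeriv (momentCurve y) ^ j) F = 0) :
    (genericDeriv ^ j) (map Polynomial.C F) = 0 :=
  eq_zero_of_map_eval_eq_zero hS fun y hy => by rw [map_eval_genericDeriv_pow, h y hy]

theorem dirDeriv_momentCurve_pow_eq_zero_of_infinite {F : MvPolynomial ℕ K} {j : ℕ} {S : Set K}
    (hS : S.Infinite) (h : ∀ y ∈ S, (dirDeriv (momentCurve y) ^ j) F = 0) (y : K) :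
    (dirDeriv (momentCurve y) ^ j) F = 0 := by
  rw [← map_eval_genericDeriv_pow, genericDeriv_pow_eq_zero hS h, map_zero]

theorem genericDeriv_eq_add_smul (x : K) :
    genericDeriv = dirDeriv (momentCurve (Polynomial.C x)) +
      (Polynomial.X - Polynomial.C x) • dividedDiffDeriv x := by
  rw [genericDeriv, dividedDiffDeriv, ← dirDeriv_smul, ← dirDeriv_add]
  congr 1
  funext i
  rw [mul_comm, geom_sum₂_mul]
  simp [momentCurve]

theorem dirDeriv_momentCurve_C_eq_sub_smul (x : K) :
    dirDeriv (momentCurve (Polynomial.C x)) =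
      genericDeriv - (Polynomial.X - Polynomial.C x) • dividedDiffDeriv x :=
  eq_sub_of_add_eq (genericDeriv_eq_add_smul x).symm

theorem dirDeriv_genericDeriv_pow (x : K) (N : ℕ) (F : MvPolynomial ℕ K) :
    dirDeriv (momentCurve (Polynomial.C x)) ((genericDeriv ^ N) (map Polynomial.C F)) =
      (genericDeriv ^ N) (map Polynomial.C (dirDeriv (momentCurve x) F)) := by
  have hcomm : Commute (dirDeriv (momentCurve (Polynomial.C x))) genericDeriv :=
    dirDeriv_commute _ _
  rw [map_C_dirDeriv_momentCurve, ← Module.End.mul_apply, ← Module.End.mul_apply,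
    (hcomm.pow_right N).eq]

theorem exists_sub_smul_pow_succ_eq {R A : Type*} [CommRing R] [Ring A] [Algebra R A] {a b : A}
    (h : Commute a b) (t : R) (n : ℕ) : ∃ z : A,
      (a - t • b) ^ (n + 1) = a ^ (n + 1) - ((n + 1 : R) * t) • (a ^ n * b) + t ^ 2 • z := by
  induction n with
  | zero => exact ⟨0, by simp⟩
  | succ n ih =>
    obtain ⟨z, hz⟩ := ih
    refine ⟨a * z + ((n : R) + 1) • (a ^ n * b * b) - t • (b * z), ?_⟩
    have hb : b * a ^ (n + 1) = a ^ (n + 1) * b := ((h.pow_left (n + 1)).eq).symm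
    have hb' : b * (a ^ n * b) = a ^ n * b * b := by
      rw [← mul_assoc, ((h.pow_left n).eq).symm]
    have ha : a * (a ^ n * b) = a ^ (n + 1) * b := by rw [← mul_assoc, ← pow_succ']
    have ha' : a * a ^ (n + 1) = a ^ (n + 2) := (pow_succ' a (n + 1)).symm
    rw [pow_succ' (a - t • b), hz]
    simp only [sub_mul, mul_add, mul_sub, smul_mul_assoc, mul_smul_comm, hb, hb', ha, ha']
    push_cast
    module

theorem X_sub_C_smul_injective (x : K) : Function.Injective
    fun G : MvPolynomial ℕ (Polynomial K) => (Polynomial.X - Polynomial.C x) • G := by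
  intro G G' h
  simp only [MvPolynomial.smul_eq_C_mul] at h
  refine mul_left_cancel₀ ?_ h
  exact (map_ne_zero_iff _ (C_injective _ _)).2 (Polynomial.X_sub_C_ne_zero x)

-- Expand `0 = D_x ^ (N + 1) F` modulo `(Y - x) ^ 2`, where `D_x = D_Y - (Y - x) Δ`: the constant
-- term `D_Y ^ (N + 1) F` vanishes too, so the linear coefficient `D_Y ^ N Δ F` is divisible
-- by `Y - x`.
theorem exists_genericDeriv_pow_dividedDiffDeriv [CharZero K] {F : MvPolynomial ℕ K} {N : ℕ}
    (h : ∀ y, (dirDeriv (momentCurve y) ^ (N + 1)) F = 0) (x : K) :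
    ∃ G, (genericDeriv ^ N) (dividedDiffDeriv x (map Polynomial.C F)) =
      (Polynomial.X - Polynomial.C x) • G := by
  have hcomm : Commute genericDeriv (dividedDiffDeriv x) := dirDeriv_commute _ _
  obtain ⟨z, hz⟩ := exists_sub_smul_pow_succ_eq
    (A := Module.End (Polynomial K) (MvPolynomial ℕ (Polynomial K))) hcomm
    (Polynomial.X - Polynomial.C x) N
  have hexp := LinearMap.congr_fun hz (map Polynomial.C F)
  rw [← dirDeriv_momentCurve_C_eq_sub_smul, ← map_C_dirDeriv_momentCurve_pow, h x, map_zero,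
    LinearMap.add_apply, LinearMap.sub_apply, LinearMap.smul_apply, LinearMap.smul_apply,
    Module.End.mul_apply, genericDeriv_pow_eq_zero Set.infinite_univ fun y _ => h y, zero_sub,
    eq_comm, neg_add_eq_zero] at hexp
  have hlin : ((N : Polynomial K) + 1) •
      (genericDeriv ^ N) (dividedDiffDeriv x (map Polynomial.C F)) =
        (Polynomial.X - Polynomial.C x) • z (map Polynomial.C F) := by
    apply X_sub_C_smul_injective x
    simp only [smul_smul]
    rw [mul_comm, hexp, pow_two]
  have hinv : Polynomial.C ((N : K) + 1)⁻¹ * ((N : Polynomial K) + 1) = 1 := by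
    rw [← Polynomial.C_eq_natCast, ← Polynomial.C_1, ← Polynomial.C_add, ← Polynomial.C_mul,
      inv_mul_cancel₀ (Nat.cast_add_one_ne_zero N)]
  refine ⟨Polynomial.C ((N : K) + 1)⁻¹ • z (map Polynomial.C F), ?_⟩
  rw [smul_comm, ← hlin, smul_smul, hinv, one_smul]

theorem map_eval_dividedDiffDeriv (x : K) (G : MvPolynomial ℕ (Polynomial K)) :
    map (evalRingHom x) (dividedDiffDeriv x G) = tangentDeriv x (map (evalRingHom x) G) := by
  rw [dividedDiffDeriv, map_dirDeriv, tangentDeriv]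
  congr 2
  funext i
  have hterm (j : ℕ) (hj : j ∈ Finset.range i) : x ^ j * x ^ (i - 1 - j) = x ^ (i - 1) := by
    rw [← pow_add, Nat.add_sub_cancel' (Nat.le_sub_one_of_lt (Finset.mem_range.1 hj))]
  simp [Finset.sum_congr rfl hterm]

theorem tangentDeriv_dirDeriv_pow_eq_zero [CharZero K] {F : MvPolynomial ℕ K} {N : ℕ}
    (h : ∀ y, (dirDeriv (momentCurve y) ^ (N + 1)) F = 0) (x : K) :
    tangentDeriv x ((dirDeriv (momentCurve x) ^ N) F) = 0 := by
  obtain ⟨G, hG⟩ := exists_genericDeriv_pow_dividedDiffDeriv h x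
  have hcomm : Commute (genericDeriv ^ N) (dividedDiffDeriv x) :=
    (dirDeriv_commute _ _).pow_left N
  have hx := congrArg (map (evalRingHom x)) hG
  rw [← Module.End.mul_apply, hcomm.eq, Module.End.mul_apply, map_eval_dividedDiffDeriv,
    map_eval_genericDeriv_pow, MvPolynomial.smul_eq_C_mul, map_mul, map_C] at hx
  simpa using hx

theorem dvd_genericDeriv_pow_dirDeriv [CharZero K] {F : MvPolynomial ℕ K} {N : ℕ}
    (h : ∀ y, (dirDeriv (momentCurve y) ^ (N + 1)) F = 0) (x : K) :
    C ((Polynomial.X - Polynomial.C x) ^ 2) ∣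
      (genericDeriv ^ N) (map Polynomial.C (dirDeriv (momentCurve x) F)) := by
  obtain ⟨G, hG⟩ := exists_genericDeriv_pow_dividedDiffDeriv h x
  rw [map_C_dirDeriv_momentCurve, dirDeriv_momentCurve_C_eq_sub_smul, LinearMap.sub_apply,
    map_sub, ← Module.End.mul_apply, ← pow_succ,
    genericDeriv_pow_eq_zero Set.infinite_univ fun y _ => h y, LinearMap.smul_apply, map_smul,
    hG, smul_smul, MvPolynomial.smul_eq_C_mul, zero_sub, ← pow_two]
  exact (dvd_neg (α := MvPolynomial ℕ (Polynomial K))).2 (dvd_mul_right _ _)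

theorem dvd_genericDeriv_pow {F : MvPolynomial ℕ K} {x : K} {b : ℕ}
    (h : (dirDeriv (momentCurve x) ^ (b + 1)) F = 0) (N : ℕ) :
    C ((Polynomial.X - Polynomial.C x) ^ (N - b)) ∣
      (genericDeriv ^ N) (map Polynomial.C F) := by
  have hcomm : Commute (dirDeriv (momentCurve (Polynomial.C x)))
      ((Polynomial.X - Polynomial.C x) • dividedDiffDeriv x) :=
    (dirDeriv_commute _ _).smul_right _
  rw [genericDeriv_eq_add_smul x, hcomm.add_pow, LinearMap.sum_apply]
  refine Finset.dvd_sum fun m _ => ?_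
  rw [(hcomm.pow_pow _ _).eq, ← nsmul_eq_mul', LinearMap.smul_apply, Module.End.mul_apply,
    ← map_C_dirDeriv_momentCurve_pow]
  by_cases hmb : b + 1 ≤ m
  · obtain ⟨t, rfl⟩ := Nat.exists_eq_add_of_le' hmb
    rw [pow_add, Module.End.mul_apply, h, map_zero, map_zero, map_zero, smul_zero]
    exact dvd_zero _
  · rw [smul_pow, LinearMap.smul_apply, MvPolynomial.smul_eq_C_mul, nsmul_eq_mul]
    exact (dvd_mul_of_dvd_left (map_dvd _ (pow_dvd_pow _ (by omega))) _).mul_left _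

theorem natDegree_coeff_genericDeriv_pow {F : MvPolynomial ℕ K} {n : ℕ}
    (hF : F ∈ supported K {i | i ≤ n}) (N : ℕ) (m : ℕ →₀ ℕ) :
    (coeff m ((genericDeriv ^ N) (map Polynomial.C F))).natDegree ≤ n * N := by
  have hsupp : map Polynomial.C F ∈ supported (Polynomial K) {i | i ≤ n} := by
    rw [mem_supported] at hF ⊢
    exact (Finset.coe_subset.2 (vars_map _ _)).trans hF
  induction N generalizing m with
  | zero => simp [coeff_map]
  | succ N ih =>
    rw [pow_succ', Module.End.mul_apply, genericDeriv, dirDeriv_eq_sum_pderiv, coeff_sum]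
    refine Polynomial.natDegree_sum_le_of_forall_le _ _ fun i hi => ?_
    have hin : i ≤ n :=
      mem_supported.1 (dirDeriv_pow_mem_supported (momentCurve Polynomial.X) hsupp N) hi
    have hcast : ((m i : Polynomial K) + 1).natDegree = 0 :=
      mod_cast Polynomial.natDegree_natCast (m i + 1)
    rw [coeff_C_mul, coeff_pderiv, momentCurve]
    refine Polynomial.natDegree_mul_le.trans ?_
    rw [Polynomial.natDegree_X_pow, Nat.mul_succ, add_comm]
    refine Nat.add_le_add (Polynomial.natDegree_mul_le.trans ?_) hin
    rw [hcast, add_zero]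
    exact ih _

theorem dvd_genericDeriv_pow_dirDeriv_of_dvd [CharZero K] {N : ℕ} {F : MvPolynomial ℕ K}
    {w : Polynomial K} (h : ∀ y, (dirDeriv (momentCurve y) ^ (N + 1)) F = 0)
    (hdvd : C w ∣ (genericDeriv ^ N) (map Polynomial.C F)) {x : K} (hx : w.eval x ≠ 0) :
    C (w * (Polynomial.X - Polynomial.C x) ^ 2) ∣
      (genericDeriv ^ N) (map Polynomial.C (dirDeriv (momentCurve x) F)) := by
  have hcop : IsCoprime w ((Polynomial.X - Polynomial.C x) ^ 2) :=
    (((Polynomial.irreducible_X_sub_C x).coprime_iff_not_dvd.2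
      fun hd => hx (Polynomial.dvd_iff_isRoot.1 hd)).symm).pow_right
  rw [C_mul]
  refine (hcop.map (C : Polynomial K →+* MvPolynomial ℕ (Polynomial K))).mul_dvd ?_
    (dvd_genericDeriv_pow_dirDeriv h x)
  obtain ⟨G, hG⟩ := hdvd
  rw [← dirDeriv_genericDeriv_pow, hG, dirDeriv_C_mul]
  exact dvd_mul_right _ _

-- Each of the `e` further derivatives along the curve makes the coefficients divisible by two
-- more linear factors, until their degree is too small.
theorem genericDeriv_pow_eq_zero_of_dvd [CharZero K] {n N e : ℕ} {F : MvPolynomial ℕ K}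
    {w : Polynomial K} (hF : F.IsHomogeneous (e + N)) (hs : F ∈ supported K {i | i ≤ n})
    (h : ∀ y, (dirDeriv (momentCurve y) ^ (N + 1)) F = 0) (hw : w ≠ 0)
    (hdvd : C w ∣ (genericDeriv ^ N) (map Polynomial.C F))
    (hdeg : n * N < w.natDegree + 2 * e) : (genericDeriv ^ N) (map Polynomial.C F) = 0 := by
  induction e generalizing F w with
  | zero =>
    ext1 m
    refine Polynomial.eq_zero_of_dvd_of_natDegree_lt ((C_dvd_iff_dvd_coeff _ _).1 hdvd m) ?_
    exact (natDegree_coeff_genericDeriv_pow hs N m).trans_lt (by simpa using hdeg)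
  | succ e ih =>
    have hinf : (Polynomial.C '' {x : K | w.eval x ≠ 0}).Infinite :=
      (Polynomial.finite_setOfPred_isRoot hw).infinite_compl.image
        Polynomial.C_injective.injOn
    have hhom : ((genericDeriv ^ N) (map Polynomial.C F)).IsHomogeneous (e + 1) := by
      have h := isHomogeneous_dirDeriv_pow (momentCurve Polynomial.X) (hF.map Polynomial.C) N
      rwa [Nat.add_sub_cancel] at h
    refine eq_zero_of_dirDeriv_momentCurve hinf hhom e.succ_ne_zero ?_
    rintro _ ⟨x, hx, rfl⟩
    have hsq : (Polynomial.X - Polynomial.C x) ^ 2 ≠ 0 :=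
      pow_ne_zero _ (Polynomial.X_sub_C_ne_zero x)
    rw [dirDeriv_genericDeriv_pow]
    refine ih (w := w * (Polynomial.X - Polynomial.C x) ^ 2) ?_
      (dirDeriv_mem_supported _ hs) (fun y => ?_) (mul_ne_zero hw hsq)
      (dvd_genericDeriv_pow_dirDeriv_of_dvd h hdvd hx) ?_
    · simpa [add_right_comm] using isHomogeneous_dirDeriv (momentCurve x) hF
    · rw [← Module.End.mul_apply, ← ((dirDeriv_commute _ _).pow_right (N + 1)).eq,
        Module.End.mul_apply, h y, map_zero]
    · rw [Polynomial.natDegree_mul hw hsq, Polynomial.natDegree_pow, Polynomial.natDegree_X_sub_C]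
      omega

theorem prod_X_sub_C_pow_dvd_genericDeriv_pow {N : ℕ} {Λ : Finset K} {b : K → ℕ}
    {F : MvPolynomial ℕ K} (hb : ∀ l ∈ Λ, (dirDeriv (momentCurve l) ^ (b l + 1)) F = 0) :
    C (∏ l ∈ Λ, (Polynomial.X - Polynomial.C l) ^ (N - b l)) ∣
      (genericDeriv ^ N) (map Polynomial.C F) := by
  rw [map_prod]
  refine Finset.prod_dvd_of_coprime (fun l _ l' _ hne => ?_)
    fun l hl => dvd_genericDeriv_pow (hb l hl) N
  exact (Polynomial.isCoprime_X_sub_C_of_isUnit_sub (sub_ne_zero.2 hne).isUnit).pow.map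
    (C : Polynomial K →+* MvPolynomial ℕ (Polynomial K))

theorem dirDeriv_momentCurve_pow_eq_zero_of_lt [CharZero K] {n N d : ℕ} {Λ : Finset K}
    {b : K → ℕ} {F : MvPolynomial ℕ K} (hF : F.IsHomogeneous d)
    (hs : F ∈ supported K {i | i ≤ n})
    (hb : ∀ l ∈ Λ, (dirDeriv (momentCurve l) ^ (b l + 1)) F = 0)
    (h : ∀ y, (dirDeriv (momentCurve y) ^ (N + 1)) F = 0)
    (hlt : (n + 2) * N < 2 * d + ∑ l ∈ Λ, (N - b l)) (y : K) :
    (dirDeriv (momentCurve y) ^ N) F = 0 := by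
  rcases lt_or_ge d N with hd | hd
  · exact dirDeriv_pow_eq_zero _ hF hd
  obtain ⟨e, rfl⟩ := Nat.exists_eq_add_of_le' hd
  have hne (l : K) (_ : l ∈ Λ) : (Polynomial.X - Polynomial.C l) ^ (N - b l) ≠ 0 :=
    pow_ne_zero _ (Polynomial.X_sub_C_ne_zero l)
  rw [← map_eval_genericDeriv_pow, genericDeriv_pow_eq_zero_of_dvd hF hs h
    (Finset.prod_ne_zero_iff.2 hne) (prod_X_sub_C_pow_dvd_genericDeriv_pow hb), map_zero]
  rw [Polynomial.natDegree_prod _ _ hne]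
  simp only [Polynomial.natDegree_pow, Polynomial.natDegree_X_sub_C, mul_one]
  linarith

end GenericDeriv

/-! ### Linear forms and tangential projections -/

section LinearForm

variable {R : Type*} [CommRing R]

/-- The linear form in the moments attached to a polynomial in one variable: the linear map
that sends `X ^ i` to the `i`-th moment. -/
def linearForm : Polynomial R →ₗ[R] MvPolynomial ℕ R :=
  (Polynomial.basisMonomials R).constr R fun i => (X i : MvPolynomial ℕ R)

@[simp] theorem linearForm_X_pow (i : ℕ) :
    linearForm (Polynomial.X ^ i : Polynomial R) = X i := by
  have h := (Polynomial.basisMonomials R).constr_basis R (fun i => (X i : MvPolynomial ℕ R)) i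
  simp only [Polynomial.coe_basisMonomials, Polynomial.monomial_one_right_eq_X_pow] at h
  exact h

theorem linearForm_eq_sum (p : Polynomial R) :
    linearForm p = ∑ i ∈ p.support, p.coeff i • X i := by
  conv_lhs => rw [Polynomial.as_sum_support_C_mul_X_pow p]
  rw [map_sum]
  refine Finset.sum_congr rfl fun i _ => ?_
  rw [← Polynomial.smul_eq_C_mul, map_smul, linearForm_X_pow]

theorem polynomial_linearMap_congr {W : Type*} [AddCommMonoid W] [Module R W]
    {f g : Polynomial R →ₗ[R] W}
    (h : ∀ i, f (Polynomial.X ^ i) = g (Polynomial.X ^ i)) (p : Polynomial R) : f p = g p := by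
  refine LinearMap.congr_fun ((Polynomial.basisMonomials R).ext fun i => ?_) p
  simpa only [Polynomial.coe_basisMonomials, Polynomial.monomial_one_right_eq_X_pow] using h i

theorem dirDeriv_momentCurve_linearForm (y : R) (p : Polynomial R) :
    dirDeriv (momentCurve y) (linearForm p) = C (p.eval y) := by
  refine polynomial_linearMap_congr (f := (dirDeriv (momentCurve y)).comp linearForm)
    (g := (Algebra.linearMap R (MvPolynomial ℕ R)).comp (Polynomial.leval y)) (fun i => ?_) p
  simp [momentCurve, MvPolynomial.algebraMap_eq]

theorem tangentDeriv_linearForm (y : R) (p : Polynomial R) :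
    tangentDeriv y (linearForm p) = C (p.derivative.eval y) := by
  refine polynomial_linearMap_congr (f := (tangentDeriv y).comp linearForm)
    (g := (Algebra.linearMap R (MvPolynomial ℕ R)).comp
      ((Polynomial.leval y).comp Polynomial.derivative)) (fun i => ?_) p
  simp [tangentDeriv, MvPolynomial.algebraMap_eq, Polynomial.derivative_X_pow]

theorem isHomogeneous_linearForm (p : Polynomial R) : (linearForm p).IsHomogeneous 1 := by
  rw [linearForm_eq_sum]
  refine IsHomogeneous.sum _ _ _ fun i _ => ?_
  rw [MvPolynomial.smul_eq_C_mul]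
  exact isHomogeneous_C_mul_X _ _

theorem linearForm_mem_supported {p : Polynomial R} {s : Set ℕ}
    (h : ∀ i ≤ p.natDegree, i ∈ s) : linearForm p ∈ supported R s := by
  rw [linearForm_eq_sum, supported_eq_adjoin_X]
  exact sum_mem fun i hi => Subalgebra.smul_mem _ (Algebra.subset_adjoin
    (Set.mem_image_of_mem X (h i (Polynomial.le_natDegree_of_mem_supp i hi)))) _

end LinearForm

section Translate

variable {R : Type*} [CommRing R]

/-- The action on the moments of the translation by `c` of the parameter of the curve. -/
def translate (c : R) : MvPolynomial ℕ R →ₐ[R] MvPolynomial ℕ R :=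
  aeval fun j => linearForm ((Polynomial.X - Polynomial.C c) ^ j)

/-- The pull-back of forms under the projection from the tangent line of the curve at the
point `c`, which maps a moment curve onto a moment curve of degree two less. -/
def tangentProj (c : R) : MvPolynomial ℕ R →ₐ[R] MvPolynomial ℕ R :=
  aeval fun j => linearForm ((Polynomial.X - Polynomial.C c) ^ 2 * Polynomial.X ^ j)

theorem translate_X (c : R) (i : ℕ) :
    translate c (X i) = linearForm ((Polynomial.X - Polynomial.C c) ^ i) :=
  aeval_X _ _

theorem tangentProj_X (c : R) (i : ℕ) :
    tangentProj c (X i) =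
      linearForm ((Polynomial.X - Polynomial.C c) ^ 2 * Polynomial.X ^ i) :=
  aeval_X _ _

theorem translate_linearForm (c : R) (p : Polynomial R) :
    translate c (linearForm p) = linearForm (p.comp (Polynomial.X - Polynomial.C c)) := by
  refine (polynomial_linearMap_congr (f := (translate c).toLinearMap.comp linearForm)
    (g := linearForm.comp (Polynomial.aeval (R := R)
      (Polynomial.X - Polynomial.C c)).toLinearMap) (fun i => ?_) p).trans ?_
  · simp [translate_X]
  · rw [LinearMap.comp_apply, AlgHom.toLinearMap_apply, Polynomial.aeval_def, Polynomial.comp,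
      Polynomial.algebraMap_eq]

theorem tangentProj_linearForm (c : R) (p : Polynomial R) :
    tangentProj c (linearForm p) =
      linearForm ((Polynomial.X - Polynomial.C c) ^ 2 * p) := by
  have h := polynomial_linearMap_congr (f := (tangentProj c).toLinearMap.comp linearForm)
    (g := linearForm.comp (LinearMap.mulLeft R ((Polynomial.X - Polynomial.C c) ^ 2)))
    (fun i => by rw [LinearMap.comp_apply, linearForm_X_pow, AlgHom.toLinearMap_apply,
      tangentProj_X, LinearMap.comp_apply, LinearMap.mulLeft_apply]) p
  rwa [LinearMap.comp_apply, AlgHom.toLinearMap_apply, LinearMap.comp_apply,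
    LinearMap.mulLeft_apply] at h

theorem translate_translate_neg (c : R) (F : MvPolynomial ℕ R) :
    translate c (translate (-c) F) = F := by
  have h : (translate c).comp (translate (-c)) = AlgHom.id R _ :=
    MvPolynomial.algHom_ext fun i => by
      rw [AlgHom.comp_apply, translate_X, translate_linearForm]
      simp
  exact DFunLike.congr_fun h F

theorem translate_injective (c : R) : Function.Injective (translate c) :=
  Function.LeftInverse.injective (g := translate (-c)) fun F => by
    simpa using translate_translate_neg (-c) F

theorem tangentProj_translate (c : R) (F : MvPolynomial ℕ R) :
    tangentProj c (translate c F) = translate c (rename (· + 2) F) := by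
  have h : (tangentProj c).comp (translate c) = (translate c).comp (rename (· + 2)) :=
    MvPolynomial.algHom_ext fun i => by
      rw [AlgHom.comp_apply, AlgHom.comp_apply, rename_X, translate_X, tangentProj_linearForm,
        translate_X, ← pow_add, add_comm]
  exact DFunLike.congr_fun h F

theorem tangentProj_injective (c : R) : Function.Injective (tangentProj c) := by
  intro F G h
  rw [← translate_translate_neg c F, ← translate_translate_neg c G, tangentProj_translate,
    tangentProj_translate] at h
  rw [← translate_translate_neg c F, ← translate_translate_neg c G,
    rename_injective _ (add_left_injective 2) (translate_injective c h)]

theorem dirDeriv_tangentProj (y c : R) (F : MvPolynomial ℕ R) :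
    dirDeriv (momentCurve y) (tangentProj c F) =
      (y - c) ^ 2 • tangentProj c (dirDeriv (momentCurve y) F) := by
  induction F using MvPolynomial.induction_on with
  | C a => simp [tangentProj]
  | add F G hF hG => simp only [map_add, hF, hG, smul_add]
  | mul_X F i h =>
    rw [map_mul, dirDeriv_mul, h, dirDeriv_mul, map_add, map_mul, map_mul, tangentProj_X,
      dirDeriv_momentCurve_linearForm, dirDeriv_X, algHom_C, MvPolynomial.algebraMap_eq,
      MvPolynomial.smul_eq_C_mul, MvPolynomial.smul_eq_C_mul]
    simp only [Polynomial.eval_mul, Polynomial.eval_pow, Polynomial.eval_sub, Polynomial.eval_X,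
      Polynomial.eval_C, C_mul, momentCurve]
    ring

theorem dirDeriv_pow_tangentProj (y c : R) (j : ℕ) (F : MvPolynomial ℕ R) :
    (dirDeriv (momentCurve y) ^ j) (tangentProj c F) =
      ((y - c) ^ 2) ^ j • tangentProj c ((dirDeriv (momentCurve y) ^ j) F) := by
  induction j with
  | zero => simp
  | succ j ih =>
    rw [pow_succ', Module.End.mul_apply, ih, map_smul, dirDeriv_tangentProj, smul_smul,
      ← pow_succ, ← Module.End.mul_apply]

theorem dirDeriv_translate {a a' : ℕ → R} {c : R}
    (h : ∀ i, dirDeriv a (linearForm ((Polynomial.X - Polynomial.C c) ^ i)) = C (a' i))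
    (F : MvPolynomial ℕ R) : dirDeriv a (translate c F) = translate c (dirDeriv a' F) := by
  induction F using MvPolynomial.induction_on with
  | C a => simp [translate]
  | add F G hF hG => simp only [map_add, hF, hG]
  | mul_X F i hF =>
    rw [map_mul, dirDeriv_mul, hF, dirDeriv_mul, map_add, map_mul, map_mul, dirDeriv_X,
      translate_X, h, algHom_C, MvPolynomial.algebraMap_eq]

theorem dirDeriv_momentCurve_translate (c y : R) (F : MvPolynomial ℕ R) :
    dirDeriv (momentCurve y) (translate c F) =
      translate c (dirDeriv (momentCurve (y - c)) F) :=
  dirDeriv_translate (fun i => by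
    rw [dirDeriv_momentCurve_linearForm]
    simp [momentCurve]) F

theorem tangentDeriv_translate (c y : R) (F : MvPolynomial ℕ R) :
    tangentDeriv y (translate c F) = translate c (tangentDeriv (y - c) F) :=
  dirDeriv_translate (fun i => by
    rw [← tangentDeriv, tangentDeriv_linearForm]
    simp [Polynomial.derivative_pow]) F

theorem aeval_mem_of_mem_supported {σ τ : Type*} {s : Set σ} {g : σ → MvPolynomial τ R}
    {T : Subalgebra R (MvPolynomial τ R)} (hg : ∀ i ∈ s, g i ∈ T) {F : MvPolynomial σ R}
    (hF : F ∈ supported R s) : aeval g F ∈ T := by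
  have hle : supported R s ≤ T.comap (aeval g) := by
    rw [supported_eq_adjoin_X, Algebra.adjoin_le_iff]
    rintro _ ⟨i, hi, rfl⟩
    simpa using hg i hi
  exact hle hF

theorem isHomogeneous_aeval_linear {σ τ : Type*} {F : MvPolynomial σ R} {d : ℕ}
    (hF : F.IsHomogeneous d) {g : σ → MvPolynomial τ R} (hg : ∀ i, (g i).IsHomogeneous 1) :
    (aeval g F).IsHomogeneous d := by
  simpa only [one_mul] using hF.aeval g hg

theorem isHomogeneous_translate (c : R) {F : MvPolynomial ℕ R} {d : ℕ}
    (hF : F.IsHomogeneous d) : (translate c F).IsHomogeneous d :=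
  isHomogeneous_aeval_linear hF fun _ => isHomogeneous_linearForm _

theorem translate_mem_supported (c : R) {F : MvPolynomial ℕ R} {q : ℕ}
    (hF : F ∈ supported R {i | i + 2 ≤ q}) : translate c F ∈ supported R {i | i + 2 ≤ q} := by
  refine aeval_mem_of_mem_supported (fun i hi => linearForm_mem_supported fun j hj => ?_) hF
  have hdeg : ((Polynomial.X - Polynomial.C c) ^ i).natDegree ≤ i :=
    Polynomial.natDegree_pow_le_of_le i (Polynomial.natDegree_X_sub_C_le c) |>.trans
      (mul_one i).le
  simp only [Set.mem_ofPred_eq] at hi ⊢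
  omega

theorem mem_vars_of_add_mem_vars_rename {i k : ℕ} {F : MvPolynomial ℕ R} (hi : i ∈ F.vars) :
    i + k ∈ (rename (· + k) F).vars := by
  rw [vars_def, Multiset.mem_toFinset] at hi ⊢
  rw [degrees_rename_of_injective (add_left_injective k)]
  exact Multiset.mem_map_of_mem _ hi

theorem mem_supported_two_le [NoZeroDivisors R] [CharZero R] {G : MvPolynomial ℕ R}
    (h0 : dirDeriv (momentCurve 0) G = 0) (h1 : tangentDeriv 0 G = 0) :
    G ∈ supported R {i | 2 ≤ i} := by
  have e0 : momentCurve (0 : R) = Pi.single 0 1 := by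
    funext i
    rcases i with _ | i <;> simp [momentCurve]
  have e1 : (fun i : ℕ => (i : R) * 0 ^ (i - 1)) = Pi.single 1 1 := by
    funext i
    rcases i with _ | _ | i <;> simp
  rw [e0, dirDeriv_single] at h0
  rw [tangentDeriv, e1, dirDeriv_single] at h1
  rw [mem_supported]
  intro i hi
  rcases i with _ | _ | i
  · exact absurd hi (notMem_vars_of_pderiv_eq_zero h0)
  · exact absurd hi (notMem_vars_of_pderiv_eq_zero h1)
  · exact Nat.le_add_left 2 i

theorem exists_tangentProj_eq [NoZeroDivisors R] [CharZero R] {G : MvPolynomial ℕ R} {c : R}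
    {q d : ℕ} (hG : G.IsHomogeneous d) (hs : G ∈ supported R {i | i + 2 ≤ q})
    (h0 : dirDeriv (momentCurve c) G = 0) (h1 : tangentDeriv c G = 0) :
    ∃ F, tangentProj c F = G ∧ F.IsHomogeneous d ∧ F ∈ supported R {i | i + 2 ≤ q - 2} := by
  have hvars : translate (-c) G ∈ supported R {i | 2 ≤ i} := mem_supported_two_le
    (by rw [dirDeriv_momentCurve_translate, zero_sub, neg_neg, h0, map_zero])
    (by rw [tangentDeriv_translate, zero_sub, neg_neg, h1, map_zero])
  obtain ⟨F, hF⟩ := exists_rename_eq_of_vars_subset_range (translate (-c) G) (· + 2)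
    (add_left_injective 2) fun i hi => ⟨i - 2, Nat.sub_add_cancel (mem_supported.1 hvars hi)⟩
  refine ⟨translate c F, ?_, ?_, translate_mem_supported c ?_⟩
  · rw [tangentProj_translate, hF, translate_translate_neg]
  · refine isHomogeneous_translate c ?_
    rw [← IsHomogeneous.rename_isHomogeneous_iff (add_left_injective 2), hF]
    exact isHomogeneous_translate (-c) hG
  · rw [mem_supported]
    intro i hi
    have hq := mem_supported.1 (translate_mem_supported (-c) hs)
      (hF ▸ mem_vars_of_add_mem_vars_rename (k := 2) hi)
    simp only [Set.mem_ofPred_eq] at hq ⊢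
    omega

end Translate

/-! ### Hankel determinants -/

section Hankel

variable {R : Type*} [CommRing R]

/-- The determinant of the Hankel matrix of size `k` of the moments with weight `f`. The roots of
`f` on the curve are extra conditions: for `f = 1` this is the equation of the variety of
`(k - 1)`-secants of the curve of degree `2 * k - 2`. -/
def hankel (k : ℕ) (f : Polynomial R) : MvPolynomial ℕ R :=
  Matrix.det (Matrix.of fun i j : Fin k => linearForm (f * Polynomial.X ^ (i + j : ℕ)))

@[simp] theorem hankel_zero (f : Polynomial R) : hankel 0 f = 1 := by simp [hankel]

theorem isHomogeneous_hankel (k : ℕ) (f : Polynomial R) : (hankel k f).IsHomogeneous k := by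
  rw [hankel, Matrix.det_apply]
  refine IsHomogeneous.sum _ _ _ fun σ _ => ?_
  have hprod : (∏ i : Fin k, linearForm (f * Polynomial.X ^ (σ i + i : ℕ))).IsHomogeneous k := by
    simpa using IsHomogeneous.prod Finset.univ _ (fun _ : Fin k => 1) fun i _ =>
      isHomogeneous_linearForm (f * Polynomial.X ^ (σ i + i : ℕ))
  rcases Int.units_eq_one_or (Equiv.Perm.sign σ) with h | h <;> rw [h]
  · simpa using hprod
  · simpa using hprod.neg

theorem det_mem_subalgebra {A n : Type*} [CommRing A] [Algebra R A] [Fintype n] [DecidableEq n]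
    {T : Subalgebra R A} {M : Matrix n n A} (hM : ∀ i j, M i j ∈ T) : M.det ∈ T := by
  rw [Matrix.det_apply']
  exact sum_mem fun σ _ => mul_mem (intCast_mem _ _) (prod_mem fun i _ => hM _ _)

theorem hankel_mem_supported {k q : ℕ} {f : Polynomial R} (h : f.natDegree + 2 * k ≤ q) :
    hankel k f ∈ supported R {i | i + 2 ≤ q} := by
  refine det_mem_subalgebra fun i j => linearForm_mem_supported fun m hm => ?_
  have hdeg := hm.trans (Polynomial.natDegree_mul_le.trans
    (Nat.add_le_add_left (Polynomial.natDegree_X_pow_le _) _))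
  have := i.2
  have := j.2
  simp only [Set.mem_ofPred_eq]
  omega

theorem tangentProj_hankel (c : R) (k : ℕ) (f : Polynomial R) :
    tangentProj c (hankel k f) = hankel k ((Polynomial.X - Polynomial.C c) ^ 2 * f) := by
  rw [hankel, AlgHom.map_det, hankel]
  congr 1
  ext1 i j
  simp only [AlgHom.mapMatrix_apply, Matrix.map_apply, Matrix.of_apply, tangentProj_linearForm,
    mul_assoc]

theorem linearForm_C_mul (y : R) (p : Polynomial R) :
    linearForm (Polynomial.C y * p) = C y * linearForm p := by
  rw [← Polynomial.smul_eq_C_mul, map_smul, MvPolynomial.smul_eq_C_mul]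

/-- The basis `1, X - y, (X - y) X, (X - y) X ^ 2, …` of `R[X]`, in which all elements but the
first vanish at `y`. -/
def pointBasis (y : R) : ℕ → Polynomial R
  | 0 => 1
  | i + 1 => (Polynomial.X - Polynomial.C y) * Polynomial.X ^ i

theorem hankel_eq_det_pointBasis (y : R) (k : ℕ) (f : Polynomial R) :
    hankel k f = Matrix.det (Matrix.of fun i j : Fin k =>
      linearForm (f * pointBasis y i * pointBasis y j)) := by
  rcases k with _ | k
  · simp [hankel]
  have hstep (p : Polynomial R) (i : ℕ) : linearForm (p * Polynomial.X ^ (i + 1)) =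
      linearForm (p * pointBasis y (i + 1)) + C y * linearForm (p * Polynomial.X ^ i) := by
    rw [← linearForm_C_mul, ← map_add, pointBasis]
    exact congrArg linearForm (by ring)
  rw [hankel, Matrix.det_eq_of_forall_row_eq_smul_add_pred
    (B := Matrix.of fun i j : Fin (k + 1) =>
      linearForm (f * pointBasis y i * Polynomial.X ^ (j : ℕ)))
    (fun _ => C y), Matrix.det_eq_of_forall_col_eq_smul_add_pred (fun _ => C y)]
  · intro i
    simp [pointBasis]
  · intro i j
    exact hstep _ _
  · intro i
    simp [pointBasis]
  · intro i j
    simp only [Matrix.of_apply, Fin.val_succ, Fin.val_castSucc, pointBasis, ← linearForm_C_mul,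
      ← map_add]
    exact congrArg linearForm (by ring)

theorem dirDeriv_det_eq_zero {σ n : Type*} [Fintype n] [DecidableEq n] {a : σ → R}
    {M : Matrix n n (MvPolynomial σ R)} (h : ∀ i j, dirDeriv a (M i j) = 0) :
    dirDeriv a M.det = 0 := by
  let T : Subalgebra R (MvPolynomial σ R) :=
    { carrier := {F | dirDeriv a F = 0}
      mul_mem' := fun {F G} hF hG => by
        rw [Set.mem_ofPred_eq] at hF hG ⊢
        rw [dirDeriv_mul, hF, hG, mul_zero, zero_mul, add_zero]
      add_mem' := fun {F G} hF hG => by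
        rw [Set.mem_ofPred_eq] at hF hG ⊢
        rw [map_add, hF, hG, add_zero]
      algebraMap_mem' := dirDeriv_C a }
  exact det_mem_subalgebra (T := T) h

-- In the basis adapted to `y`, the derivative kills all entries but the top left one.
theorem dirDeriv_hankel_succ (y : R) (k : ℕ) (f : Polynomial R) :
    dirDeriv (momentCurve y) (hankel (k + 1) f) =
      C (f.eval y) * hankel k ((Polynomial.X - Polynomial.C y) ^ 2 * f) := by
  have hentry (i j : ℕ) (hj : j ≠ 0) :
      dirDeriv (momentCurve y) (linearForm (f * pointBasis y i * pointBasis y j)) = 0 := by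
    obtain ⟨j, rfl⟩ := Nat.exists_eq_succ_of_ne_zero hj
    simp [dirDeriv_momentCurve_linearForm, pointBasis]
  rw [hankel_eq_det_pointBasis y, Matrix.det_succ_row_zero, map_sum, Finset.sum_eq_single 0]
  · rw [dirDeriv_mul, dirDeriv_det_eq_zero, hankel]
    · simp only [Fin.val_zero, pow_zero, one_mul, mul_zero, zero_add, Matrix.of_apply, pointBasis,
        mul_one, dirDeriv_momentCurve_linearForm]
      refine congrArg _ (congrArg Matrix.det (Matrix.ext fun i j => ?_))
      simp only [Matrix.submatrix_apply, Matrix.of_apply, Fin.succAbove_zero, Fin.val_succ]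
      exact congrArg linearForm (by ring)
    · exact fun i j => hentry _ _ (by simp)
  · intro j _ hj
    have hsign : ((-1) ^ (j : ℕ) : MvPolynomial ℕ R) = C ((-1) ^ (j : ℕ)) := by simp
    rw [hsign, mul_assoc, dirDeriv_C_mul, dirDeriv_mul, dirDeriv_det_eq_zero, Matrix.of_apply,
      hentry _ _ (Fin.val_ne_zero_iff.2 hj), mul_zero, zero_mul, add_zero, mul_zero]
    intro i m
    rw [Matrix.submatrix_apply, Matrix.of_apply, mul_right_comm]
    exact hentry _ _ (by simp)
  · simp

theorem dirDeriv_hankel_eq_zero {y : R} {f : Polynomial R} (k : ℕ) (h : f.eval y = 0) :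
    dirDeriv (momentCurve y) (hankel k f) = 0 := by
  rcases k with _ | k
  · rw [hankel_zero, ← C_1, dirDeriv_C]
  · rw [dirDeriv_hankel_succ, h, C_0, zero_mul]

theorem dirDeriv_dirDeriv_hankel (y : R) (k : ℕ) (f : Polynomial R) :
    dirDeriv (momentCurve y) (dirDeriv (momentCurve y) (hankel k f)) = 0 := by
  rcases k with _ | k
  · rw [hankel_zero, ← C_1, dirDeriv_C, map_zero]
  · rw [dirDeriv_hankel_succ, dirDeriv_C_mul, dirDeriv_hankel_eq_zero k (by simp), mul_zero]

theorem hankel_ne_zero [IsDomain R] [Infinite R] (k : ℕ) {f : Polynomial R} (hf : f ≠ 0) :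
    hankel k f ≠ 0 := by
  induction k generalizing f with
  | zero => simp
  | succ k ih =>
    intro h
    obtain ⟨y, hy⟩ := (Polynomial.finite_setOfPred_isRoot hf).infinite_compl.nonempty
    have hD := congrArg (dirDeriv (momentCurve y)) h
    rw [dirDeriv_hankel_succ, map_zero] at hD
    exact mul_ne_zero ((map_ne_zero_iff _ (C_injective _ _)).2 hy)
      (ih (mul_ne_zero (pow_ne_zero _ (Polynomial.X_sub_C_ne_zero y)) hf)) hD

theorem exists_hankel_mul_X_sub_C_eq_sum (k : ℕ) (f : Polynomial R) :
    ∃ a : ℕ → MvPolynomial ℕ R, ∀ s : R,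
      hankel k (f * (Polynomial.X - Polynomial.C s)) =
        ∑ i ∈ Finset.range (k + 1), s ^ i • a i := by
  set A : Matrix (Fin k) (Fin k) (MvPolynomial ℕ R) :=
    Matrix.of fun i j => linearForm (-(f * Polynomial.X ^ (i + j : ℕ))) with hA
  set B : Matrix (Fin k) (Fin k) (MvPolynomial ℕ R) :=
    Matrix.of fun i j => linearForm (f * Polynomial.X * Polynomial.X ^ (i + j : ℕ)) with hB
  set P : Polynomial (MvPolynomial ℕ R) :=
    Matrix.det ((Polynomial.X : Polynomial (MvPolynomial ℕ R)) • A.map Polynomial.C +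
      B.map Polynomial.C) with hP
  have hdeg : P.natDegree ≤ k := by simpa using Polynomial.natDegree_det_X_add_C_le A B
  refine ⟨P.coeff, fun s => ?_⟩
  have heval : hankel k (f * (Polynomial.X - Polynomial.C s)) = P.eval (C s) := by
    rw [hP, ← Polynomial.coe_evalRingHom, RingHom.map_det, hankel]
    refine congrArg Matrix.det (Matrix.ext fun i j => ?_)
    simp only [RingHom.mapMatrix_apply, Matrix.map_apply, Matrix.of_apply, Matrix.add_apply,
      Matrix.smul_apply, smul_eq_mul, hA, hB, Polynomial.coe_evalRingHom, Polynomial.eval_add,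
      Polynomial.eval_mul, Polynomial.eval_X, Polynomial.eval_C]
    rw [← linearForm_C_mul, ← map_add]
    exact congrArg linearForm (by ring)
  rw [heval, Polynomial.eval_eq_sum_range' (Nat.lt_succ_of_le hdeg)]
  refine Finset.sum_congr rfl fun i _ => ?_
  rw [MvPolynomial.smul_eq_C_mul, C_pow, mul_comm]

theorem sum_pow_smul_mem_span_image {K V : Type*} [Field K] [AddCommGroup V] [Module K V]
    (a : ℕ → V) (c : K) {k : ℕ} {S : Finset K} (hS : k < S.card) :
    ∑ i ∈ Finset.range (k + 1), c ^ i • a i ∈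
      Submodule.span K ((fun s : K => ∑ i ∈ Finset.range (k + 1), s ^ i • a i) '' S) := by
  classical
  have hlagrange (i : ℕ) (hi : i ∈ Finset.range (k + 1)) :
      c ^ i = ∑ s ∈ S, (Lagrange.basis S id s).eval c * s ^ i := by
    have hdeg : (Polynomial.X ^ i : Polynomial K).degree < S.card := by
      rw [Polynomial.degree_X_pow]
      exact_mod_cast (Nat.lt_succ_iff.1 (Finset.mem_range.1 hi)).trans_lt hS
    have h := congrArg (Polynomial.eval c)
      (Lagrange.eq_interpolate (v := id) Function.injective_id.injOn hdeg)
    rw [Lagrange.interpolate_apply] at h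
    simpa [Polynomial.eval_finsetSum, mul_comm] using h
  have hsum : ∑ i ∈ Finset.range (k + 1), c ^ i • a i =
      ∑ s ∈ S, (Lagrange.basis S id s).eval c •
        ∑ i ∈ Finset.range (k + 1), s ^ i • a i := by
    rw [Finset.sum_congr rfl fun i hi => by rw [hlagrange i hi, Finset.sum_smul],
      Finset.sum_comm]
    simp only [mul_smul, Finset.smul_sum]
  rw [hsum]
  exact sum_mem fun s hs => Submodule.smul_mem _ _ (Submodule.subset_span ⟨s, hs, rfl⟩)

theorem hankel_mem_span_image {K : Type*} [Field K] (k : ℕ) (f : Polynomial K) (c : K)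
    {S : Finset K} (hS : k < S.card) :
    hankel k (f * (Polynomial.X - Polynomial.C c)) ∈
      Submodule.span K ((fun s => hankel k (f * (Polynomial.X - Polynomial.C s))) '' S) := by
  obtain ⟨a, ha⟩ := exists_hankel_mul_X_sub_C_eq_sum k f
  simpa only [ha] using sum_pow_smul_mem_span_image a c hS

end Hankel

section DirDerivProd

variable {σ R : Type*} [CommRing R] {a : σ → R}

theorem dirDeriv_pow_succ_mul {F : MvPolynomial σ R} (hF : dirDeriv a (dirDeriv a F) = 0)
    (m : ℕ) (G : MvPolynomial σ R) :
    (dirDeriv a ^ (m + 1)) (F * G) = F * (dirDeriv a ^ (m + 1)) G +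
      ((m : MvPolynomial σ R) + 1) * (dirDeriv a F * (dirDeriv a ^ m) G) := by
  induction m with
  | zero => simp [dirDeriv_mul]
  | succ m ih =>
    have hcast : (m : MvPolynomial σ R) + 1 = C ((m : R) + 1) := by simp
    rw [pow_succ', Module.End.mul_apply, ih, map_add, dirDeriv_mul, hcast, dirDeriv_C_mul,
      dirDeriv_mul _ (dirDeriv a F), hF, pow_succ' _ m]
    simp only [Module.End.mul_apply, Nat.cast_add, Nat.cast_one, C_add, C_1, map_natCast]
    ring

theorem dirDeriv_pow_mul_of_eq_zero {F : MvPolynomial σ R} (hF : dirDeriv a F = 0) (m : ℕ)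
    (G : MvPolynomial σ R) : (dirDeriv a ^ m) (F * G) = F * (dirDeriv a ^ m) G := by
  rcases m with _ | m
  · rfl
  · rw [dirDeriv_pow_succ_mul (by rw [hF, map_zero]), hF]
    ring

theorem dirDeriv_pow_prod_eq_zero {ι : Type*} {s t : Finset ι} {P : ι → MvPolynomial σ R}
    (hP : ∀ j ∈ s, dirDeriv a (dirDeriv a (P j)) = 0)
    (ht : ∀ j ∈ s, dirDeriv a (P j) ≠ 0 → j ∈ t) {m : ℕ} (hm : t.card < m) :
    (dirDeriv a ^ m) (∏ j ∈ s, P j) = 0 := by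
  classical
  induction s using Finset.induction_on generalizing m t with
  | empty =>
    rw [Finset.prod_empty]
    exact dirDeriv_pow_eq_zero a (isHomogeneous_one _ _) (Nat.zero_lt_of_lt hm)
  | insert i s hi ih =>
    have hs (j : ι) (hj : j ∈ s) := hP j (Finset.mem_insert_of_mem hj)
    have hts (j : ι) (hj : j ∈ s) := ht j (Finset.mem_insert_of_mem hj)
    rw [Finset.prod_insert hi]
    by_cases h0 : dirDeriv a (P i) = 0
    · rw [dirDeriv_pow_mul_of_eq_zero h0, ih hs hts hm, mul_zero]
    · have hit := Finset.card_erase_add_one (ht i (Finset.mem_insert_self i s) h0)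
      obtain ⟨m, rfl⟩ := Nat.exists_eq_add_of_le' (Nat.one_le_of_lt hm)
      rw [dirDeriv_pow_succ_mul (hP i (Finset.mem_insert_self i s)), ih hs hts hm,
        ih (t := t.erase i) hs (fun j hj h => Finset.mem_erase.2
          ⟨ne_of_mem_of_not_mem hj hi, hts j hj h⟩) (by omega)]
      ring

theorem dirDeriv_pow_card_prod {ι : Type*} (s : Finset ι) {P : ι → MvPolynomial σ R}
    (hP : ∀ j ∈ s, dirDeriv a (dirDeriv a (P j)) = 0) :
    (dirDeriv a ^ s.card) (∏ j ∈ s, P j) = (s.card.factorial : MvPolynomial σ R) *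
      ∏ j ∈ s, dirDeriv a (P j) := by
  classical
  induction s using Finset.induction_on with
  | empty => simp
  | insert i s hi ih =>
    have hs (j : ι) (hj : j ∈ s) := hP j (Finset.mem_insert_of_mem hj)
    rw [Finset.prod_insert hi, Finset.card_insert_of_notMem hi,
      dirDeriv_pow_succ_mul (hP i (Finset.mem_insert_self i s)), ih hs,
      dirDeriv_pow_prod_eq_zero hs (fun j hj _ => hj) (Nat.lt_succ_self _),
      Finset.prod_insert hi, Nat.factorial_succ]
    push_cast
    ring

end DirDerivProd

/-! ### Exchange of roots -/

section Exchange

variable {ι α : Type*} [DecidableEq α]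

/-- The family obtained from `I` by replacing the element `c` of `I j` by `s`. -/
def exchange [DecidableEq ι] (I : ι → Finset α) (j : ι) (c s : α) : ι → Finset α :=
  Function.update I j (insert s ((I j).erase c))

theorem card_exchange [DecidableEq ι] {I : ι → Finset α} {j : ι} {c s : α} (hc : c ∈ I j)
    (hs : s ∉ I j) (i : ι) : (exchange I j c s i).card = (I i).card := by
  rcases eq_or_ne i j with rfl | hij
  · rw [exchange, Function.update_self, Finset.card_insert_of_notMem
      fun h => hs (Finset.mem_of_mem_erase h), Finset.card_erase_add_one hc]
  · rw [exchange, Function.update_of_ne hij]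

variable [Fintype ι]

/-- The number of members of the family `I` that contain `l`. -/
def incidence (I : ι → Finset α) (l : α) : ℕ :=
  (Finset.univ.filter fun j => l ∈ I j).card

theorem card_filter_notMem_add_incidence (I : ι → Finset α) (l : α) :
    (Finset.univ.filter fun j => l ∉ I j).card + incidence I l = Fintype.card ι := by
  rw [incidence, add_comm, Finset.card_filter_add_card_filter_not, Finset.card_univ]

theorem sum_card_inter (I : ι → Finset α) (Λ : Finset α) :
    ∑ j, (I j ∩ Λ).card = ∑ l ∈ Λ, incidence I l := by
  simp only [incidence, Finset.card_filter]
  rw [Finset.sum_comm]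
  refine Finset.sum_congr rfl fun j _ => ?_
  rw [← Finset.card_filter, Finset.inter_comm, Finset.filter_mem_eq_inter]

theorem sum_incidence_add_sum_card_sdiff (I : ι → Finset α) (Λ : Finset α) :
    ∑ l ∈ Λ, incidence I l + ∑ j, (I j \ Λ).card = ∑ j, (I j).card := by
  rw [← sum_card_inter, ← Finset.sum_add_distrib]
  exact Finset.sum_congr rfl fun j _ => Finset.card_inter_add_card_sdiff _ _

theorem incidence_exchange [DecidableEq ι] {I : ι → Finset α} {j : ι} {c s : α} (hc : c ∈ I j)
    (hs : s ∉ I j) (l : α) : incidence (exchange I j c s) l + (if l = c then 1 else 0) =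
      incidence I l + if l = s then 1 else 0 := by
  have hsplit (J : ι → Finset α) : incidence J l = (if l ∈ J j then 1 else 0) +
      ∑ i ∈ Finset.univ.erase j, if l ∈ J i then 1 else 0 := by
    rw [incidence, Finset.card_filter,
      Finset.add_sum_erase _ (fun i => if l ∈ J i then 1 else 0) (Finset.mem_univ j)]
  have hother : ∑ i ∈ Finset.univ.erase j, (if l ∈ exchange I j c s i then 1 else 0) =
      ∑ i ∈ Finset.univ.erase j, if l ∈ I i then 1 else 0 :=
    Finset.sum_congr rfl fun i hi => by
      rw [exchange, Function.update_of_ne (Finset.ne_of_mem_erase hi)]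
  have hself : (if l ∈ exchange I j c s j then 1 else 0) + (if l = c then 1 else 0) =
      (if l ∈ I j then 1 else 0) + if l = s then 1 else 0 := by
    have hcs : c ≠ s := fun h => hs (h ▸ hc)
    rw [exchange, Function.update_self]
    rcases eq_or_ne l c with rfl | hlc
    · simp [hc, hcs]
    rcases eq_or_ne l s with rfl | hls
    · simp [hs, hlc]
    · simp [hlc, hls]
  rw [hsplit, hsplit I, hother]
  omega

theorem incidence_cons {N : ℕ} (J : Finset α) (I : Fin N → Finset α) (l : α) :
    incidence (Fin.cons J I : Fin (N + 1) → Finset α) l =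
      (if l ∈ J then 1 else 0) + incidence I l := by
  simp only [incidence, Finset.card_filter, Fin.sum_univ_succ, Fin.cons_zero, Fin.cons_succ]

end Exchange

section HankelProd

variable {K ι : Type*} [Field K] [Fintype ι]

/-- The product of the Hankel determinants of sizes `k j` whose weights have the simple roots
`I j`. -/
def hankelProd (k : ι → ℕ) (I : ι → Finset K) : MvPolynomial ℕ K :=
  ∏ j, hankel (k j) (Lagrange.nodal (I j) id)

variable [DecidableEq K] [DecidableEq ι]

theorem hankelProd_mem_span_exchange (k : ι → ℕ) (I : ι → Finset K) {j : ι} {c : K}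
    (hc : c ∈ I j) {S : Finset K} (hS : Disjoint S (I j)) (hk : k j < S.card) :
    hankelProd k I ∈ Submodule.span K ((fun s => hankelProd k (exchange I j c s)) '' S) := by
  set f := Lagrange.nodal ((I j).erase c) id with hf
  set P := ∏ i ∈ Finset.univ.erase j, hankel (k i) (Lagrange.nodal (I i) id)
  have hI : hankelProd k I = hankel (k j) (f * (Polynomial.X - Polynomial.C c)) * P := by
    rw [hankelProd, ← Finset.mul_prod_erase _ _ (Finset.mem_univ j), hf, mul_comm _ (_ - _),
      Lagrange.nodal_eq_mul_nodal_erase hc]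
    rfl
  have hexchange (s : K) (hs : s ∈ S) : hankelProd k (exchange I j c s) =
      hankel (k j) (f * (Polynomial.X - Polynomial.C s)) * P := by
    have hs' : s ∉ (I j).erase c := fun h =>
      Finset.disjoint_left.1 hS hs (Finset.mem_of_mem_erase h)
    rw [hankelProd, ← Finset.mul_prod_erase _ _ (Finset.mem_univ j), exchange,
      Function.update_self, Lagrange.nodal_insert_eq_nodal hs', mul_comm (_ - _)]
    refine congrArg _ (Finset.prod_congr rfl fun i hi => ?_)
    rw [Function.update_of_ne (Finset.ne_of_mem_erase hi)]
  have hmem := Submodule.mem_map_of_mem (f := LinearMap.mulRight K P)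
    (hankel_mem_span_image (k j) f c hk)
  rw [Submodule.map_span, Set.image_image] at hmem
  rw [hI, Set.image_congr hexchange]
  exact hmem

theorem hankelProd_mem_span_of_exchange {k : ι → ℕ} {P Q : (ι → Finset K) → Prop}
    (μ : (ι → Finset K) → ℕ)
    (step : ∀ I, P I → ¬ Q I → ∃ (j : ι) (c : K) (S : Finset K), c ∈ I j ∧ Disjoint S (I j) ∧
      k j < S.card ∧ ∀ s ∈ S, P (exchange I j c s) ∧ μ (exchange I j c s) < μ I)
    {I : ι → Finset K} (hI : P I) :
    hankelProd k I ∈ Submodule.span K {F | ∃ I', P I' ∧ Q I' ∧ F = hankelProd k I'} := by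
  induction hm : μ I using Nat.strong_induction_on generalizing I with
  | _ m ih =>
  by_cases hQ : Q I
  · exact Submodule.subset_span ⟨I, hI, hQ, rfl⟩
  obtain ⟨j, c, S, hc, hS, hk, hstep⟩ := step I hI hQ
  refine Submodule.span_le.2 ?_ (hankelProd_mem_span_exchange k I hc hS hk)
  rintro _ ⟨s, hs, rfl⟩
  obtain ⟨hPs, hμ⟩ := hstep s hs
  exact ih _ (hm ▸ hμ) hPs rfl

end HankelProd

section Configuration

variable {K : Type*} [Field K]

/-- The forms of degree `d` in the first `q - 1` moments which have degree at most `b l` along the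
point `l` of the curve, for `l ∈ Λ`, and degree at most `N` along every point of the curve. For
`n + 1 = q - 1` moments, having degree at most `b` along a point of `ℙ^n` means vanishing to order
at least `d - b` there. -/
def admissible (q N d : ℕ) (Λ : Finset K) (b : K → ℕ) : Submodule K (MvPolynomial ℕ K) where
  carrier := {F | F.IsHomogeneous d ∧ F ∈ supported K {i | i + 2 ≤ q} ∧
    (∀ l ∈ Λ, (dirDeriv (momentCurve l) ^ (b l + 1)) F = 0) ∧
    ∀ y, (dirDeriv (momentCurve y) ^ (N + 1)) F = 0}
  zero_mem' := ⟨isHomogeneous_zero _ _ _, zero_mem _, fun _ _ => map_zero _, fun _ => map_zero _⟩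
  add_mem' := by
    rintro F G ⟨hF, hFs, hFb, hFN⟩ ⟨hG, hGs, hGb, hGN⟩
    exact ⟨hF.add hG, add_mem hFs hGs, fun l hl => by rw [map_add, hFb l hl, hGb l hl, add_zero],
      fun y => by rw [map_add, hFN, hGN, add_zero]⟩
  smul_mem' := by
    rintro a F ⟨hF, hFs, hFb, hFN⟩
    refine ⟨?_, Subalgebra.smul_mem _ hFs _, fun l hl => by rw [map_smul, hFb l hl, smul_zero],
      fun y => by rw [map_smul, hFN, smul_zero]⟩
    rw [MvPolynomial.smul_eq_C_mul]
    exact hF.C_mul a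

theorem eval_nodal_eq_zero_iff {I : Finset K} {y : K} :
    (Lagrange.nodal I id).eval y = 0 ↔ y ∈ I := by
  simp [Lagrange.eval_nodal, Finset.prod_eq_zero_iff, sub_eq_zero]

variable [DecidableEq K] {q N d : ℕ} {Λ : Finset K} {b : K → ℕ} {W : Finset K} {k : Fin N → ℕ}
  {I : Fin N → Finset K}

/-- The sizes `k` and roots `I` of a product of `N` Hankel determinants in `admissible q N d Λ b`,
with all roots outside `W`. -/
structure IsConfiguration (q d : ℕ) (Λ : Finset K) (b : K → ℕ) (W : Finset K) (k : Fin N → ℕ)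
    (I : Fin N → Finset K) : Prop where
  card : ∀ j, (I j).card + 2 * k j = q
  sum : ∑ j, k j = d
  mult : ∀ l ∈ Λ, N ≤ b l + incidence I l
  avoid : ∀ j, Disjoint (I j) W

/-- The span of the products of Hankel determinants of the configurations. -/
def hankelSpan (q N d : ℕ) (Λ : Finset K) (b : K → ℕ) (W : Finset K) :
    Submodule K (MvPolynomial ℕ K) :=
  Submodule.span K {F | ∃ (k : Fin N → ℕ) (I : Fin N → Finset K),
    IsConfiguration q d Λ b W k I ∧ F = hankelProd k I}

theorem IsConfiguration.hankelProd_mem_admissible (h : IsConfiguration q d Λ b W k I) :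
    hankelProd k I ∈ admissible q N d Λ b := by
  refine ⟨?_, ?_, fun l hl => ?_, fun y => ?_⟩
  · rw [← h.sum]
    exact IsHomogeneous.prod _ _ _ fun j _ => isHomogeneous_hankel _ _
  · exact prod_mem fun j _ => hankel_mem_supported
      (by rw [Lagrange.natDegree_nodal, h.card j])
  · refine dirDeriv_pow_prod_eq_zero (t := Finset.univ.filter fun j => l ∉ I j)
      (fun j _ => dirDeriv_dirDeriv_hankel _ _ _) (fun j _ hj => ?_) ?_
    · exact Finset.mem_filter.2 ⟨Finset.mem_univ j, fun hm =>
        hj (dirDeriv_hankel_eq_zero _ (eval_nodal_eq_zero_iff.2 hm))⟩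
    · have hcard := card_filter_notMem_add_incidence I l
      have hmult := h.mult l hl
      rw [Fintype.card_fin] at hcard
      omega
  · exact dirDeriv_pow_prod_eq_zero (fun j _ => dirDeriv_dirDeriv_hankel _ _ _)
      (fun j hj _ => hj) (by simp)

theorem hankelSpan_le_admissible (q N d : ℕ) (Λ : Finset K) (b : K → ℕ) (W : Finset K) :
    hankelSpan q N d Λ b W ≤ admissible q N d Λ b := by
  refine Submodule.span_le.2 ?_
  rintro _ ⟨k, I, h, rfl⟩
  exact h.hankelProd_mem_admissible

theorem sum_card_add_two_mul {q N : ℕ} {α : Type*} {k : Fin N → ℕ} {I : Fin N → Finset α}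
    (hcard : ∀ j, (I j).card + 2 * k j = q) : ∑ j, (I j).card + 2 * ∑ j, k j = q * N := by
  rw [Finset.mul_sum, ← Finset.sum_add_distrib, Finset.sum_congr rfl fun j _ => hcard j]
  simp [mul_comm]

theorem exists_surplus {α : Type*} [DecidableEq α] {N : ℕ} {I : Fin N → Finset α} {Λ : Finset α}
    {b : α → ℕ} (hb : ∀ l ∈ Λ, b l ≤ N)
    (h : ¬ ((∀ j, I j ⊆ Λ) ∧ ∀ l ∈ Λ, b l + incidence I l ≤ N + 1)) :
    ∃ j, ∃ c ∈ I j, c ∈ Λ → N + 1 < b c + incidence I c := by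
  by_contra! hcon
  refine h ⟨fun j c hcj => (hcon j c hcj).1, fun l hl => ?_⟩
  by_contra hlt
  have hpos : 0 < incidence I l := by have := hb l hl; omega
  obtain ⟨j, hj⟩ := Finset.card_pos.1 hpos
  exact hlt (hcon j l (by simpa using hj)).2

theorem card_deficient {α : Type*} [DecidableEq α] {q N d : ℕ} {k : Fin N → ℕ}
    {I : Fin N → Finset α} {Λ : Finset α} {b : α → ℕ} (hcard : ∀ j, (I j).card + 2 * k j = q)
    (hsum : ∑ j, k j = d) (hb : ∀ l ∈ Λ, b l ≤ N) (hmult : ∀ l ∈ Λ, N ≤ b l + incidence I l)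
    (hT : q * (N + 1) = 2 * d + ∑ l ∈ Λ, (N + 1 - b l)) :
    (Λ.filter fun l => b l + incidence I l < N + 1).card =
      q + ∑ j, (I j \ Λ).card + ∑ l ∈ Λ, (b l + incidence I l - (N + 1)) := by
  have htot := sum_card_add_two_mul hcard
  have hsplit := sum_incidence_add_sum_card_sdiff I Λ
  have hdef : (Λ.filter fun l => b l + incidence I l < N + 1).card + ∑ l ∈ Λ, incidence I l =
      ∑ l ∈ Λ, (N + 1 - b l) + ∑ l ∈ Λ, (b l + incidence I l - (N + 1)) := by
    rw [Finset.card_filter, ← Finset.sum_add_distrib, ← Finset.sum_add_distrib]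
    refine Finset.sum_congr rfl fun l hl => ?_
    have := hb l hl
    have := hmult l hl
    split_ifs <;> omega
  rw [mul_add_one] at hT
  omega

theorem lt_card_deficient_sdiff {α : Type*} [DecidableEq α] {q N d : ℕ} {k : Fin N → ℕ}
    {I : Fin N → Finset α} {Λ : Finset α} {b : α → ℕ} (hcard : ∀ j, (I j).card + 2 * k j = q)
    (hsum : ∑ j, k j = d) (hb : ∀ l ∈ Λ, b l ≤ N) (hmult : ∀ l ∈ Λ, N ≤ b l + incidence I l)
    (hT : q * (N + 1) = 2 * d + ∑ l ∈ Λ, (N + 1 - b l)) {j : Fin N} {c : α} (hcj : c ∈ I j)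
    (hc : c ∈ Λ → N + 1 < b c + incidence I c) :
    k j < ((Λ.filter fun l => b l + incidence I l < N + 1) \ I j).card := by
  have hsurplus : 1 ≤ ∑ j, (I j \ Λ).card + ∑ l ∈ Λ, (b l + incidence I l - (N + 1)) := by
    by_cases hcΛ : c ∈ Λ
    · have hle := Finset.single_le_sum (f := fun l => b l + incidence I l - (N + 1))
        (fun _ _ => Nat.zero_le _) hcΛ
      have hlt := hc hcΛ
      omega
    · have hle := Finset.single_le_sum (f := fun j => (I j \ Λ).card)
        (fun _ _ => Nat.zero_le _) (Finset.mem_univ j)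
      have hpos : 0 < (I j \ Λ).card := Finset.card_pos.2 ⟨c, Finset.mem_sdiff.2 ⟨hcj, hcΛ⟩⟩
      omega
  have hdef := card_deficient hcard hsum hb hmult hT
  have hsdiff := Finset.le_card_sdiff (I j) (Λ.filter fun l => b l + incidence I l < N + 1)
  have hq := hcard j
  omega

/-- In the tight case all roots can be moved into `Λ` in such a way that no point is used more
often than one more factor requires. -/
theorem hankelProd_mem_span_of_tight (hcard : ∀ j, (I j).card + 2 * k j = q)
    (hsum : ∑ j, k j = d) (hb : ∀ l ∈ Λ, b l ≤ N) (hmult : ∀ l ∈ Λ, N ≤ b l + incidence I l)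
    (hT : q * (N + 1) = 2 * d + ∑ l ∈ Λ, (N + 1 - b l)) :
    hankelProd k I ∈ Submodule.span K {F | ∃ I' : Fin N → Finset K,
      ((∀ j, (I' j).card + 2 * k j = q) ∧ ∀ l ∈ Λ, N ≤ b l + incidence I' l) ∧
      ((∀ j, I' j ⊆ Λ) ∧ ∀ l ∈ Λ, b l + incidence I' l ≤ N + 1) ∧ F = hankelProd k I'} := by
  refine hankelProd_mem_span_of_exchange
    (P := fun I => (∀ j, (I j).card + 2 * k j = q) ∧ ∀ l ∈ Λ, N ≤ b l + incidence I l)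
    (Q := fun I => (∀ j, I j ⊆ Λ) ∧ ∀ l ∈ Λ, b l + incidence I l ≤ N + 1)
    (fun I => (Λ.filter fun l => b l + incidence I l < N + 1).card) ?_ ⟨hcard, hmult⟩
  rintro I ⟨hcard, hmult⟩ hQ
  obtain ⟨j, c, hcj, hc⟩ := exists_surplus hb hQ
  refine ⟨j, c, _, hcj, Finset.sdiff_disjoint,
    lt_card_deficient_sdiff hcard hsum hb hmult hT hcj hc, fun s hs => ?_⟩
  obtain ⟨hsB, hsj⟩ := Finset.mem_sdiff.1 hs
  obtain ⟨hsΛ, -⟩ := Finset.mem_filter.1 hsB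
  have hinc := incidence_exchange hcj hsj
  have hsc : s ≠ c := fun h => hsj (h ▸ hcj)
  have hge (l : K) (hl : l ∈ Λ) (h : b l + incidence (exchange I j c s) l < N + 1) :
      b l + incidence I l < N + 1 := by
    have hl' := hinc l
    rcases eq_or_ne l c with rfl | hlc
    · have := hc hl
      rw [if_pos rfl, if_neg hsc.symm] at hl'
      omega
    · rw [if_neg hlc] at hl'
      omega
  refine ⟨⟨fun i => by rw [card_exchange hcj hsj, hcard], fun l hl => ?_⟩,
    Finset.card_lt_card (Finset.ssubset_iff_of_subset ?_ |>.2 ⟨s, hsB, fun hsf => ?_⟩)⟩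
  · have hl' := hinc l
    have := hmult l hl
    rcases eq_or_ne l c with rfl | hlc
    · have := hc hl
      rw [if_pos rfl, if_neg hsc.symm] at hl'
      omega
    · rw [if_neg hlc] at hl'
      omega
  · exact fun l hl => Finset.mem_filter.2 ⟨(Finset.mem_filter.1 hl).1,
      hge l (Finset.mem_filter.1 hl).1 (Finset.mem_filter.1 hl).2⟩
  · have hs' := hinc s
    have := (Finset.mem_filter.1 hsf).2
    have := hmult s hsΛ
    rw [if_neg hsc, if_pos rfl] at hs'
    omega

theorem IsConfiguration.hankelProd_mem_span_subset (hI : IsConfiguration q d Λ b ∅ k I)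
    (hΛ : q ≤ Λ.card) :
    hankelProd k I ∈ Submodule.span K {F | ∃ I' : Fin N → Finset K,
      IsConfiguration q d Λ b ∅ k I' ∧ (∀ j, I' j ⊆ Λ) ∧ F = hankelProd k I'} := by
  refine hankelProd_mem_span_of_exchange (P := IsConfiguration q d Λ b ∅ k)
    (fun I => ∑ j, (I j \ Λ).card) (fun I hI hsub => ?_) hI
  push Not at hsub
  obtain ⟨j, hj⟩ := hsub
  obtain ⟨c, hcj, hcΛ⟩ := Finset.not_subset.1 hj
  have hk : k j < (Λ \ I j).card := by
    have hlt : (I j ∩ Λ).card < (I j).card :=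
      Finset.card_lt_card (Finset.inter_subset_left.ssubset_of_ne fun h => hj (h ▸
        Finset.inter_subset_right))
    have hsplit := Finset.card_inter_add_card_sdiff Λ (I j)
    rw [Finset.inter_comm] at hsplit
    have := hI.card j
    omega
  refine ⟨j, c, _, hcj, Finset.sdiff_disjoint, hk, fun s hs => ?_⟩
  obtain ⟨hsΛ, hsj⟩ := Finset.mem_sdiff.1 hs
  have hinc (l : K) (hl : l ∈ Λ) :
      incidence (exchange I j c s) l = incidence I l + if l = s then 1 else 0 := by
    rw [← incidence_exchange hcj hsj, if_neg (ne_of_mem_of_not_mem hl hcΛ), add_zero]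
  refine ⟨⟨fun i => by rw [card_exchange hcj hsj, hI.card], hI.sum, fun l hl => ?_,
    fun _ => Finset.disjoint_empty_right _⟩, ?_⟩
  · rw [hinc l hl, ← add_assoc]
    exact (hI.mult l hl).trans (Nat.le_add_right _ _)
  · have hold := sum_incidence_add_sum_card_sdiff I Λ
    have hnew := sum_incidence_add_sum_card_sdiff (exchange I j c s) Λ
    rw [Finset.sum_congr rfl hinc, Finset.sum_add_distrib, Finset.sum_ite_eq', if_pos hsΛ,
      Finset.sum_congr rfl fun i _ => card_exchange hcj hsj i] at hnew
    omega

end Configuration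

/-! ### The spanning theorem -/

section Spanning

variable {K : Type*} [Field K] {q N d : ℕ} {Λ : Finset K} {b : K → ℕ} {W : Finset K}

theorem admissible_mono {Λ' : Finset K} {b' : K → ℕ} (hΛ : Λ' ⊆ Λ) (hb : ∀ l ∈ Λ', b l ≤ b' l) :
    admissible q N d Λ b ≤ admissible q N d Λ' b' :=
  fun _ hF => ⟨hF.1, hF.2.1, fun l hl => Module.End.pow_map_zero_of_le
    (Nat.succ_le_succ (hb l hl)) (hF.2.2.1 l (hΛ hl)), hF.2.2.2⟩

theorem dirDeriv_pow_succ_eq_zero_of_lt_two {F : MvPolynomial ℕ K} (hq : q < 2)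
    (hs : F ∈ supported K {i | i + 2 ≤ q}) (a : ℕ → K) (j : ℕ) :
    (dirDeriv a ^ (j + 1)) F = 0 := by
  have hempty : {i | i + 2 ≤ q} = (∅ : Set ℕ) :=
    Set.eq_empty_of_forall_notMem fun i hi => by
      rw [Set.mem_ofPred_eq] at hi
      omega
  rw [hempty, supported_empty] at hs
  obtain ⟨c, rfl⟩ := Algebra.mem_bot.1 hs
  exact dirDeriv_pow_eq_zero a (isHomogeneous_C _ c) (Nat.succ_pos j)

theorem admissible_succ_le_of_lt [CharZero K]
    (hD : q * (N + 1) < 2 * d + ∑ l ∈ Λ, (N + 1 - b l)) :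
    admissible q (N + 1) d Λ b ≤ admissible q N d Λ b := by
  refine fun F hF => ⟨hF.1, hF.2.1, hF.2.2.1, fun y => ?_⟩
  rcases lt_or_ge q 2 with hq | hq
  · exact dirDeriv_pow_succ_eq_zero_of_lt_two hq hF.2.1 _ _
  · obtain ⟨n, rfl⟩ := Nat.exists_eq_add_of_le' hq
    exact dirDeriv_momentCurve_pow_eq_zero_of_lt hF.1
      (by simpa using hF.2.1) hF.2.2.1 hF.2.2.2 hD y

theorem admissible_zero_eq_bot [CharZero K] (hd : 0 < d) : admissible q 0 d Λ b = ⊥ := by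
  refine (Submodule.eq_bot_iff _).2 fun F hF => ?_
  exact eq_zero_of_dirDeriv_momentCurve Set.infinite_univ hF.1 hd.ne' fun y _ => by
    simpa using hF.2.2.2 y

theorem admissible_le_of_card_lt [CharZero K]
    (hT : q * (N + 1) = 2 * d + ∑ l ∈ Λ, (N + 1 - b l))
    (hlt : (Λ.filter fun l => b l ≤ N).card < q) {t : ℕ} (ht : t ≤ N) :
    admissible q N d Λ b ≤ admissible q (N - t) d Λ b := by
  induction t with
  | zero => exact le_rfl
  | succ t ih =>
    refine (ih (by omega)).trans ?_
    obtain ⟨M, hM⟩ : ∃ M, N - t = M + 1 := ⟨N - t - 1, by omega⟩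
    rw [show N - (t + 1) = M by omega, hM]
    refine admissible_succ_le_of_lt ?_
    have hsum : ∑ l ∈ Λ, (N + 1 - b l) ≤
        ∑ l ∈ Λ, (M + 1 - b l) + (Λ.filter fun l => b l ≤ N).card * (N - M) := by
      rw [Finset.card_filter, Finset.sum_mul, ← Finset.sum_add_distrib]
      refine Finset.sum_le_sum fun l _ => ?_
      split_ifs
      · rw [one_mul]
        omega
      · omega
    have hmul := Nat.mul_lt_mul_of_pos_right hlt (show 0 < N - M by omega)
    have hq : q * (N + 1) = q * (M + 1) + q * (N - M) := by
      rw [← mul_add]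
      exact congrArg _ (by omega)
    omega

theorem admissible_eq_bot_of_card_lt [CharZero K]
    (hT : q * (N + 1) = 2 * d + ∑ l ∈ Λ, (N + 1 - b l))
    (hlt : (Λ.filter fun l => b l ≤ N).card < q) : admissible q N d Λ b = ⊥ := by
  have hd : 0 < d := by
    rcases Nat.eq_zero_or_pos d with rfl | hd
    · have hle : ∑ l ∈ Λ, (N + 1 - b l) ≤ (Λ.filter fun l => b l ≤ N).card * (N + 1) := by
        rw [← Finset.sum_filter_of_ne (p := fun l => b l ≤ N) fun l _ h => by omega]
        exact Finset.sum_le_card_nsmul _ _ _ fun l _ => Nat.sub_le _ _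
      have hmul := Nat.mul_lt_mul_of_pos_right hlt (Nat.add_one_pos N)
      omega
    · exact hd
  have hle := admissible_le_of_card_lt hT hlt le_rfl
  rwa [Nat.sub_self, admissible_zero_eq_bot hd, le_bot_iff] at hle

variable [DecidableEq K]

/-- The extra factor is `hankel 0 = 1`; its weight takes up the points used once less often than
required. -/
theorem hankelProd_mem_hankelSpan_succ (hΛW : Disjoint Λ W) (hb : ∀ l ∈ Λ, b l ≤ N)
    (hT : q * (N + 1) = 2 * d + ∑ l ∈ Λ, (N + 1 - b l)) {k : Fin N → ℕ} {I : Fin N → Finset K}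
    (hsum : ∑ j, k j = d) (hcard : ∀ j, (I j).card + 2 * k j = q) (hsub : ∀ j, I j ⊆ Λ)
    (hmult : ∀ l ∈ Λ, N ≤ b l + incidence I l ∧ b l + incidence I l ≤ N + 1) :
    hankelProd k I ∈ hankelSpan q (N + 1) d Λ b W := by
  set J := Λ.filter fun l => b l + incidence I l = N with hJ
  have hJcard : J.card = q := by
    have hinc : J.card + ∑ l ∈ Λ, incidence I l = ∑ l ∈ Λ, (N + 1 - b l) := by
      rw [hJ, Finset.card_filter, ← Finset.sum_add_distrib]
      refine Finset.sum_congr rfl fun l hl => ?_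
      have := hb l hl
      have := hmult l hl
      split_ifs <;> omega
    have htot := sum_card_add_two_mul hcard
    have hinter := sum_card_inter I Λ
    rw [Finset.sum_congr rfl fun j _ => by rw [Finset.inter_eq_left.2 (hsub j)]] at hinter
    rw [mul_add_one] at hT
    omega
  refine Submodule.subset_span ⟨Fin.cons 0 k, Fin.cons J I, ⟨?_, ?_, fun l hl => ?_, ?_⟩, ?_⟩
  · exact Fin.cases (by simpa using hJcard) (by simpa using hcard)
  · simp [Fin.sum_univ_succ, hsum]
  · rw [incidence_cons]
    have := hmult l hl
    by_cases hlJ : b l + incidence I l = N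
    · rw [if_pos (Finset.mem_filter.2 ⟨hl, hlJ⟩)]
      omega
    · omega
  · exact Fin.cases (Finset.disjoint_of_subset_left (Finset.filter_subset _ _) hΛW)
      fun j => Finset.disjoint_of_subset_left (hsub j) hΛW
  · simp [hankelProd, Fin.prod_univ_succ]

theorem admissible_le_hankelSpan_succ_of_tight [CharZero K]
    (ih : ∀ Λ' : Finset K, 2 * d + ∑ l ∈ Λ', (N - b l) ≤ q * N →
      admissible q N d Λ' b ≤ hankelSpan q N d Λ' b ∅)
    (hT : q * (N + 1) = 2 * d + ∑ l ∈ Λ, (N + 1 - b l)) (hW : Disjoint Λ W) :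
    admissible q N d Λ b ≤ hankelSpan q (N + 1) d Λ b W := by
  rcases lt_or_ge (Λ.filter fun l => b l ≤ N).card q with hlt | hge
  · rw [admissible_eq_bot_of_card_lt hT hlt]
    exact bot_le
  set Λ' := Λ.filter fun l => b l ≤ N with hΛ'
  have hb (l : K) (hl : l ∈ Λ') : b l ≤ N := (Finset.mem_filter.1 hl).2
  rw [← Finset.sum_filter_of_ne (p := fun l => b l ≤ N) fun l _ h => by omega, ← hΛ'] at hT
  have hcard : ∑ l ∈ Λ', (N + 1 - b l) = ∑ l ∈ Λ', (N - b l) + Λ'.card := by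
    rw [Finset.card_eq_sum_ones, ← Finset.sum_add_distrib]
    exact Finset.sum_congr rfl fun l hl => Nat.sub_add_comm (hb l hl)
  have hT' := hT
  rw [mul_add_one] at hT'
  refine (admissible_mono (Finset.filter_subset _ _) fun _ _ => le_rfl).trans
    ((ih Λ' (by omega)).trans ?_)
  refine Submodule.span_le.2 ?_
  rintro _ ⟨k, I, hI, rfl⟩
  refine Submodule.span_le.2 ?_ (hankelProd_mem_span_of_tight hI.card hI.sum hb hI.mult hT)
  rintro _ ⟨I', ⟨hcard, hmult⟩, ⟨hsub, hmult'⟩, rfl⟩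
  have hmem := hankelProd_mem_hankelSpan_succ (Finset.disjoint_of_subset_left
    (Finset.filter_subset _ _) hW) hb hT hI.sum hcard hsub fun l hl => ⟨hmult l hl, hmult' l hl⟩
  refine Submodule.span_mono ?_ hmem
  rintro _ ⟨k, I, hI, rfl⟩
  refine ⟨k, I, ⟨hI.card, hI.sum, fun l hl => ?_, hI.avoid⟩, rfl⟩
  by_cases hlb : b l ≤ N
  · exact hI.mult l (Finset.mem_filter.2 ⟨hl, hlb⟩)
  · omega

theorem hankelSpan_mono {Λ' : Finset K} {b' : K → ℕ} (hΛ : Λ' ⊆ Λ) (hb : ∀ l ∈ Λ', b l ≤ b' l) :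
    hankelSpan q N d Λ b W ≤ hankelSpan q N d Λ' b' W := by
  refine Submodule.span_mono ?_
  rintro _ ⟨k, I, hI, rfl⟩
  exact ⟨k, I, ⟨hI.card, hI.sum, fun l hl => (hI.mult l (hΛ hl)).trans
    (Nat.add_le_add_right (hb l hl) _), hI.avoid⟩, rfl⟩

omit [DecidableEq K] in
theorem dirDeriv_pow_hankelProd_succ (c : K) (k : Fin N → ℕ) (I : Fin N → Finset K) :
    (dirDeriv (momentCurve c) ^ N) (hankelProd (fun j => k j + 1) I) =
      ((N.factorial : K) * ∏ j, (Lagrange.nodal (I j) id).eval c) •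
        tangentProj c (hankelProd k I) := by
  have h := dirDeriv_pow_card_prod (a := momentCurve c) Finset.univ
    (P := fun j => hankel (k j + 1) (Lagrange.nodal (I j) id))
    fun j _ => dirDeriv_dirDeriv_hankel _ _ _
  rw [Finset.card_univ, Fintype.card_fin] at h
  rw [hankelProd, h, hankelProd, map_prod, MvPolynomial.smul_eq_C_mul, C_mul, map_natCast, map_prod,
    mul_assoc, ← Finset.prod_mul_distrib]
  simp only [dirDeriv_hankel_succ, tangentProj_hankel]

theorem map_tangentProj_hankelSpan_le [CharZero K] (q N e : ℕ) (Λ : Finset K) (b : K → ℕ)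
    (W : Finset K) (c : K) :
    (hankelSpan q N e Λ b (insert c W)).map (tangentProj c).toLinearMap ≤
      (hankelSpan (q + 2) N (e + N) Λ b W).map (dirDeriv (momentCurve c) ^ N) := by
  refine (Submodule.map_span_le _ _ _).2 ?_
  rintro _ ⟨k, I, hI, rfl⟩
  set w : K := (N.factorial : K) * ∏ j, (Lagrange.nodal (I j) id).eval c with hw
  have hw0 : w ≠ 0 := mul_ne_zero (Nat.cast_ne_zero.2 N.factorial_ne_zero)
    (Finset.prod_ne_zero_iff.2 fun j _ h => Finset.disjoint_left.1 (hI.avoid j)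
      (eval_nodal_eq_zero_iff.1 h) (Finset.mem_insert_self c W))
  refine ⟨w⁻¹ • hankelProd (fun j => k j + 1) I, Submodule.smul_mem _ _ (Submodule.subset_span
    ⟨_, I, ⟨fun j => ?_, ?_, hI.mult, fun j => ?_⟩, rfl⟩), ?_⟩
  · rw [mul_add_one, ← add_assoc, hI.card]
  · simp [Finset.sum_add_distrib, hI.sum]
  · exact Finset.disjoint_of_subset_right (Finset.subset_insert c W) (hI.avoid j)
  · rw [map_smul, dirDeriv_pow_hankelProd_succ, ← hw, smul_smul, inv_mul_cancel₀ hw0, one_smul]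
    rfl

omit [DecidableEq K] in
theorem exists_mem_admissible_tangentProj_eq [CharZero K] {e : ℕ} {c : K} (hc : c ∉ Λ)
    {F : MvPolynomial ℕ K} (hF : F ∈ admissible (q + 2) N (e + N) Λ b) :
    ∃ R ∈ admissible q N e Λ b, tangentProj c R = (dirDeriv (momentCurve c) ^ N) F := by
  obtain ⟨hFd, hFs, hFb, hFN⟩ := hF
  obtain ⟨R, hR, hRd, hRs⟩ := exists_tangentProj_eq
    (isHomogeneous_dirDeriv_pow (momentCurve c) hFd N)
    (dirDeriv_pow_mem_supported (momentCurve c) hFs N)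
    (by rw [← Module.End.mul_apply, ← pow_succ', hFN c])
    (tangentDeriv_dirDeriv_pow_eq_zero hFN c)
  have hne (y : K) (j : ℕ) (hy : y ≠ c) (h : (dirDeriv (momentCurve y) ^ j) F = 0) :
      (dirDeriv (momentCurve y) ^ j) R = 0 := by
    have hproj := dirDeriv_pow_tangentProj y c j R
    have hcomm : Commute (dirDeriv (momentCurve y) ^ j) (dirDeriv (momentCurve c) ^ N) :=
      (dirDeriv_commute _ _).pow_pow _ _
    rw [hR, ← Module.End.mul_apply, hcomm.eq, Module.End.mul_apply, h, map_zero, eq_comm,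
      smul_eq_zero] at hproj
    refine tangentProj_injective c ?_
    rw [hproj.resolve_left (pow_ne_zero _ (pow_ne_zero _ (sub_ne_zero.2 hy))), map_zero]
  refine ⟨R, ⟨by simpa using hRd, by simpa using hRs,
    fun l hl => hne l _ (ne_of_mem_of_not_mem hl hc) (hFb l hl), ?_⟩, hR⟩
  exact dirDeriv_momentCurve_pow_eq_zero_of_infinite (Set.finite_singleton c).infinite_compl
    fun y hy => hne y _ hy (hFN y)

theorem exists_sub_mem_admissible_insert [CharZero K]
    (ih : ∀ q' < q, ∀ (e : ℕ) (W : Finset K), 2 * e + ∑ l ∈ Λ, (N + 1 - b l) ≤ q' * (N + 1) →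
      Disjoint Λ W → admissible q' (N + 1) e Λ b ≤ hankelSpan q' (N + 1) e Λ b W)
    (hd : 2 * d + ∑ l ∈ Λ, (N + 1 - b l) ≤ q * (N + 1)) (hW : Disjoint Λ W)
    {F : MvPolynomial ℕ K} (hF : F ∈ admissible q (N + 1) d Λ b) :
    ∃ c ∉ Λ, c ∉ W ∧ ∃ G ∈ hankelSpan q (N + 1) d Λ b W,
      F - G ∈ admissible q (N + 1) d (insert c Λ) (Function.update b c N) := by
  obtain ⟨c, hc⟩ := Infinite.exists_notMem_finset (Λ ∪ W)
  rw [Finset.mem_union, not_or] at hc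
  refine ⟨c, hc.1, hc.2, ?_⟩
  suffices ∃ G ∈ hankelSpan q (N + 1) d Λ b W,
      (dirDeriv (momentCurve c) ^ (N + 1)) (F - G) = 0 by
    obtain ⟨G, hG, h⟩ := this
    obtain ⟨hd, hs, hb, hN⟩ := sub_mem hF (hankelSpan_le_admissible _ _ _ _ _ _ hG)
    refine ⟨G, hG, hd, hs, fun l hl => ?_, hN⟩
    rcases Finset.mem_insert.1 hl with rfl | hl
    · rw [Function.update_self, h]
    · rw [Function.update_of_ne (ne_of_mem_of_not_mem hl hc.1), hb l hl]
  rcases lt_or_ge d (N + 1) with hdN | hdN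
  · exact ⟨0, zero_mem _, by rw [sub_zero, dirDeriv_pow_eq_zero _ hF.1 hdN]⟩
  rcases lt_or_ge q 2 with hq | hq
  · exact ⟨0, zero_mem _, by
      rw [sub_zero, dirDeriv_pow_succ_eq_zero_of_lt_two hq hF.2.1]⟩
  obtain ⟨e, rfl⟩ := Nat.exists_eq_add_of_le' hdN
  obtain ⟨q, rfl⟩ := Nat.exists_eq_add_of_le' hq
  obtain ⟨R, hR, hRF⟩ := exists_mem_admissible_tangentProj_eq hc.1 hF
  have hRs := ih q (by omega) e (insert c W) (by rw [add_mul q] at hd; omega)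
    (Finset.disjoint_insert_right.2 ⟨hc.1, hW⟩) hR
  obtain ⟨G, hG, hGR⟩ := map_tangentProj_hankelSpan_le _ _ _ _ _ _ _
    (Submodule.mem_map_of_mem hRs)
  exact ⟨G, hG, by rw [map_sub, hGR, AlgHom.toLinearMap_apply, hRF, sub_self]⟩

omit [Field K] in
theorem sum_sub_update_insert {c : K} (hc : c ∉ Λ) :
    ∑ l ∈ insert c Λ, (N + 1 - Function.update b c N l) = ∑ l ∈ Λ, (N + 1 - b l) + 1 := by
  rw [Finset.sum_insert hc, Function.update_self, Finset.sum_congr rfl fun l hl => by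
    rw [Function.update_of_ne (ne_of_mem_of_not_mem hl hc)]]
  omega

/-- Inserting a point `c` of weight `N` into `Λ` raises the left side of `hd` by one; once it
exceeds the right side, `N` can be lowered. -/
theorem admissible_le_hankelSpan [CharZero K] (N q d : ℕ) (Λ : Finset K) (b : K → ℕ)
    (W : Finset K) (hd : 2 * d + ∑ l ∈ Λ, (N - b l) ≤ q * N) (hW : Disjoint Λ W) :
    admissible q N d Λ b ≤ hankelSpan q N d Λ b W := by
  induction N generalizing q d Λ b W with
  | zero =>
    intro F hF
    obtain rfl : d = 0 := by omega
    rw [totalDegree_eq_zero_iff_eq_C.1 ((totalDegree_zero_iff_isHomogeneous ℕ).2 hF.1),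
      ← mul_one (C _), ← MvPolynomial.smul_eq_C_mul]
    exact Submodule.smul_mem _ _ (Submodule.subset_span ⟨Fin.elim0, Fin.elim0,
      ⟨fun j => j.elim0, by simp, fun l _ => Nat.zero_le _, fun j => j.elim0⟩,
      by simp [hankelProd]⟩)
  | succ N ihN =>
  induction q using Nat.strong_induction_on generalizing d Λ b W with
  | _ q ihq =>
  obtain ⟨D, hD⟩ := Nat.exists_eq_add_of_le hd
  induction D generalizing d Λ b W with
  | zero =>
    intro F hF
    obtain ⟨c, hc, -, G, hG, hFG⟩ := exists_sub_mem_admissible_insert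
      (fun q' hq' e W => ihq q' hq' e Λ b W) hd hW hF
    rw [← sub_add_cancel F G]
    refine add_mem ?_ hG
    have hFG' := admissible_succ_le_of_lt (by rw [sum_sub_update_insert hc]; omega) hFG
    refine admissible_le_hankelSpan_succ_of_tight
      (fun Λ' h => ihN q d Λ' b ∅ h (Finset.disjoint_empty_right _)) (by omega) hW
      (admissible_mono (Finset.subset_insert c Λ) (fun l hl => ?_) hFG')
    rw [Function.update_of_ne (ne_of_mem_of_not_mem hl hc)]
  | succ D ihD =>
    intro F hF
    obtain ⟨c, hc, hcW, G, hG, hFG⟩ := exists_sub_mem_admissible_insert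
      (fun q' hq' e W => ihq q' hq' e Λ b W) hd hW hF
    rw [← sub_add_cancel F G]
    refine add_mem (hankelSpan_mono (Finset.subset_insert c Λ) (fun l hl => ?_)
      (ihD d (insert c Λ) (Function.update b c N) W ?_
        (Finset.disjoint_insert_left.2 ⟨hcW, hW⟩) ?_ hFG)) hG
    · rw [Function.update_of_ne (ne_of_mem_of_not_mem hl hc)]
    all_goals rw [sum_sub_update_insert hc]; omega

theorem mem_span_hankelProd [CharZero K] {F : MvPolynomial ℕ K} (hF : F.IsHomogeneous d)
    (hs : F ∈ supported K {i | i + 2 ≤ q})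
    (hb : ∀ l ∈ Λ, (dirDeriv (momentCurve l) ^ (b l + 1)) F = 0) (hΛ : q ≤ Λ.card) :
    F ∈ Submodule.span K {G | ∃ (N : ℕ) (k : Fin N → ℕ) (I : Fin N → Finset K),
      IsConfiguration q d Λ b ∅ k I ∧ (∀ j, I j ⊆ Λ) ∧ G = hankelProd k I} := by
  suffices ∀ N, admissible q N d Λ b ≤ Submodule.span K {G | ∃ (N : ℕ) (k : Fin N → ℕ)
      (I : Fin N → Finset K), IsConfiguration q d Λ b ∅ k I ∧ (∀ j, I j ⊆ Λ) ∧
        G = hankelProd k I} from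
    this d ⟨hF, hs, hb, fun y => dirDeriv_pow_eq_zero _ hF (Nat.lt_succ_self d)⟩
  have hle (N : ℕ) (h : 2 * d + ∑ l ∈ Λ, (N - b l) ≤ q * N) :
      admissible q N d Λ b ≤ Submodule.span K {G | ∃ (N : ℕ) (k : Fin N → ℕ)
        (I : Fin N → Finset K), IsConfiguration q d Λ b ∅ k I ∧ (∀ j, I j ⊆ Λ) ∧
          G = hankelProd k I} := by
    refine (admissible_le_hankelSpan N q d Λ b ∅ h (Finset.disjoint_empty_right _)).trans
      (Submodule.span_le.2 ?_)
    rintro _ ⟨k, I, hI, rfl⟩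
    refine Submodule.span_mono ?_ (hI.hankelProd_mem_span_subset hΛ)
    rintro _ ⟨I', hI', hsub, rfl⟩
    exact ⟨N, k, I', hI', hsub, rfl⟩
  intro N
  induction N with
  | zero =>
    rcases Nat.eq_zero_or_pos d with rfl | hd
    · exact hle 0 (by simp)
    · rw [admissible_zero_eq_bot hd]
      exact bot_le
  | succ N ih =>
    rcases lt_or_ge (q * (N + 1)) (2 * d + ∑ l ∈ Λ, (N + 1 - b l)) with h | h
    · exact (admissible_succ_le_of_lt h).trans ih
    · exact hle (N + 1) h

end Spanning

/-! ### Polynomials along lines -/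

section Along

variable {σ R : Type*} [CommRing R]

theorem eval_smul_of_isHomogeneous {P : MvPolynomial σ R} {d : ℕ} (hP : P.IsHomogeneous d)
    (c : R) (x : σ → R) : eval (c • x) P = c ^ d * eval x P := by
  rw [eval_eq, eval_eq, Finset.mul_sum]
  refine Finset.sum_congr rfl fun m hm => ?_
  have hdeg : ∑ i ∈ m.support, m i = d := by
    rw [← Finsupp.degree_apply, Finsupp.degree_eq_weight_one]
    exact hP (mem_support_iff.1 hm)
  simp only [Pi.smul_apply, smul_eq_mul, mul_pow]
  rw [Finset.prod_mul_distrib, Finset.prod_pow_eq_pow_sum, hdeg, mul_left_comm]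

theorem coeff_aeval_scale (c : R) (P : MvPolynomial σ R)
    (m : σ →₀ ℕ) :
    coeff m (aeval (fun i => C c * X i : σ → MvPolynomial σ R) P) =
      c ^ m.degree * coeff m P := by
  classical
  induction P using MvPolynomial.induction_on' with
  | add p q hp hq => rw [map_add, coeff_add, hp, hq, coeff_add, mul_add]
  | monomial s a =>
    have hs : aeval (fun i => C c * X i : σ → MvPolynomial σ R) (monomial s a) =
        monomial s (c ^ s.degree * a) := by
      rw [aeval_monomial, Finsupp.prod, Finset.prod_congr rfl fun i _ => mul_pow _ _ _,
        Finset.prod_mul_distrib, Finset.prod_pow_eq_pow_sum, monomial_eq, ← C_pow,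
        ← mul_assoc, algebraMap_eq, ← C_mul, mul_comm a]
      rfl
    rw [hs, coeff_monomial, coeff_monomial]
    split_ifs with h
    · rw [h]
    · rw [mul_zero]

/-- The restriction of a polynomial to the parametrized line `s ↦ a + s b`. -/
def along (a b : σ → R) : MvPolynomial σ R →ₐ[R] Polynomial R :=
  aeval fun i => Polynomial.C (a i) + Polynomial.C (b i) * Polynomial.X

theorem along_C (a b : σ → R) (c : R) : along a b (C c) = Polynomial.C c := by
  rw [along, algHom_C, Polynomial.algebraMap_apply, Algebra.algebraMap_self_apply]

theorem along_X (a b : σ → R) (i : σ) :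
    along a b (X i) = Polynomial.C (a i) + Polynomial.C (b i) * Polynomial.X :=
  aeval_X _ _

theorem along_rename {τ : Type*} (f : τ → σ) (a b : σ → R) (P : MvPolynomial τ R) :
    along a b (rename f P) = along (a ∘ f) (b ∘ f) P := by
  rw [along, aeval_rename]
  rfl

theorem eval_along (a b : σ → R) (P : MvPolynomial σ R) (s : R) :
    (along a b P).eval s = eval (a + s • b) P := by
  have h : (Polynomial.aeval s).comp (along a b) = aeval (a + s • b) :=
    MvPolynomial.algHom_ext fun i => by
      rw [AlgHom.comp_apply, along_X, aeval_X]
      simp [mul_comm (b i)]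
  rw [← Polynomial.coe_aeval_eq_eval, ← coe_aeval_eq_eval, ← h]
  rfl

theorem derivative_along (a b : σ → R) (P : MvPolynomial σ R) :
    (along a b P).derivative = along a b (dirDeriv b P) := by
  induction P using MvPolynomial.induction_on with
  | C c => rw [dirDeriv_C, map_zero, along_C, Polynomial.derivative_C]
  | add P Q hP hQ => simp only [map_add, hP, hQ]
  | mul_X P i hP =>
    rw [dirDeriv_mul, dirDeriv_X, map_add, map_mul (along a b), map_mul (along a b),
      map_mul (along a b), along_C, along_X, Polynomial.derivative_mul, hP]
    simp [add_comm]

theorem iterate_derivative_along (a b : σ → R) (P : MvPolynomial σ R) (k : ℕ) :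
    Polynomial.derivative^[k] (along a b P) = along a b ((dirDeriv b ^ k) P) := by
  induction k with
  | zero => rfl
  | succ k ih =>
    rw [Function.iterate_succ_apply', ih, derivative_along, pow_succ', Module.End.mul_apply]

theorem factorial_mul_coeff_along (a b : σ → R) (P : MvPolynomial σ R) (k : ℕ) :
    (k.factorial : R) * (along a b P).coeff k = eval a ((dirDeriv b ^ k) P) := by
  have h := Polynomial.coeff_iterate_derivative (k := k) (along a b P) 0
  rw [iterate_derivative_along, Polynomial.coeff_zero_eq_eval_zero, eval_along, zero_smul,
    add_zero, zero_add, Nat.descFactorial_self, nsmul_eq_mul] at h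
  exact h.symm

theorem natDegree_along_le {P : MvPolynomial σ R} {d : ℕ} (hP : P.IsHomogeneous d)
    (a b : σ → R) : (along a b P).natDegree ≤ d := by
  have h := aeval_natDegree_le P hP.totalDegree_le
    (fun i => Polynomial.C (a i) + Polynomial.C (b i) * Polynomial.X) (n := 1) fun i => by
      rw [add_comm]
      exact Polynomial.natDegree_linear_le
  rwa [mul_one] at h

variable {K : Type*} [Field K]

/-- On `s ≠ 0` this is the identity `P (b + s a) = s ^ d P (a + s⁻¹ b)`. -/
theorem reflect_along [Infinite K] {P : MvPolynomial σ K} {d : ℕ} (hP : P.IsHomogeneous d)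
    (a b : σ → K) : (along a b P).reflect d = along b a P := by
  refine mul_right_cancel₀ Polynomial.X_ne_zero (Polynomial.funext fun s => ?_)
  rw [Polynomial.eval_mul, Polynomial.eval_mul, Polynomial.eval_X]
  rcases eq_or_ne s 0 with rfl | hs
  · rw [mul_zero, mul_zero]
  · let _ := invertibleOfNonzero (inv_ne_zero hs)
    have h := Polynomial.eval₂_reflect_mul_pow (RingHom.id K) s⁻¹ d (along a b P)
      (natDegree_along_le hP a b)
    rw [invOf_eq_inv, inv_inv, Polynomial.eval₂_id, Polynomial.eval₂_id, eval_along] at h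
    have hline : b + s • a = s • (a + s⁻¹ • b) := by
      rw [smul_add, smul_smul, mul_inv_cancel₀ hs, one_smul, add_comm]
    rw [eval_along, hline, eval_smul_of_isHomogeneous hP, ← h, mul_left_comm, ← mul_pow,
      mul_inv_cancel₀ hs, one_pow, mul_one]

theorem coeff_along_swap [Infinite K] {P : MvPolynomial σ K} {d : ℕ} (hP : P.IsHomogeneous d)
    (a b : σ → K) {k : ℕ} (hk : k ≤ d) :
    (along a b P).coeff k = (along b a P).coeff (d - k) := by
  rw [← reflect_along hP b a, Polynomial.coeff_reflect, Polynomial.revAt_le hk]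

theorem eval_add_smul_eq_sum [CharZero K] (a b : σ → K) {P : MvPolynomial σ K} {m : ℕ}
    (hP : ∀ k, m < k → (dirDeriv b ^ k) P = 0) (s : K) :
    eval (a + s • b) P =
      ∑ k ∈ Finset.range (m + 1), (k.factorial : K)⁻¹ * eval a ((dirDeriv b ^ k) P) * s ^ k := by
  have hfac (k : ℕ) : (k.factorial : K) ≠ 0 := Nat.cast_ne_zero.2 k.factorial_ne_zero
  have hdeg : (along a b P).natDegree ≤ m := by
    rw [Polynomial.natDegree_le_iff_coeff_eq_zero]
    intro k hk
    have h := factorial_mul_coeff_along a b P k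
    rw [hP k hk, map_zero] at h
    exact (mul_eq_zero.1 h).resolve_left (hfac k)
  rw [← eval_along, Polynomial.eval_eq_sum_range' (Nat.lt_succ_of_le hdeg)]
  refine Finset.sum_congr rfl fun k _ => ?_
  rw [← factorial_mul_coeff_along, inv_mul_cancel_left₀ (hfac k)]

theorem eval_smul_add_smul_mul_zpow [CharZero K] {P : MvPolynomial σ K} {d m : ℕ}
    (hP : P.IsHomogeneous d) {b : σ → K} (h : ∀ k, m < k → (dirDeriv b ^ k) P = 0)
    (a : σ → K) {t : K} (ht : t ≠ 0) (s : K) :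
    eval (t • a + s • b) P * t ^ ((m : ℤ) - d) = ∑ k ∈ Finset.range (m + 1),
      (k.factorial : K)⁻¹ * eval a ((dirDeriv b ^ k) P) * s ^ k * t ^ (m - k) := by
  rw [eval_add_smul_eq_sum _ _ h, Finset.sum_mul]
  refine Finset.sum_congr rfl fun k hk => ?_
  have hkm : k ≤ m := Nat.lt_succ_iff.1 (Finset.mem_range.1 hk)
  rcases lt_or_ge d k with hdk | hdk
  · simp [dirDeriv_pow_eq_zero b hP hdk]
  · have hhom : ((dirDeriv b ^ k) P).IsHomogeneous (d - k) :=
      isHomogeneous_dirDeriv_pow b hP k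
    have hpow : t ^ (d - k) * t ^ ((m : ℤ) - d) = t ^ (m - k) := by
      rw [← zpow_natCast, ← zpow_natCast, ← zpow_add₀ ht]
      congr 1
      omega
    rw [eval_smul_of_isHomogeneous hhom, ← hpow]
    ring

end Along

section Avoiding

variable {σ ι K : Type*} [Finite σ] [Finite ι] [Field K]

theorem exists_eval_eq_dual (f : Module.Dual K (σ → K)) :
    ∃ ψ : MvPolynomial σ K, ∀ x, eval x ψ = f x := by
  classical
  have := Fintype.ofFinite σ
  refine ⟨∑ j, C (f (Pi.single j 1)) * X j, fun x => ?_⟩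
  conv_rhs => rw [pi_eq_sum_univ' x, map_sum]
  simp [mul_comm]

theorem exists_ne_zero_avoiding {V : ι → Submodule K (σ → K)} (hV : ∀ i, V i ≠ ⊤) :
    ∃ ψ : MvPolynomial σ K, ψ ≠ 0 ∧ ∀ x, eval x ψ ≠ 0 → ∀ i, x ∉ V i := by
  have := Fintype.ofFinite ι
  have hform (i : ι) : ∃ ψ : MvPolynomial σ K, ψ ≠ 0 ∧ ∀ x ∈ V i, eval x ψ = 0 := by
    obtain ⟨f, hf, hfV⟩ := Submodule.exists_le_ker_of_lt_top (V i) (lt_top_iff_ne_top.2 (hV i))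
    obtain ⟨ψ, hψ⟩ := exists_eval_eq_dual f
    refine ⟨ψ, ?_, fun x hx => (hψ x).trans (hfV hx)⟩
    rintro rfl
    exact hf (LinearMap.ext fun x => by simpa using (hψ x).symm)
  choose ψ hψ h using hform
  refine ⟨∏ i, ψ i, Finset.prod_ne_zero_iff.2 fun i _ => hψ i, fun x hx i hi => hx ?_⟩
  rw [map_prod]
  exact Finset.prod_eq_zero (Finset.mem_univ i) (h i x hi)

variable {V : ι → Submodule K (σ → K)}

theorem eq_of_eval_eq_avoiding [Infinite K] (hV : ∀ i, V i ≠ ⊤) {P Q : MvPolynomial σ K}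
    (h : ∀ x, (∀ i, x ∉ V i) → eval x P = eval x Q) : P = Q := by
  obtain ⟨ψ, hψ, hav⟩ := exists_ne_zero_avoiding hV
  refine mul_right_cancel₀ hψ (MvPolynomial.funext fun x => ?_)
  rw [map_mul, map_mul]
  by_cases hx : eval x ψ = 0
  · rw [hx, mul_zero, mul_zero]
  · rw [h x (hav x hx)]

theorem exists_avoiding [Infinite K] (hV : ∀ i, V i ≠ ⊤) : ∃ x, ∀ i, x ∉ V i := by
  obtain ⟨ψ, hψ, hav⟩ := exists_ne_zero_avoiding hV
  by_contra! hcon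
  refine hψ (MvPolynomial.funext fun x => ?_)
  by_contra hx
  obtain ⟨i, hi⟩ := hcon x
  exact hav x (by simpa using hx) i hi

theorem sup_span_singleton_ne_top {W : Type*} [AddCommGroup W] [Module K W]
    {U : Submodule K W} (hU : Module.finrank K U + 1 < Module.finrank K W) (x : W) :
    U ⊔ Submodule.span K {x} ≠ ⊤ := by
  have hfin : FiniteDimensional K W := FiniteDimensional.of_finrank_pos (by omega)
  have hx : Module.finrank K (Submodule.span K {x}) ≤ 1 := by
    simpa using finrank_span_le_card (R := K) ({x} : Set W)
  have hsup := Submodule.finrank_add_le_finrank_add_finrank U (Submodule.span K {x})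
  exact (Submodule.lt_top_of_finrank_lt_finrank (by omega)).ne

theorem ne_top_of_finrank_add_one_lt {W : Type*} [AddCommGroup W] [Module K W]
    {U : Submodule K W} (hU : Module.finrank K U + 1 < Module.finrank K W) : U ≠ ⊤ :=
  ne_top_of_le_ne_top (sup_span_singleton_ne_top hU 0) le_sup_left

/-- Two points outside of the `V i` are joined by a line that misses all `V i`, provided that the
second one avoids the planes spanned by the `V i` and the first one. A nowhere vanishing polynomial
is constant on such lines. -/
theorem eq_C_of_eval_ne_zero_avoiding [IsAlgClosed K]
    (hV : ∀ i, Module.finrank K (V i) + 1 < Module.finrank K (σ → K)) {Q : MvPolynomial σ K}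
    (hQ : ∀ x, (∀ i, x ∉ V i) → eval x Q ≠ 0) : ∃ c, Q = C c := by
  have : Infinite K := IsAlgClosed.instInfinite
  obtain ⟨x, hx⟩ := exists_avoiding fun i => ne_top_of_finrank_add_one_lt (hV i)
  refine ⟨eval x Q, eq_of_eval_eq_avoiding (fun i => sup_span_singleton_ne_top (hV i) x)
    fun w hw => ?_⟩
  have hline (s : K) (i : ι) : x + s • (w - x) ∉ V i := by
    intro hi
    rcases eq_or_ne s 0 with rfl | hs
    · exact hx i (by simpa using hi)
    · have hw' : w = s⁻¹ • (x + s • (w - x)) + (1 - s⁻¹) • x := by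
        rw [smul_add, smul_smul, inv_mul_cancel₀ hs, one_smul, sub_smul, one_smul]
        abel
      refine hw i (hw' ▸ Submodule.add_mem_sup (Submodule.smul_mem _ _ hi)
        (Submodule.smul_mem _ _ (Submodule.mem_span_singleton_self x)))
  have hdeg : (along x (w - x) Q).degree = 0 := by
    by_contra hne
    obtain ⟨s, hs⟩ := IsAlgClosed.exists_root _ hne
    rw [Polynomial.IsRoot.def, eval_along] at hs
    exact hQ _ (hline s) hs
  have h0 := eval_along x (w - x) Q 0
  have h1 := eval_along x (w - x) Q 1
  rw [Polynomial.eq_C_of_degree_eq_zero hdeg, Polynomial.eval_C] at h0 h1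
  rw [eval_C, ← add_sub_cancel x w, ← one_smul K (w - x), ← h1, h0, zero_smul, add_zero]

/-- `f` is a quotient of polynomials near every point outside of the subspaces `V i`. -/
def IsLocalQuotient (V : ι → Submodule K (σ → K)) (f : (σ → K) → K) : Prop :=
  ∀ x, (∀ i, x ∉ V i) → ∃ P Q : MvPolynomial σ K, eval x Q ≠ 0 ∧
    ∀ w, (∀ i, w ∉ V i) → eval w Q ≠ 0 → f w = eval w P / eval w Q

theorem mul_eq_mul_of_quotient_eq [Infinite K] (hV : ∀ i, V i ≠ ⊤) {P Q P₁ Q₁ : MvPolynomial σ K}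
    (hQ : Q ≠ 0) (hQ₁ : Q₁ ≠ 0)
    (h : ∀ w, (∀ i, w ∉ V i) → eval w Q ≠ 0 → eval w Q₁ ≠ 0 →
      eval w P / eval w Q = eval w P₁ / eval w Q₁) : P * Q₁ = P₁ * Q := by
  refine mul_right_cancel₀ (mul_ne_zero hQ hQ₁) (eq_of_eval_eq_avoiding hV fun w hw => ?_)
  by_cases hw0 : eval w (Q * Q₁) = 0
  · rw [map_mul, map_mul _ _ (Q * Q₁), hw0, mul_zero, mul_zero]
  · rw [map_mul] at hw0
    have hQw := left_ne_zero_of_mul hw0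
    have hQ₁w := right_ne_zero_of_mul hw0
    rw [map_mul, map_mul _ _ (Q * Q₁), map_mul _ P, map_mul _ P₁,
      (div_eq_div_iff hQw hQ₁w).1 (h w hw hQw hQ₁w)]

theorem IsLocalQuotient.exists_eq_div [Infinite K] (hV : ∀ i, V i ≠ ⊤) {f : (σ → K) → K}
    (hf : IsLocalQuotient V f) : ∃ P Q : MvPolynomial σ K,
      ∀ x, (∀ i, x ∉ V i) → eval x Q ≠ 0 ∧ f x = eval x P / eval x Q := by
  have hne {x : σ → K} {Q : MvPolynomial σ K} (h : eval x Q ≠ 0) : Q ≠ 0 := by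
    rintro rfl
    simp at h
  obtain ⟨x₀, hx₀⟩ := exists_avoiding hV
  obtain ⟨P₀, Q₀, hQ₀, hf₀⟩ := hf x₀ hx₀
  obtain ⟨P, Q, c, hrel, rfl, rfl⟩ :=
    UniqueFactorizationMonoid.exists_reduced_factors' P₀ Q₀ (hne hQ₀)
  refine ⟨P, Q, fun x hx => ?_⟩
  obtain ⟨P₁, Q₁, hQ₁, hf₁⟩ := hf x hx
  have hcross : P * Q₁ = P₁ * Q := by
    refine mul_left_cancel₀ (left_ne_zero_of_mul (hne hQ₀)) ?_
    rw [← mul_assoc, mul_eq_mul_of_quotient_eq hV (hne hQ₀) (hne hQ₁) fun w hw h h₁ =>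
      (hf₀ w hw h).symm.trans (hf₁ w hw h₁), mul_left_comm]
  have hdvd : Q ∣ Q₁ := hrel.symm.dvd_of_dvd_mul_left ⟨P₁, by rw [hcross, mul_comm]⟩
  have hQx : eval x Q ≠ 0 := fun h => hQ₁ (zero_dvd_iff.1 (h ▸ map_dvd (eval x) hdvd))
  refine ⟨hQx, ?_⟩
  rw [hf₁ x hx hQ₁, div_eq_div_iff hQ₁ hQx, ← map_mul, ← map_mul, hcross]

theorem IsLocalQuotient.exists_polynomial [IsAlgClosed K]
    (hV : ∀ i, Module.finrank K (V i) + 1 < Module.finrank K (σ → K)) {f : (σ → K) → K}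
    (hf : IsLocalQuotient V f) :
    ∃ G : MvPolynomial σ K, ∀ x, (∀ i, x ∉ V i) → f x = eval x G := by
  have : Infinite K := IsAlgClosed.instInfinite
  obtain ⟨P, Q, hPQ⟩ := hf.exists_eq_div fun i => ne_top_of_finrank_add_one_lt (hV i)
  obtain ⟨a, rfl⟩ := eq_C_of_eval_ne_zero_avoiding hV fun x hx => (hPQ x hx).1
  refine ⟨C a⁻¹ * P, fun x hx => ?_⟩
  rw [(hPQ x hx).2, eval_C, map_mul, eval_C, div_eq_inv_mul]

theorem degree_eq_of_eval_smul [Infinite K] (hV : ∀ i, V i ≠ ⊤) {c : K}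
    (hc : Function.Injective (c ^ · : ℤ → K)) {G : MvPolynomial σ K} {d : ℤ}
    (h : ∀ x, (∀ i, x ∉ V i) → eval (c • x) G = c ^ d * eval x G)
    {s : σ →₀ ℕ} (hs : coeff s G ≠ 0) : (s.degree : ℤ) = d := by
  have hscale : aeval (fun i => C c * X i : _ → MvPolynomial σ K) G = C (c ^ d) * G := by
    refine eq_of_eval_eq_avoiding hV fun x hx => ?_
    have hcomp : (aeval x : MvPolynomial σ K →ₐ[K] K).comp
        (aeval (fun i => C c * X i : _ → MvPolynomial σ K)) = aeval (c • x) :=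
      MvPolynomial.algHom_ext fun i => by simp
    rw [map_mul, eval_C, ← h x hx, ← coe_aeval_eq_eval, ← coe_aeval_eq_eval]
    exact DFunLike.congr_fun hcomp G
  have hcoeff := congrArg (coeff s) hscale
  rw [coeff_aeval_scale, coeff_C_mul, ← zpow_natCast] at hcoeff
  exact hc (mul_right_cancel₀ hs hcoeff)

end Avoiding

/-! ### Moment charts -/

section MomentChart

variable {n r : ℕ}

/-- The substitution `s ↦ s + μ t` of the parameters of the Veronese map, as a linear
transformation of its target. -/
def shear (n : ℕ) (μ : ℂ) : Matrix (Fin (n + 1)) (Fin (n + 1)) ℂ := fun j k =>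
  if (j : ℕ) ≤ k then ((n - j).choose (k - j) : ℂ) * μ ^ ((k : ℕ) - j) else 0

theorem shear_mulVec_veronese (n : ℕ) (μ s t : ℂ) :
    (shear n μ).mulVec (veronese n s t) = veronese n (s + μ * t) t := by
  funext j
  obtain ⟨j, hj⟩ := j
  obtain ⟨m, rfl⟩ : ∃ m, n = j + m := ⟨n - j, by omega⟩
  let term (k : ℕ) : ℂ := (if j ≤ k then ((j + m - j).choose (k - j) : ℂ) * μ ^ (k - j) else 0) *
    (s ^ (j + m - k) * t ^ k)
  have hsum : (shear (j + m) μ).mulVec (veronese (j + m) s t) ⟨j, hj⟩ =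
      ∑ k ∈ Finset.range (j + (m + 1)), term k := Fin.sum_univ_eq_sum_range term (j + m + 1)
  rw [hsum, Finset.sum_range_add, Finset.sum_eq_zero, zero_add]
  · simp only [veronese, Nat.add_sub_cancel_left]
    rw [add_comm s, add_pow, Finset.sum_mul]
    refine Finset.sum_congr rfl fun k _ => ?_
    simp only [term]
    rw [if_pos (Nat.le_add_right j k), Nat.add_sub_add_left, mul_pow, pow_add,
      Nat.add_sub_cancel_left, Nat.add_sub_cancel_left]
    ring
  · intro k hk
    simp only [term]
    rw [if_neg (Nat.not_le.2 (Finset.mem_range.1 hk)), zero_mul]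

theorem shear_mulVec_injective (n : ℕ) (μ : ℂ) : Function.Injective (shear n μ).mulVec := by
  have hdet : (shear n μ).det = 1 := by
    rw [Matrix.det_of_isUpperTriangular]
    · exact Finset.prod_eq_one fun j _ => by simp [shear]
    · exact fun i j hij => if_neg (not_le.2 hij)
  exact Matrix.mulVec_injective_of_isUnit
    ((Matrix.isUnit_iff_isUnit_det _).2 (hdet ▸ isUnit_one))

/-- The point `(1, y, …, y ^ n)` of the moment curve in `ℂ^(n+1)`. -/
def momentVec (n : ℕ) (y : ℂ) : Vec n := fun j => momentCurve y j

theorem momentVec_zero (n : ℕ) (y : ℂ) : momentVec n y 0 = 1 := pow_zero y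

theorem momentVec_ne_zero (n : ℕ) (y : ℂ) : momentVec n y ≠ 0 := fun h =>
  one_ne_zero ((momentVec_zero n y).symm.trans (congrFun h 0))

theorem eq_of_momentVec_mem_span (hn : 1 ≤ n) {y y' : ℂ}
    (h : momentVec n y ∈ Submodule.span ℂ {momentVec n y'}) : y = y' := by
  obtain ⟨c, hc⟩ := Submodule.mem_span_singleton.1 h
  have hc1 : c = 1 := by
    simpa only [Pi.smul_apply, momentVec_zero, smul_eq_mul, mul_one] using congrFun hc 0
  rw [hc1, one_smul] at hc
  simpa [momentVec, momentCurve, eq_comm] using congrFun hc ⟨1, by omega⟩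

theorem veronese_eq_smul_momentVec (n : ℕ) {s : ℂ} (hs : s ≠ 0) (t : ℂ) :
    veronese n s t = s ^ n • momentVec n (t / s) := by
  funext j
  simp only [veronese, momentVec, momentCurve, Pi.smul_apply, smul_eq_mul, div_pow]
  rw [← pow_sub_mul_pow s (Nat.lt_succ_iff.1 j.2), mul_assoc,
    mul_div_cancel₀ _ (pow_ne_zero (j : ℕ) hs)]

/-- In the linear coordinates given by `B`, the points `p i` are the points with the distinct
parameters `y i` of the moment curve. -/
structure IsMomentChart (p : Fin r → ℙ ℂ (Vec n)) (B : Vec n ≃ₗ[ℂ] Vec n) (y : Fin r → ℂ) :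
    Prop where
  injective : Function.Injective y
  submodule_eq : ∀ i, (p i).submodule = Submodule.span ℂ {B (momentVec n (y i))}

/-- A shear moves the finitely many parameters away from the point `s = 0` of the curve. -/
theorem IsRationalNormalCurve.exists_isMomentChart {C : Set (ℙ ℂ (Vec n))}
    (hC : IsRationalNormalCurve C) {p : Fin r → ℙ ℂ (Vec n)} (hp : Function.Injective p)
    (hpC : ∀ i, p i ∈ C) : ∃ B y, IsMomentChart p B y := by
  obtain ⟨A, hA⟩ := hC
  choose s t hst hspan using fun i => (hA (p i)).1 (hpC i)
  obtain ⟨μ, hμ⟩ : ∃ μ : ℂ, μ ∉ Set.range fun i => s i / t i :=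
    (Set.finite_range _).exists_notMem
  have hs (i : Fin r) : s i - μ * t i ≠ 0 := by
    intro h
    by_cases ht : t i = 0
    · rw [ht, mul_zero, sub_zero] at h
      exact (hst i).elim (fun hs => hs h) fun ht' => ht' ht
    · exact hμ ⟨i, (div_eq_iff ht).2 (sub_eq_zero.1 h)⟩
  let U : Vec n ≃ₗ[ℂ] Vec n := LinearEquiv.ofInjectiveEndo (Matrix.mulVecLin (shear n μ))
    (shear_mulVec_injective n μ)
  have hver (i : Fin r) : veronese n (s i) (t i) =
      (s i - μ * t i) ^ n • U (momentVec n (t i / (s i - μ * t i))) := by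
    rw [← map_smul, ← veronese_eq_smul_momentVec n (hs i)]
    exact ((shear_mulVec_veronese n μ _ _).trans (by rw [sub_add_cancel])).symm
  have hsub (i : Fin r) : (p i).submodule =
      Submodule.span ℂ {(U.trans A) (momentVec n (t i / (s i - μ * t i)))} := by
    rw [hspan i, hver i, map_smul, LinearEquiv.trans_apply]
    exact Submodule.span_singleton_smul_eq (IsUnit.mk0 _ (pow_ne_zero n (hs i))) _
  refine ⟨U.trans A, fun i => t i / (s i - μ * t i), fun i j hij => hp ?_, hsub⟩
  apply Projectivization.submodule_injective
  rw [hsub i, hsub j, show t i / (s i - μ * t i) = t j / (s j - μ * t j) from hij]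

variable {p : Fin r → ℙ ℂ (Vec n)} {B : Vec n ≃ₗ[ℂ] Vec n} {y : Fin r → ℂ}

theorem IsMomentChart.apply_mem_iff (h : IsMomentChart p B y) (i : Fin r) (z : Vec n) :
    B z ∈ (p i).submodule ↔ z ∈ Submodule.span ℂ {momentVec n (y i)} := by
  rw [h.submodule_eq, Submodule.mem_span_singleton, Submodule.mem_span_singleton]
  refine exists_congr fun c => ?_
  rw [← map_smul, B.injective.eq_iff]

theorem IsMomentChart.injective_points (h : IsMomentChart p B y) (hn : 1 ≤ n) :
    Function.Injective p := fun i j hij => by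
  refine h.injective (eq_of_momentVec_mem_span hn ?_)
  rw [← h.apply_mem_iff, ← hij, h.apply_mem_iff]
  exact Submodule.mem_span_singleton_self _

end MomentChart

/-! ### Sections as polynomials -/

section Cone

variable {n r : ℕ} {p : Fin r → ℙ ℂ (Vec n)}

theorem mem_cone {z : Ambient p} :
    z ∈ cone p ↔ z.1 ≠ 0 ∧ (∀ i, z.2 i ≠ 0) ∧ ∃ t, IsExcEq p z t := by
  constructor
  · rintro ⟨h, h', hz⟩
    have hexc (i : Fin r) : ∃ t : ℂ, (p i).submodule.mkQ z.1 = t • z.2 i := by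
      have hle := hz i
      simp only [Projectivization.submodule_mk] at hle
      obtain ⟨t, ht⟩ := Submodule.mem_span_singleton.1
        (hle (Submodule.mem_map_of_mem (Submodule.mem_span_singleton_self z.1)))
      exact ⟨t, ht.symm⟩
    choose t ht using hexc
    exact ⟨h, h', t, ht⟩
  · rintro ⟨h, h', t, ht⟩
    refine ⟨h, h', fun i => ?_⟩
    simp only [Projectivization.submodule_mk]
    rw [Submodule.map_span_le]
    rintro x rfl
    rw [ht i]
    exact Submodule.smul_mem _ _ (Submodule.mem_span_singleton_self _)

theorem IsExcEq.unique {z : Ambient p} (hz : z ∈ cone p) {t t' : Fin r → ℂ}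
    (ht : IsExcEq p z t) (ht' : IsExcEq p z t') : t = t' := by
  funext i
  exact smul_left_injective ℂ ((mem_cone.1 hz).2.1 i) ((ht i).symm.trans (ht' i))

theorem span_singleton_eq_submodule {i : Fin r} {x : Vec n} (hx : x ≠ 0)
    (hi : x ∈ (p i).submodule) : Submodule.span ℂ {x} = (p i).submodule :=
  Submodule.eq_of_le_of_finrank_eq ((Submodule.span_singleton_le_iff_mem _ _).2 hi)
    ((finrank_span_singleton hx).trans (Projectivization.finrank_submodule _).symm)

theorem eq_of_mem_submodule {i j : Fin r} {x : Vec n} (hx : x ≠ 0) (hi : x ∈ (p i).submodule)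
    (hj : x ∈ (p j).submodule) : p i = p j :=
  Projectivization.submodule_injective
    ((span_singleton_eq_submodule hx hi).symm.trans (span_singleton_eq_submodule hx hj))

/-- The coordinates on the blow-up of a point with coordinates `x` that lies outside of the
exceptional divisors. -/
def liftCone (p : Fin r → ℙ ℂ (Vec n)) : Vec n →ₗ[ℂ] Ambient p :=
  LinearMap.prod LinearMap.id (LinearMap.pi fun i => (p i).submodule.mkQ)

theorem isExcEq_liftCone (x : Vec n) : IsExcEq p (liftCone p x) 1 :=
  fun _ => (one_smul _ _).symm

theorem liftCone_mem_cone (x : Off p) : liftCone p x.1 ∈ cone p :=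
  mem_cone.2 ⟨x.2.1, fun i h => x.2.2 i ((Submodule.Quotient.mk_eq_zero _).1 h), _,
    isExcEq_liftCone x.1⟩

theorem exists_eval_eq_polyFun {σ W : Type} [Finite σ] [AddCommGroup W] [Module ℂ W]
    (φ : (σ → ℂ) →ₗ[ℂ] W) {P : W → ℂ} (hP : P ∈ polyFun W) :
    ∃ G : MvPolynomial σ ℂ, ∀ x, eval x G = P (φ x) := by
  induction hP using Algebra.adjoin_induction with
  | mem f hf =>
    obtain ⟨ψ, rfl⟩ := hf
    exact exists_eval_eq_dual (ψ ∘ₗ φ)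
  | algebraMap c => exact ⟨C c, fun x => eval_C c⟩
  | add f g _ _ hf hg =>
    obtain ⟨P, hP⟩ := hf
    obtain ⟨Q, hQ⟩ := hg
    exact ⟨P + Q, fun x => by rw [map_add, hP, hQ, Pi.add_apply]⟩
  | mul f g _ _ hf hg =>
    obtain ⟨P, hP⟩ := hf
    obtain ⟨Q, hQ⟩ := hg
    exact ⟨P * Q, fun x => by rw [map_mul, hP, hQ, Pi.mul_apply]⟩

theorem exists_eval_eq_polyFun_line {W : Type} [AddCommGroup W] [Module ℂ W] (a b : W)
    {P : W → ℂ} (hP : P ∈ polyFun W) :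
    ∃ G : Polynomial ℂ, ∀ s, G.eval s = P (a + s • b) := by
  obtain ⟨G, hG⟩ := exists_eval_eq_polyFun (Fintype.linearCombination ℂ ![a, b]) hP
  refine ⟨along ![1, 0] ![0, 1] G, fun s => ?_⟩
  rw [eval_along, hG]
  simp [Fintype.linearCombination_apply, Fin.sum_univ_two]

theorem submodule_finrank_add_one_lt (hn : 2 ≤ n) (i : Fin r) :
    Module.finrank ℂ (p i).submodule + 1 < Module.finrank ℂ (Vec n) := by
  rw [Projectivization.finrank_submodule, Module.finrank_fin_fun]
  omega

section Polynomial

variable [NeZero r]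

/-- The point of `Off p` with coordinates `x`. Since there is a point `p i`, the vector `x` is
nonzero as soon as it lies on none of them. -/
def offMk (x : Vec n) (hx : ∀ i, x ∉ (p i).submodule) : Off p :=
  ⟨x, fun h => hx 0 (h ▸ Submodule.zero_mem _), hx⟩

/-- The extension by zero of `F` to all vectors is locally a quotient of polynomials outside of
the lines `p i`. -/
theorem exists_polynomial_of_mem_H0 (hn : 2 ≤ n) {D : Div r} {F : Off p → ℂ} (hF : F ∈ H0 p D) :
    ∃ G : MvPolynomial (Fin (n + 1)) ℂ, ∀ x : Off p, F x = eval x.1 G := by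
  obtain ⟨-, g, hg, hgF⟩ := hF
  have hfg (x : Off p) : Function.extend Subtype.val F 0 x.1 = g (liftCone p x.1) := by
    rw [Subtype.val_injective.extend_apply,
      hgF _ (liftCone_mem_cone x) 1 (isExcEq_liftCone x.1) x rfl]
    simp only [Pi.one_apply, one_zpow, Finset.prod_const_one, mul_one]
  have hloc : IsLocalQuotient (fun i => (p i).submodule) (Function.extend Subtype.val F 0) := by
    intro x hx
    obtain ⟨P, hP, Q, hQ, hne, h⟩ := hg _ (liftCone_mem_cone (offMk x hx))
    obtain ⟨P', hP'⟩ := exists_eval_eq_polyFun (liftCone p) hP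
    obtain ⟨Q', hQ'⟩ := exists_eval_eq_polyFun (liftCone p) hQ
    refine ⟨P', Q', by rwa [hQ'], fun w hw hwQ => ?_⟩
    rw [hQ'] at hwQ
    rw [hP', hQ']
    exact (hfg (offMk w hw)).trans (h _ (liftCone_mem_cone (offMk w hw)) hwQ)
  obtain ⟨G, hG⟩ := hloc.exists_polynomial (submodule_finrank_add_one_lt hn)
  exact ⟨G, fun x => by rw [← hG x.1 x.2.2, Subtype.val_injective.extend_apply]⟩

end Polynomial

end Cone

section PolySection

variable {n r : ℕ} {p : Fin r → ℙ ℂ (Vec n)}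

/-- Extension by zero of a vector in `ℂ^(n+1)` to a sequence. -/
def extendVec (n : ℕ) : Vec n →ₗ[ℂ] (ℕ → ℂ) := Function.ExtendByZero.linearMap ℂ Fin.val

theorem extendVec_apply (z : Vec n) (j : Fin (n + 1)) : extendVec n z j = z j :=
  Fin.val_injective.extend_apply z 0 j

theorem eval_extendVec_rename (z : Vec n) (G : MvPolynomial (Fin (n + 1)) ℂ) :
    eval (extendVec n z) (rename Fin.val G) = eval z G := by
  rw [eval_rename]
  congr 2
  exact funext (extendVec_apply z)

theorem mem_supported_iff_exists_rename {P : MvPolynomial ℕ ℂ} :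
    P ∈ supported ℂ {i | i + 2 ≤ n + 2} ↔
      ∃ G : MvPolynomial (Fin (n + 1)) ℂ, rename Fin.val G = P := by
  classical
  rw [mem_supported]
  constructor
  · refine fun h => exists_rename_eq_of_vars_subset_range P Fin.val Fin.val_injective fun i hi => ?_
    have hin : i + 2 ≤ n + 2 := h hi
    exact ⟨⟨i, by omega⟩, rfl⟩
  · rintro ⟨G, rfl⟩ i hi
    obtain ⟨j, -, rfl⟩ := Finset.mem_image.1 (vars_rename _ _ hi)
    exact Nat.add_le_add_right j.is_le 2

theorem eval_comp_mem_polyFun {W : Type} [AddCommGroup W] [Module ℂ W] {σ : Type*}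
    (φ : W →ₗ[ℂ] (σ → ℂ)) (P : MvPolynomial σ ℂ) : (fun w => eval (φ w) P) ∈ polyFun W := by
  induction P using MvPolynomial.induction_on with
  | C c =>
    simp only [eval_C]
    exact (polyFun W).algebraMap_mem c
  | add P Q hP hQ =>
    simp only [map_add]
    exact add_mem hP hQ
  | mul_X P i hP =>
    simp only [map_mul, eval_X]
    exact mul_mem hP (Algebra.subset_adjoin ⟨LinearMap.proj i ∘ₗ φ, rfl⟩)

/-- The function on the complement of the points `p i` given by a polynomial, in the coordinates
defined by `B`. The variables are indexed by `ℕ`, and those of index greater than `n` are sent to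
zero. -/
def polySection (p : Fin r → ℙ ℂ (Vec n)) (B : Vec n ≃ₗ[ℂ] Vec n) :
    MvPolynomial ℕ ℂ →ₐ[ℂ] (Off p → ℂ) :=
  AlgHom.pi fun x => aeval (extendVec n (B.symm x.1))

theorem polySection_apply (B : Vec n ≃ₗ[ℂ] Vec n) (P : MvPolynomial ℕ ℂ) (x : Off p) :
    polySection p B P x = eval (extendVec n (B.symm x.1)) P := by
  rw [← coe_aeval_eq_eval]
  rfl

theorem polySection_rename (B : Vec n ≃ₗ[ℂ] Vec n) (G : MvPolynomial (Fin (n + 1)) ℂ) (x : Off p) :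
    polySection p B (rename Fin.val G) x = eval (B.symm x.1) G := by
  rw [polySection_apply, eval_extendVec_rename]

theorem comap_ne_top (B : Vec n ≃ₗ[ℂ] Vec n) {U : Submodule ℂ (Vec n)} (hU : U ≠ ⊤) :
    U.comap B.toLinearMap ≠ ⊤ := fun h =>
  hU (Submodule.comap_injective_of_surjective B.surjective (h.trans (Submodule.comap_top _).symm))

variable [NeZero r]

theorem polySection_ne_zero (hn : 2 ≤ n) (B : Vec n ≃ₗ[ℂ] Vec n) {P : MvPolynomial ℕ ℂ}
    (hs : P ∈ supported ℂ {i | i + 2 ≤ n + 2}) (hP : P ≠ 0) : polySection p B P ≠ 0 := by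
  obtain ⟨G, rfl⟩ := mem_supported_iff_exists_rename.1 hs
  intro h
  suffices hG : G = 0 from hP (by rw [hG, map_zero])
  refine eq_of_eval_eq_avoiding (fun i => comap_ne_top B
    (ne_top_of_finrank_add_one_lt (submodule_finrank_add_one_lt (p := p) hn i))) fun z hz => ?_
  have hBz := congrFun h (offMk (B z) hz)
  rw [polySection_rename] at hBz
  simpa [offMk] using hBz

theorem degree_eq_of_mem_H0 (hn : 2 ≤ n) {B : Vec n ≃ₗ[ℂ] Vec n} {D : Div r}
    {G : MvPolynomial (Fin (n + 1)) ℂ} (hF : polySection p B (rename Fin.val G) ∈ H0 p D)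
    {s : Fin (n + 1) →₀ ℕ} (hs : coeff s G ≠ 0) : (s.degree : ℤ) = D.1 := by
  have hinj : Function.Injective ((2 : ℂ) ^ · : ℤ → ℂ) := fun a b hab => by
    have hnorm := congrArg norm hab
    simp only [norm_zpow, Complex.norm_two] at hnorm
    exact zpow_right_injective₀ two_pos (by norm_num) hnorm
  refine degree_eq_of_eval_smul (fun i => comap_ne_top B
    (ne_top_of_finrank_add_one_lt (submodule_finrank_add_one_lt (p := p) hn i))) hinj
    (fun z hz => ?_) hs
  have hz2 (i : Fin r) : B ((2 : ℂ) • z) ∉ (p i).submodule := by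
    rw [map_smul, Submodule.smul_mem_iff _ two_ne_zero]
    exact hz i
  have hscale := hF.1 2 (offMk _ hz) (offMk _ hz2) two_ne_zero (map_smul _ _ _)
  rw [polySection_rename, polySection_rename] at hscale
  simpa [offMk] using hscale

theorem exists_polySection_eq_of_mem_H0 (hn : 2 ≤ n) (B : Vec n ≃ₗ[ℂ] Vec n) {D : Div r}
    {F : Off p → ℂ} (hF : F ∈ H0 p D) (hF0 : F ≠ 0) :
    ∃ (d : ℕ) (P : MvPolynomial ℕ ℂ), D.1 = d ∧ P.IsHomogeneous d ∧
      P ∈ supported ℂ {i | i + 2 ≤ n + 2} ∧ F = polySection p B P := by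
  obtain ⟨G₀, hG₀⟩ := exists_polynomial_of_mem_H0 hn hF
  obtain ⟨G, hG⟩ := exists_eval_eq_polyFun B.toLinearMap
    (eval_comp_mem_polyFun (LinearMap.id : Vec n →ₗ[ℂ] Vec n) G₀)
  obtain rfl : F = polySection p B (rename Fin.val G) := by
    funext x
    rw [polySection_rename, hG, hG₀]
    simp
  have hG0 : G ≠ 0 := by
    rintro rfl
    exact hF0 (by rw [map_zero, map_zero])
  obtain ⟨s, hs⟩ := exists_coeff_ne_zero hG0
  have hhom : G.IsHomogeneous s.degree := fun u hu => by
    have hdeg : (u.degree : ℤ) = s.degree :=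
      (degree_eq_of_mem_H0 hn hF hu).trans (degree_eq_of_mem_H0 hn hF hs).symm
    exact (DFunLike.congr_fun Finsupp.degree_eq_weight_one u).symm.trans (Nat.cast_injective hdeg)
  exact ⟨_, _, (degree_eq_of_mem_H0 hn hF hs).symm, hhom.rename_isHomogeneous,
    mem_supported_iff_exists_rename.2 ⟨G, rfl⟩, rfl⟩

end PolySection

section Multiplicity

variable {n r : ℕ} {p : Fin r → ℙ ℂ (Vec n)}

theorem add_smul_notMem_of_notMem_sup {K M : Type*} [Field K] [AddCommGroup M] [Module K M]
    {U V : Submodule K M} {v w : M} (hv : v ∈ U) (hw : w ∉ U ⊔ V) {s : K} (hs : s ≠ 0) :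
    v + s • w ∉ V := fun h => by
  refine hw ((Submodule.smul_mem_iff _ hs).1 ?_)
  rw [← add_sub_cancel_left v (s • w)]
  exact sub_mem (Submodule.mem_sup_right h) (Submodule.mem_sup_left hv)

/-- For `v` on the line `p i`, the lift to the multicone of the curve `s ↦ v + s w`: at `s = 0` it
meets the exceptional divisor over `p i` in the direction of `w`. -/
def lineLift (p : Fin r → ℙ ℂ (Vec n)) (i : Fin r) (v w : Vec n) (s : ℂ) : Ambient p :=
  (v + s • w, Function.update (fun j => (p j).submodule.mkQ (v + s • w)) i
    ((p i).submodule.mkQ w))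

theorem lineLift_eq_add_smul (i : Fin r) (v w : Vec n) (s : ℂ) : lineLift p i v w s =
    lineLift p i v w 0 + s • (w, Function.update (fun j => (p j).submodule.mkQ w) i 0) := by
  refine Prod.ext ?_ (funext fun j => ?_)
  · simp [lineLift]
  · rcases eq_or_ne j i with rfl | hj
    · simp [lineLift]
    · simp [lineLift, hj]

variable {i : Fin r} {v w : Vec n}

theorem isExcEq_lineLift (hv : v ∈ (p i).submodule) (s : ℂ) :
    IsExcEq p (lineLift p i v w s) (Pi.mulSingle i s) := by
  intro j
  rcases eq_or_ne j i with rfl | hj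
  · simp [lineLift, (Submodule.Quotient.mk_eq_zero _).2 hv]
  · simp [lineLift, hj]

theorem lineLift_mem_cone (hp : Function.Injective p) (hv0 : v ≠ 0) (hv : v ∈ (p i).submodule)
    (hw : ∀ j, w ∉ (p i).submodule ⊔ (p j).submodule) (s : ℂ) :
    lineLift p i v w s ∈ cone p := by
  refine mem_cone.2 ⟨fun h => ?_, fun j => ?_, _, isExcEq_lineLift hv s⟩
  · have h0 : v + s • w = 0 := h
    rcases eq_or_ne s 0 with rfl | hs
    · exact hv0 (by simpa using h0)
    · exact add_smul_notMem_of_notMem_sup hv (hw i) hs (h0 ▸ Submodule.zero_mem _)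
  · rcases eq_or_ne j i with rfl | hj
    · simpa [lineLift] using fun h => hw j (Submodule.mem_sup_left h)
    · simp only [lineLift, Function.update_of_ne hj, Submodule.mkQ_apply, Ne,
        Submodule.Quotient.mk_eq_zero]
      rcases eq_or_ne s 0 with rfl | hs
      · rw [zero_smul, add_zero]
        exact fun h => hj (hp (eq_of_mem_submodule hv0 h hv))
      · exact add_smul_notMem_of_notMem_sup hv (hw j) hs

theorem exists_quotient_along_line (hp : Function.Injective p) {D : Div r} {F : Off p → ℂ}
    (hF : F ∈ H0 p D) (hv0 : v ≠ 0) (hv : v ∈ (p i).submodule)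
    (hw : ∀ j, w ∉ (p i).submodule ⊔ (p j).submodule) :
    ∃ P Q : Polynomial ℂ, Q.eval 0 ≠ 0 ∧ ∀ (s : ℂ) (x : Off p), x.1 = v + s • w → Q.eval s ≠ 0 →
      F x * s ^ D.2 i = P.eval s / Q.eval s := by
  obtain ⟨-, g, hg, hgF⟩ := hF
  obtain ⟨P, hP, Q, hQ, hQ0, hPQ⟩ := hg _ (lineLift_mem_cone hp hv0 hv hw 0)
  have hline {R : Ambient p → ℂ} (hR : R ∈ polyFun (Ambient p)) :
      ∃ R' : Polynomial ℂ, ∀ s, R'.eval s = R (lineLift p i v w s) := by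
    obtain ⟨R', hR'⟩ := exists_eval_eq_polyFun_line (lineLift p i v w 0) _ hR
    exact ⟨R', fun s => (hR' s).trans (congrArg R (lineLift_eq_add_smul i v w s).symm)⟩
  obtain ⟨P', hP'⟩ := hline hP
  obtain ⟨Q', hQ'⟩ := hline hQ
  refine ⟨P', Q', by rwa [hQ'], fun s x hx hs => ?_⟩
  have hcone := lineLift_mem_cone hp hv0 hv hw s
  rw [hQ'] at hs
  rw [hP', hQ', ← hPQ _ hcone hs, hgF _ hcone _ (isExcEq_lineLift hv s) x hx.symm,
    Fintype.prod_eq_single i fun j hj => by rw [Pi.mulSingle_eq_of_ne hj, one_zpow],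
    Pi.mulSingle_eq_same]

theorem X_pow_dvd_of_eval_mul_inv_eq {K : Type*} [Field K] [Infinite K] {G P Q : Polynomial K}
    {m : ℕ} (hQ : Q.eval 0 ≠ 0)
    (h : ∀ s ≠ 0, Q.eval s ≠ 0 → G.eval s * (s ^ m)⁻¹ = P.eval s / Q.eval s) :
    Polynomial.X ^ m ∣ G := by
  have hQ0 : Q ≠ 0 := by
    rintro rfl
    exact hQ Polynomial.eval_zero
  have hmul : G * Q = P * Polynomial.X ^ m := by
    refine mul_right_cancel₀ (mul_ne_zero hQ0 Polynomial.X_ne_zero)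
      (Polynomial.funext fun s => ?_)
    rw [Polynomial.eval_mul (p := G * Q), Polynomial.eval_mul (p := P * Polynomial.X ^ m)]
    by_cases hs : (Q * Polynomial.X).eval s = 0
    · rw [hs, mul_zero, mul_zero]
    · rw [Polynomial.eval_mul, Polynomial.eval_X] at hs
      have hs0 := right_ne_zero_of_mul hs
      have hQs := left_ne_zero_of_mul hs
      congr 1
      rw [Polynomial.eval_mul, Polynomial.eval_mul, Polynomial.eval_pow, Polynomial.eval_X,
        ← (eq_div_iff hQs).1 (h s hs0 hQs), mul_right_comm _ _ (s ^ m),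
        inv_mul_cancel_right₀ (pow_ne_zero m hs0)]
  have hdvd : Polynomial.X ^ m ∣ G * Q := hmul ▸ dvd_mul_left _ _
  have hXQ : ¬ Polynomial.X ∣ Q := by
    rwa [Polynomial.X_dvd_iff, Polynomial.coeff_zero_eq_eval_zero]
  exact Polynomial.prime_X.pow_dvd_of_dvd_mul_right m hXQ hdvd

variable [NeZero r] {B : Vec n ≃ₗ[ℂ] Vec n} {y : Fin r → ℂ} {d : ℕ} {e : Fin r → ℤ}

theorem IsMomentChart.X_pow_dvd_along (h : IsMomentChart p B y) (hn : 1 ≤ n) {D : Div r}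
    {G : MvPolynomial (Fin (n + 1)) ℂ} (hF : polySection p B (rename Fin.val G) ∈ H0 p D)
    {m : ℕ} (hm : D.2 i = -m) {z : Vec n}
    (hz : ∀ j, B z ∉ (p i).submodule ⊔ (p j).submodule) :
    Polynomial.X ^ m ∣ along (momentVec n (y i)) z G := by
  have hv : B (momentVec n (y i)) ∈ (p i).submodule :=
    (h.apply_mem_iff i _).2 (Submodule.mem_span_singleton_self _)
  obtain ⟨P, Q, hQ, hPQ⟩ := exists_quotient_along_line (h.injective_points hn) hF
    ((LinearEquiv.map_ne_zero_iff B).2 (momentVec_ne_zero n (y i))) hv hz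
  refine X_pow_dvd_of_eval_mul_inv_eq (P := P) hQ fun s hs hQs => ?_
  have heq := hPQ s (offMk _ fun j => add_smul_notMem_of_notMem_sup hv (hz j) hs) rfl hQs
  rw [polySection_rename, hm, zpow_neg, zpow_natCast] at heq
  rw [← heq, eval_along]
  simp [offMk]

theorem IsMomentChart.dirDeriv_pow_eq_zero (h : IsMomentChart p B y) (hn : 2 ≤ n)
    {P : MvPolynomial ℕ ℂ} (hP : P.IsHomogeneous d) (hs : P ∈ supported ℂ {i | i + 2 ≤ n + 2})
    (hF : polySection p B P ∈ H0 p (d, e)) {k : ℕ} (hk : d + e i < k) :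
    (dirDeriv (momentCurve (y i)) ^ k) P = 0 := by
  rcases lt_or_ge d k with hdk | hdk
  · exact BlowUpCox.dirDeriv_pow_eq_zero _ hP hdk
  obtain ⟨m, hm⟩ : ∃ m : ℕ, e i = -m := ⟨(-e i).toNat, by omega⟩
  obtain ⟨Q, hQ⟩ := mem_supported_iff_exists_rename.1
    (dirDeriv_pow_mem_supported (momentCurve (y i)) hs k)
  obtain ⟨G, rfl⟩ := mem_supported_iff_exists_rename.1 hs
  have hV (j : Fin r) : ((p i).submodule ⊔ (p j).submodule).comap B.toLinearMap ≠ ⊤ :=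
    comap_ne_top B (h.submodule_eq j ▸
      sup_span_singleton_ne_top (submodule_finrank_add_one_lt hn i) _)
  rw [← hQ]
  suffices hQ0 : Q = 0 by rw [hQ0, map_zero]
  refine eq_of_eval_eq_avoiding hV fun z hz => ?_
  have hcoeff : (along z (momentVec n (y i)) G).coeff k = 0 := by
    rw [coeff_along_swap ((IsHomogeneous.rename_isHomogeneous_iff Fin.val_injective).1 hP) _ _ hdk]
    exact Polynomial.X_pow_dvd_iff.1 (h.X_pow_dvd_along (by omega) hF hm hz) _ (by omega)
  have hfun : extendVec n z ∘ Fin.val = z := funext (extendVec_apply z)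
  have hmom : momentCurve (y i) ∘ Fin.val = momentVec n (y i) := rfl
  rw [map_zero, ← eval_extendVec_rename, hQ, ← factorial_mul_coeff_along, along_rename, hfun,
    hmom, hcoeff, mul_zero]

end Multiplicity

section RegularAt

variable {W : Type} [AddCommGroup W] [Module ℂ W] {S : Set W} {z : W}

/-- The functions that are quotients of polynomial functions on `S` near `z`, so that
`IsRegularOn S g` says that `g` belongs to all `regularAt S z` with `z ∈ S`. -/
def regularAt (S : Set W) (z : W) : Subalgebra ℂ (W → ℂ) where
  carrier := {g | ∃ P ∈ polyFun W, ∃ Q ∈ polyFun W,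
    Q z ≠ 0 ∧ ∀ w ∈ S, Q w ≠ 0 → g w = P w / Q w}
  add_mem' := by
    rintro f g ⟨P, hP, Q, hQ, hQz, hf⟩ ⟨P', hP', Q', hQ', hQz', hg⟩
    refine ⟨P * Q' + Q * P', add_mem (mul_mem hP hQ') (mul_mem hQ hP'), Q * Q', mul_mem hQ hQ',
      mul_ne_zero hQz hQz', fun w hw hne => ?_⟩
    have hQw : Q w ≠ 0 := left_ne_zero_of_mul hne
    have hQw' : Q' w ≠ 0 := right_ne_zero_of_mul hne
    simp only [Pi.add_apply, Pi.mul_apply, hf w hw hQw, hg w hw hQw']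
    exact div_add_div _ _ hQw hQw'
  mul_mem' := by
    rintro f g ⟨P, hP, Q, hQ, hQz, hf⟩ ⟨P', hP', Q', hQ', hQz', hg⟩
    refine ⟨P * P', mul_mem hP hP', Q * Q', mul_mem hQ hQ', mul_ne_zero hQz hQz',
      fun w hw hne => ?_⟩
    simp only [Pi.mul_apply, hf w hw (left_ne_zero_of_mul hne), hg w hw (right_ne_zero_of_mul hne)]
    exact div_mul_div_comm _ _ _ _
  algebraMap_mem' c := ⟨_, (polyFun W).algebraMap_mem c, 1, (polyFun W).one_mem, one_ne_zero,
    fun w _ _ => by simp⟩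

theorem mem_regularAt_of_mem_polyFun {P : W → ℂ} (hP : P ∈ polyFun W) : P ∈ regularAt S z :=
  ⟨P, hP, 1, (polyFun W).one_mem, one_ne_zero, fun w _ _ => by simp⟩

theorem exists_polyFun_ne_zero_of_mem_regularAt {f : W → ℂ} (hf : f ∈ regularAt S z) (hz : z ∈ S)
    (hfz : f z ≠ 0) : ∃ R ∈ polyFun W, R z ≠ 0 ∧ ∀ w ∈ S, R w ≠ 0 → f w ≠ 0 := by
  obtain ⟨P, hP, Q, hQ, hQz, hPQ⟩ := hf
  rw [hPQ z hz hQz] at hfz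
  refine ⟨P * Q, mul_mem hP hQ, mul_ne_zero (div_ne_zero_iff.1 hfz).1 hQz, fun w hw hne => ?_⟩
  rw [hPQ w hw (right_ne_zero_of_mul hne)]
  exact div_ne_zero (left_ne_zero_of_mul hne) (right_ne_zero_of_mul hne)

theorem inv_mem_regularAt {f : W → ℂ} (hf : f ∈ regularAt S z) (hz : z ∈ S) (hfz : f z ≠ 0) :
    f⁻¹ ∈ regularAt S z := by
  obtain ⟨P, hP, Q, hQ, hQz, hPQ⟩ := hf
  rw [hPQ z hz hQz] at hfz
  refine ⟨Q * Q, mul_mem hQ hQ, P * Q, mul_mem hP hQ,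
    mul_ne_zero (div_ne_zero_iff.1 hfz).1 hQz, fun w hw hne => ?_⟩
  have hQw : Q w ≠ 0 := right_ne_zero_of_mul hne
  rw [Pi.inv_apply, Pi.mul_apply, Pi.mul_apply, hPQ w hw hQw, inv_div, mul_div_mul_right _ _ hQw]

theorem zpow_mem_regularAt {f : W → ℂ} (hf : f ∈ regularAt S z) (hz : z ∈ S) (hfz : f z ≠ 0)
    (e : ℤ) : f ^ e ∈ regularAt S z := by
  obtain ⟨m, rfl | rfl⟩ := e.eq_nat_or_neg
  · rw [zpow_natCast]
    exact pow_mem hf m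
  · rw [zpow_neg, zpow_natCast, ← inv_pow]
    exact pow_mem (inv_mem_regularAt hf hz hfz) m

theorem mem_regularAt_of_eqOn {f g R : W → ℂ} (hf : f ∈ regularAt S z) (hR : R ∈ polyFun W)
    (hRz : R z ≠ 0) (h : ∀ w ∈ S, R w ≠ 0 → g w = f w) : g ∈ regularAt S z := by
  obtain ⟨P, hP, Q, hQ, hQz, hPQ⟩ := hf
  refine ⟨P * R, mul_mem hP hR, Q * R, mul_mem hQ hR, mul_ne_zero hQz hRz, fun w hw hne => ?_⟩
  have hRw : R w ≠ 0 := right_ne_zero_of_mul hne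
  rw [h w hw hRw, hPQ w hw (left_ne_zero_of_mul hne), Pi.mul_apply, Pi.mul_apply,
    mul_div_mul_right _ _ hRw]

variable {ι : Type*} [Fintype ι] {t : ι → W → ℂ}

theorem exists_isRegularOn_mul_prod_zpow [Nonempty ι] (ht : ∀ i, ∀ z ∈ S, t i ∈ regularAt S z)
    (hne : ∀ z ∈ S, ∃ i, ∀ j ≠ i, t j z ≠ 0) (e : ι → ℤ) (f : W → ℂ) {K : ι → W → ℂ}
    (hKreg : ∀ i, ∀ z ∈ S, K i ∈ regularAt S z)
    (hK : ∀ i, ∀ z ∈ S, t i z ≠ 0 → K i z = f z * t i z ^ e i) :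
    ∃ g, IsRegularOn S g ∧ ∀ z ∈ S, (∀ i, t i z ≠ 0) → g z = f z * ∏ i, t i z ^ e i := by
  classical
  let L (i : ι) (z : W) : ℂ := K i z * ∏ j ∈ Finset.univ.erase i, t j z ^ e j
  have hL (i : ι) (z : W) (hz : z ∈ S) (hi : t i z ≠ 0) : L i z = f z * ∏ j, t j z ^ e j := by
    rw [← Finset.mul_prod_erase _ _ (Finset.mem_univ i), ← mul_assoc, ← hK i z hz hi]
  choose! i hi using hne
  have hglue (z : W) (hz : z ∈ S) (j : ι) (hj : ∀ k ≠ j, t k z ≠ 0) : L (i z) z = L j z := by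
    rcases eq_or_ne (i z) j with rfl | hij
    · rfl
    · rw [hL _ z hz (hj _ hij), hL j z hz (hi z hz j hij.symm)]
  refine ⟨fun z => L (i z) z, fun z hz => ?_, fun z hz hz0 => hL _ z hz (hz0 _)⟩
  have hprod : ∏ j ∈ Finset.univ.erase (i z), t j ∈ regularAt S z :=
    prod_mem fun j _ => ht j z hz
  have hzpow : ∏ j ∈ Finset.univ.erase (i z), t j ^ e j ∈ regularAt S z := prod_mem fun j hj =>
    zpow_mem_regularAt (ht j z hz) hz (hi z hz j (Finset.ne_of_mem_erase hj)) (e j)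
  obtain ⟨R, hR, hRz, hRw⟩ := exists_polyFun_ne_zero_of_mem_regularAt hprod hz (by
    rw [Finset.prod_apply]
    exact Finset.prod_ne_zero_iff.2 fun j hj => hi z hz j (Finset.ne_of_mem_erase hj))
  refine mem_regularAt_of_eqOn (mul_mem (hKreg (i z) z hz) hzpow) hR hRz fun w hw hw0 => ?_
  have hw' := hRw w hw hw0
  rw [Finset.prod_apply] at hw'
  rw [hglue w hw (i z) fun j hj =>
    Finset.prod_ne_zero_iff.1 hw' j (Finset.mem_erase.2 ⟨hj, Finset.mem_univ j⟩)]
  simp only [L, Pi.mul_apply, Finset.prod_apply, Pi.pow_apply]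

end RegularAt

section Extension

variable {n r : ℕ} {p : Fin r → ℙ ℂ (Vec n)}

open Classical in
/-- The equations of the exceptional divisors, as functions on the multicone; the value outside
the multicone is irrelevant. -/
def excEq (z : Ambient p) : Fin r → ℂ := if h : ∃ t, IsExcEq p z t then h.choose else 0

theorem isExcEq_excEq {z : Ambient p} (hz : z ∈ cone p) : IsExcEq p z (excEq z) := by
  have h := (mem_cone.1 hz).2.2
  rw [excEq, dif_pos h]
  exact h.choose_spec

theorem excEq_mem_regularAt (i : Fin r) {z : Ambient p} (hz : z ∈ cone p) :
    (excEq · i) ∈ regularAt (cone p) z := by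
  obtain ⟨φ, hφ⟩ : ∃ φ : Module.Dual ℂ (Dir p i), φ (z.2 i) ≠ 0 := by
    by_contra! h
    exact (mem_cone.1 hz).2.1 i ((Module.forall_dual_apply_eq_zero_iff ℂ _).1 h)
  refine ⟨fun w => φ ((p i).submodule.mkQ w.1),
    Algebra.subset_adjoin ⟨φ ∘ₗ (p i).submodule.mkQ ∘ₗ LinearMap.fst ℂ _ _, rfl⟩,
    fun w => φ (w.2 i),
    Algebra.subset_adjoin ⟨φ ∘ₗ LinearMap.proj i ∘ₗ LinearMap.snd ℂ _ _, rfl⟩, hφ,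
    fun w hw hne => ?_⟩
  beta_reduce at hne ⊢
  rw [isExcEq_excEq hw i, map_smul, smul_eq_mul, mul_div_cancel_right₀ _ hne]

theorem exists_forall_excEq_ne_zero [NeZero r] (hp : Function.Injective p) {z : Ambient p}
    (hz : z ∈ cone p) : ∃ i, ∀ j ≠ i, excEq z j ≠ 0 := by
  have hmem (i : Fin r) (hi : excEq z i = 0) : z.1 ∈ (p i).submodule := by
    rw [← Submodule.Quotient.mk_eq_zero, ← Submodule.mkQ_apply, isExcEq_excEq hz i, hi, zero_smul]
  by_cases! h : ∃ i, excEq z i = 0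
  · obtain ⟨i, hi⟩ := h
    exact ⟨i, fun j hj hj0 =>
      hj (hp (eq_of_mem_submodule (mem_cone.1 hz).1 (hmem j hj0) (hmem i hi)))⟩
  · exact ⟨0, fun j _ => h j⟩

theorem exists_mkQ_splitting_of_span_singleton {K V : Type*} [Field K] [AddCommGroup V] [Module K V]
    {U : Submodule K V} {v : V} (hU : U = Submodule.span K {v}) (hv : v ≠ 0) :
    ∃ (σ : (V ⧸ U) →ₗ[K] V) (α : V →ₗ[K] K), ∀ x, x = σ (U.mkQ x) + α x • v := by
  obtain ⟨σ, hσ⟩ := U.mkQ.exists_rightInverse_of_surjective U.range_mkQ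
  obtain ⟨β, hβ⟩ := Module.Projective.exists_dual_eq_one K hv
  refine ⟨σ, β ∘ₗ (LinearMap.id - σ ∘ₗ U.mkQ), fun x => ?_⟩
  have hx : x - σ (U.mkQ x) ∈ U := by
    rw [← Submodule.Quotient.mk_eq_zero, ← Submodule.mkQ_apply, map_sub, sub_eq_zero]
    exact (LinearMap.congr_fun hσ (U.mkQ x)).symm
  obtain ⟨c, hc⟩ := Submodule.mem_span_singleton.1 (hU.le hx)
  have hβc : β (x - σ (U.mkQ x)) = c := by rw [← hc, map_smul, hβ, smul_eq_mul, mul_one]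
  simp only [LinearMap.comp_apply, LinearMap.sub_apply, LinearMap.id_apply, hβc, hc]
  exact (add_sub_cancel _ _).symm

theorem eval_congr_of_mem_supported {R σ : Type*} [CommSemiring R] {s : Set σ}
    {P : MvPolynomial σ R} (hP : P ∈ supported R s) {z w : σ → R} (h : ∀ i ∈ s, z i = w i) :
    eval z P = eval w P :=
  eval₂Hom_congr' rfl (fun i hi _ => h i (mem_supported.1 hP hi)) rfl

variable {B : Vec n ≃ₗ[ℂ] Vec n} {y : Fin r → ℂ} {d : ℕ} {P : MvPolynomial ℕ ℂ}

/-- Expanding `P` along the line from the point `p i` in the direction `z.2 i` cancels the power of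
the equation of `E i` in the denominator. -/
theorem IsMomentChart.exists_local_extension (h : IsMomentChart p B y) (i : Fin r) {m : ℕ}
    (hP : P.IsHomogeneous d) (hs : P ∈ supported ℂ {i | i + 2 ≤ n + 2})
    (hm : ∀ k, m < k → (dirDeriv (momentCurve (y i)) ^ k) P = 0) :
    ∃ K : Ambient p → ℂ, (∀ z ∈ cone p, K ∈ regularAt (cone p) z) ∧
      ∀ z ∈ cone p, excEq z i ≠ 0 →
        K z = eval (extendVec n (B.symm z.1)) P * excEq z i ^ ((m : ℤ) - d) := by
  obtain ⟨σ, α, hσ⟩ := exists_mkQ_splitting_of_span_singleton (h.submodule_eq i)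
    ((LinearEquiv.map_ne_zero_iff B).2 (momentVec_ne_zero n (y i)))
  let φ : Ambient p →ₗ[ℂ] (ℕ → ℂ) :=
    extendVec n ∘ₗ B.symm.toLinearMap ∘ₗ σ ∘ₗ LinearMap.proj i ∘ₗ LinearMap.snd ℂ _ _
  let ψ : Ambient p → ℂ := fun z => α z.1
  have hψ : ψ ∈ polyFun (Ambient p) := Algebra.subset_adjoin ⟨α ∘ₗ LinearMap.fst ℂ _ _, rfl⟩
  let Pk (k : ℕ) : Ambient p → ℂ := fun z => eval (φ z) ((dirDeriv (momentCurve (y i)) ^ k) P)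
  refine ⟨∑ k ∈ Finset.range (m + 1), algebraMap ℂ _ (k.factorial : ℂ)⁻¹ * Pk k * ψ ^ k *
    (excEq · i) ^ (m - k), fun z hz => sum_mem fun k _ => ?_, fun z hz hne => ?_⟩
  · exact mul_mem (mul_mem (mul_mem (Subalgebra.algebraMap_mem _ _)
      (mem_regularAt_of_mem_polyFun (eval_comp_mem_polyFun φ _)))
      (pow_mem (mem_regularAt_of_mem_polyFun hψ) k)) (pow_mem (excEq_mem_regularAt i hz) _)
  · have heval : eval (extendVec n (B.symm z.1)) P =
        eval (excEq z i • φ z + ψ z • momentCurve (y i)) P := by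
      refine eval_congr_of_mem_supported hs fun j hj => ?_
      have hj' : extendVec n (momentVec n (y i)) j = momentCurve (y i) j :=
        extendVec_apply (momentVec n (y i)) ⟨j, Nat.lt_of_add_lt_add_right hj⟩
      have hz1 : B.symm z.1 = excEq z i • B.symm (σ (z.2 i)) + ψ z • momentVec n (y i) := by
        conv_lhs => rw [hσ z.1, isExcEq_excEq hz i]
        rw [map_smul, map_add, map_smul, map_smul, B.symm_apply_apply]
      rw [hz1, map_add, map_smul, map_smul, Pi.add_apply, Pi.smul_apply (ψ z), hj']
      rfl
    rw [heval, eval_smul_add_smul_mul_zpow hP hm _ hne, Finset.sum_apply]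
    rfl

theorem IsMomentChart.polySection_mem_H0 [NeZero r] (h : IsMomentChart p B y) (hn : 1 ≤ n)
    {e : Fin r → ℤ} (hP : P.IsHomogeneous d) (hs : P ∈ supported ℂ {i | i + 2 ≤ n + 2})
    (hmult : ∀ i (k : ℕ), d + e i < k → (dirDeriv (momentCurve (y i)) ^ k) P = 0) :
    polySection p B P ∈ H0 p (d, e) := by
  by_cases! hneg : ∃ i, d + e i < 0
  · obtain ⟨i, hi⟩ := hneg
    have hP0 : P = 0 := hmult i 0 (by simpa using hi)
    rw [hP0, map_zero]
    exact Submodule.zero_mem _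
  choose m hm using fun i => Int.eq_ofNat_of_zero_le (hneg i)
  choose K hKreg hK using fun i => h.exists_local_extension i (m := m i) hP hs
    fun k hk => hmult i k (by rw [hm i]; exact_mod_cast hk)
  obtain ⟨g, hg, hgP⟩ := exists_isRegularOn_mul_prod_zpow (fun i z hz => excEq_mem_regularAt i hz)
    (fun z hz => exists_forall_excEq_ne_zero (h.injective_points hn) hz) e
    (fun z => eval (extendVec n (B.symm z.1)) P) hKreg
    (fun i z hz hne => by rw [hK i z hz hne, ← hm i, add_sub_cancel_left])
  refine ⟨fun c x x' _ hx => ?_, g, hg, fun z hz t ht x hx => ?_⟩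
  · rw [polySection_apply, polySection_apply, hx, map_smul, map_smul,
      eval_smul_of_isHomogeneous hP, zpow_natCast]
  · obtain rfl : t = excEq z := IsExcEq.unique hz ht (isExcEq_excEq hz)
    rw [hgP z hz fun i => exc_ne_zero ht x hx i, polySection_apply]
    simp only [hx]

end Extension

/-! ### Hankel determinants as sections -/

section HankelSection

variable {n r : ℕ}

theorem sum_E (J : Finset (Fin r)) :
    ∑ i ∈ J, E i = ((0 : ℤ), fun i => if i ∈ J then (1 : ℤ) else 0) := by
  refine Prod.ext ?_ (funext fun i => ?_)
  · simp [Prod.fst_sum, E]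
  · simp [Prod.snd_sum, E, Pi.single_apply]

theorem minimalDivisor_eq (k : ℕ) (I : Finset (Fin r)) :
    minimalDivisor k I = ((k : ℤ), fun i => (if i ∈ I then 0 else 1) - (k : ℤ)) := by
  rw [minimalDivisor, sum_E, sum_E]
  refine Prod.ext ?_ (funext fun i => ?_)
  · simp [H]
  · by_cases hi : i ∈ I <;> simp [H, hi]

theorem sum_minimalDivisor_add_sum_smul_E {N : ℕ} (k : Fin N → ℕ) (I : Fin N → Finset (Fin r))
    (m : Fin r → ℕ) : ∑ j, minimalDivisor (k j) (I j) + ∑ i, m i • E i =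
      (((∑ j, k j : ℕ) : ℤ), fun i =>
        ((Finset.univ.filter fun j => i ∉ I j).card + m i : ℤ) - (∑ j, k j : ℕ)) := by
  refine Prod.ext ?_ (funext fun i => ?_)
  · simp [minimalDivisor_eq, E, Prod.fst_sum]
  · have hcard : ((Finset.univ.filter fun j => i ∉ I j).card : ℤ) =
        ∑ j, if i ∈ I j then (0 : ℤ) else 1 := by
      rw [Finset.card_filter]
      push_cast
      exact Finset.sum_congr rfl fun j _ => ite_not _ _ _
    simp only [minimalDivisor_eq, E, Prod.snd_add, Prod.snd_sum, Prod.smul_snd, Pi.add_apply,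
      Finset.sum_apply, Finset.sum_sub_distrib, Pi.smul_apply, Pi.single_apply, hcard]
    simp
    ring

theorem sum_card_filter_notMem_add_sum_card {N : ℕ} (J : Fin N → Finset (Fin r)) :
    ∑ i, (Finset.univ.filter fun j => i ∉ J j).card + ∑ j, (J j).card = r * N := by
  have hinter := sum_card_inter J Finset.univ
  simp only [Finset.inter_univ] at hinter
  rw [hinter, ← Finset.sum_add_distrib]
  simp [card_filter_notMem_add_incidence]

theorem eq_of_minimalDivisor_eq_sum (hr : n + 3 ≤ r) {k : ℕ} (hk : 1 ≤ k)
    {I : Finset (Fin r)} (hI : I.card + 2 * k = n + 2) {N : ℕ} {l : Fin N → ℕ}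
    {J : Fin N → Finset (Fin r)} {m : Fin r → ℕ} (hJ : ∀ j, (J j).card + 2 * l j = n + 2)
    (h : minimalDivisor k I = ∑ j, minimalDivisor (l j) (J j) + ∑ i, m i • E i) :
    N = 1 ∧ ∀ j, l j = k ∧ J j = I := by
  rw [minimalDivisor_eq, sum_minimalDivisor_add_sum_smul_E, Prod.mk.injEq] at h
  have hsum : ∑ j, l j = k := Nat.cast_injective h.1.symm
  have hmult (i : Fin r) : (Finset.univ.filter fun j => i ∉ J j).card + m i =
      if i ∈ I then 0 else 1 := by
    have hi := congrFun h.2 i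
    rw [hsum] at hi
    split_ifs at hi ⊢ <;> omega
  have hN0 : N ≠ 0 := by
    rintro rfl
    rw [Fin.sum_univ_zero] at hsum
    omega
  have hnotMem : ∑ i, (Finset.univ.filter fun j => i ∉ J j).card + I.card ≤ r := by
    calc _ ≤ ∑ i, (if i ∈ I then 0 else 1) + I.card :=
          Nat.add_le_add_right (Finset.sum_le_sum fun i _ => Nat.le.intro (hmult i)) _
      _ = ∑ i, (if i ∈ I then 0 else 1) + ∑ i, (if i ∈ I then 1 else 0) := by simp
      _ = ∑ i : Fin r, 1 := by
          rw [← Finset.sum_add_distrib]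
          exact Finset.sum_congr rfl fun i _ => by split_ifs <;> rfl
      _ ≤ r := by simp
  have hcard : ∑ j, (J j).card + 2 * k = N * (n + 2) := by
    rw [← hsum, Finset.mul_sum, ← Finset.sum_add_distrib]
    simp [hJ]
  have hN : N = 1 := by
    by_contra hN1
    have hN2 : 2 ≤ N := by omega
    nlinarith [sum_card_filter_notMem_add_sum_card J]
  subst hN
  have hl : l 0 = k := by rwa [Fin.sum_univ_one] at hsum
  have hIJ : I ⊆ J 0 := fun i hi => by
    by_contra hiJ
    have hpos : 0 < (Finset.univ.filter fun j => i ∉ J j).card :=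
      Finset.card_pos.2 ⟨0, by simpa using hiJ⟩
    have hle := hmult i
    rw [if_pos hi] at hle
    omega
  have hJI : J 0 = I := (Finset.eq_of_subset_of_card_le hIJ (by have := hJ 0; omega)).symm
  exact ⟨rfl, fun j => by rw [Fin.fin_one_eq_zero j]; exact ⟨hl, hJI⟩⟩

variable {p : Fin r → ℙ ℂ (Vec n)} {B : Vec n ≃ₗ[ℂ] Vec n} {y : Fin r → ℂ}

/-- The section of `minimalDivisor k I` given by a Hankel determinant, for `|I| + 2k = n + 2`. -/
def hankelSection (p : Fin r → ℙ ℂ (Vec n)) (B : Vec n ≃ₗ[ℂ] Vec n) (y : Fin r → ℂ) (k : ℕ)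
    (I : Finset (Fin r)) : Off p → ℂ :=
  polySection p B (hankel k (Lagrange.nodal (I.image y) id))

theorem hankelSection_zero (I : Finset (Fin r)) : hankelSection p B y 0 I = 1 := by
  rw [hankelSection, hankel_zero, map_one]

theorem hankel_nodal_image_mem_supported (hy : Function.Injective y) {k : ℕ} {I : Finset (Fin r)}
    (hI : I.card + 2 * k = n + 2) :
    hankel k (Lagrange.nodal (I.image y) id) ∈ supported ℂ {i | i + 2 ≤ n + 2} := by
  refine hankel_mem_supported (le_of_eq ?_)
  rw [Lagrange.natDegree_nodal, Finset.card_image_of_injective _ hy, hI]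

theorem IsMomentChart.exists_prod_hankelSection_eq (h : IsMomentChart p B y) {d N : ℕ}
    {e : Fin r → ℤ} {b : ℂ → ℕ} (hb : ∀ i, (b (y i) : ℤ) = d + e i) {k : Fin N → ℕ}
    {I : Fin N → Finset ℂ}
    (hI : IsConfiguration (n + 2) d (Finset.univ.image y) b ∅ k I)
    (hsub : ∀ j, I j ⊆ Finset.univ.image y) :
    ∃ (J : Fin N → Finset (Fin r)) (m : Fin r → ℕ), (∀ j, (J j).card + 2 * k j = n + 2) ∧
      ((d, e) : Div r) = ∑ j, minimalDivisor (k j) (J j) + ∑ i, m i • E i ∧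
      polySection p B (hankelProd k I) = ∏ j, hankelSection p B y (k j) (J j) := by
  choose J _ hJ using fun j => Finset.subset_image_iff.1 (hsub j)
  obtain rfl : I = fun j => (J j).image y := funext fun j => (hJ j).symm
  have hincidence (i : Fin r) : incidence (fun j => (J j).image y) (y i) = incidence J i := by
    simp only [incidence, h.injective.mem_finset_image]
  have hmult (i : Fin r) : (Finset.univ.filter fun j => i ∉ J j).card ≤ b (y i) := by
    have hN := card_filter_notMem_add_incidence J i
    have hle := hI.mult (y i) (Finset.mem_image_of_mem y (Finset.mem_univ i))
    rw [hincidence] at hle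
    rw [Fintype.card_fin] at hN
    omega
  choose m hm using fun i => Nat.le.dest (hmult i)
  refine ⟨J, m, fun j => ?_, ?_, map_prod _ _ _⟩
  · rw [← Finset.card_image_of_injective _ h.injective]
    exact hI.card j
  · rw [sum_minimalDivisor_add_sum_smul_E, hI.sum]
    refine Prod.ext rfl (funext fun i => ?_)
    have hi : ((Finset.univ.filter fun j => i ∉ J j).card + m i : ℤ) = d + e i := by
      rw [← hb]
      exact_mod_cast hm i
    exact (sub_eq_of_eq_add' hi).symm

variable [NeZero r]

theorem hankelSection_ne_zero (hn : 2 ≤ n) (hy : Function.Injective y) {k : ℕ}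
    {I : Finset (Fin r)} (hI : I.card + 2 * k = n + 2) : hankelSection p B y k I ≠ 0 :=
  polySection_ne_zero hn B (hankel_nodal_image_mem_supported hy hI)
    (hankel_ne_zero k Lagrange.nodal_ne_zero)

namespace IsMomentChart

theorem hankelSection_mem_H0 (h : IsMomentChart p B y) (hn : 1 ≤ n) {k : ℕ} {I : Finset (Fin r)}
    (hI : I.card + 2 * k = n + 2) : hankelSection p B y k I ∈ H0 p (minimalDivisor k I) := by
  rw [minimalDivisor_eq]
  refine h.polySection_mem_H0 hn (isHomogeneous_hankel _ _)
    (hankel_nodal_image_mem_supported h.injective hI) fun i m hm => ?_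
  by_cases hi : i ∈ I
  · obtain ⟨m, rfl⟩ : ∃ m', m = m' + 1 := ⟨m - 1, by rw [if_pos hi] at hm; omega⟩
    rw [pow_succ, Module.End.mul_apply, dirDeriv_hankel_eq_zero k
      (eval_nodal_eq_zero_iff.2 (Finset.mem_image_of_mem y hi)), map_zero]
  · obtain ⟨m, rfl⟩ : ∃ m', m = m' + 2 := ⟨m - 2, by rw [if_neg hi] at hm; omega⟩
    rw [pow_add, pow_two, Module.End.mul_apply, Module.End.mul_apply, dirDeriv_dirDeriv_hankel,
      map_zero]

theorem one_mem_H0_E (h : IsMomentChart p B y) (hn : 1 ≤ n) (i : Fin r) :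
    (1 : Off p → ℂ) ∈ H0 p (E i) := by
  rw [← map_one (polySection p B)]
  refine h.polySection_mem_H0 hn (isHomogeneous_one _ _) (one_mem _) fun j m hm => ?_
  have hnonneg : (0 : ℤ) ≤ (Pi.single i 1 : Fin r → ℤ) j := by
    rw [Pi.single_apply]
    split_ifs <;> simp
  obtain ⟨m, rfl⟩ : ∃ m', m = m' + 1 := ⟨m - 1, by push_cast at hm; omega⟩
  rw [pow_succ, Module.End.mul_apply, ← C_1, dirDeriv_C, map_zero]

theorem mem_span_prod_hankelSection (h : IsMomentChart p B y) (hn : 2 ≤ n) (hr : n + 2 ≤ r)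
    {D : Div r} {F : Off p → ℂ} (hF : F ∈ H0 p D) :
    F ∈ Submodule.span ℂ {S | ∃ (N : ℕ) (k : Fin N → ℕ) (I : Fin N → Finset (Fin r))
      (m : Fin r → ℕ), (∀ j, (I j).card + 2 * k j = n + 2) ∧
      D = ∑ j, minimalDivisor (k j) (I j) + ∑ i, m i • E i ∧
      S = ∏ j, hankelSection p B y (k j) (I j)} := by
  rcases eq_or_ne F 0 with rfl | hF0
  · exact Submodule.zero_mem _
  obtain ⟨d, P, hd, hP, hs, rfl⟩ := exists_polySection_eq_of_mem_H0 hn B hF hF0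
  obtain ⟨_, e⟩ := D
  obtain rfl := hd
  have hP0 : P ≠ 0 := by
    rintro rfl
    exact hF0 (map_zero _)
  have hderiv (i : Fin r) {k : ℕ} (hk : d + e i < k) :
      (dirDeriv (momentCurve (y i)) ^ k) P = 0 := h.dirDeriv_pow_eq_zero hn hP hs hF hk
  have hnonneg (i : Fin r) : 0 ≤ d + e i := by
    by_contra! hneg
    exact hP0 (hderiv i (k := 0) (by simpa using hneg))
  choose m hm using fun i => Int.eq_ofNat_of_zero_le (hnonneg i)
  let b : ℂ → ℕ := Function.extend y m 0
  have hb (i : Fin r) : (b (y i) : ℤ) = d + e i :=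
    (congrArg Nat.cast (h.injective.extend_apply m 0 i)).trans (hm i).symm
  have hspan := mem_span_hankelProd (Λ := Finset.univ.image y) (b := b) hP hs
    (Finset.forall_mem_image.2 fun i _ =>
      hderiv i (by rw [← hb]; exact_mod_cast Nat.lt_succ_self _))
    (by rwa [Finset.card_image_of_injective _ h.injective, Finset.card_fin])
  have hmap := Submodule.mem_map_of_mem (f := (polySection p B).toLinearMap) hspan
  rw [Submodule.map_span] at hmap
  refine Submodule.span_mono ?_ hmap
  rintro _ ⟨_, ⟨N, k, I, hI, hsub, rfl⟩, rfl⟩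
  obtain ⟨J, m, hJ, hD, hprod⟩ := h.exists_prod_hankelSection_eq hb hI hsub
  exact ⟨N, k, J, m, hJ, hD, hprod⟩

theorem H0_E_le_span (h : IsMomentChart p B y) (hn : 2 ≤ n) (hr : n + 2 ≤ r) (i : Fin r) :
    H0 p (E i) ≤ Submodule.span ℂ {1} := by
  intro F hF
  refine Submodule.span_mono ?_ (h.mem_span_prod_hankelSection hn hr hF)
  rintro _ ⟨N, k, I, m, -, hD, rfl⟩
  rw [sum_minimalDivisor_add_sum_smul_E] at hD
  have hsum : ∑ j, k j = 0 := (Nat.cast_injective (congrArg Prod.fst hD)).symm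
  refine Finset.prod_eq_one fun j _ => ?_
  rw [Finset.sum_eq_zero_iff.1 hsum j (Finset.mem_univ j), hankelSection_zero]

theorem H0_minimalDivisor_le_span (h : IsMomentChart p B y) (hn : 2 ≤ n) (hr : n + 3 ≤ r)
    {k : ℕ} (hk : 1 ≤ k) {I : Finset (Fin r)} (hI : I.card + 2 * k = n + 2) :
    H0 p (minimalDivisor k I) ≤ Submodule.span ℂ {hankelSection p B y k I} := by
  intro F hF
  refine Submodule.span_mono ?_ (h.mem_span_prod_hankelSection hn (by omega) hF)
  rintro _ ⟨N, l, J, m, hJ, hD, rfl⟩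
  obtain ⟨rfl, hlJ⟩ := eq_of_minimalDivisor_eq_sum hr hk hI hJ hD
  rw [Set.mem_singleton_iff, Fin.prod_univ_one, (hlJ 0).1, (hlJ 0).2]

theorem finrank_H0 (h : IsMomentChart p B y) (hn : 2 ≤ n) (hr : n + 3 ≤ r) {D : Div r}
    (hD : D ∈ generatorDivisors n r) : Module.finrank ℂ (H0 p D) = 1 := by
  suffices ∃ s ∈ H0 p D, s ≠ 0 ∧ H0 p D ≤ Submodule.span ℂ {s} by
    obtain ⟨s, hs, hs0, hle⟩ := this
    rw [le_antisymm hle ((Submodule.span_singleton_le_iff_mem _ _).2 hs)]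
    exact finrank_span_singleton hs0
  obtain ⟨i, rfl⟩ | ⟨k, I, hk, hkn, hI, rfl⟩ := hD
  · have hone : (1 : Off p → ℂ) ≠ 0 :=
      map_one (polySection p B) ▸ polySection_ne_zero hn B (one_mem _) one_ne_zero
    exact ⟨1, h.one_mem_H0_E (by omega) i, hone, h.H0_E_le_span hn (by omega) i⟩
  · have hI' : I.card + 2 * k = n + 2 := by omega
    exact ⟨_, h.hankelSection_mem_H0 (by omega) hI', hankelSection_ne_zero hn h.injective hI',
      h.H0_minimalDivisor_le_span hn hr hk hI'⟩

end IsMomentChart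

end HankelSection

/-! ### Generation of the Cox ring -/

section Generation

variable {n r : ℕ} {p : Fin r → ℙ ℂ (Vec n)}

theorem finite_generatorDivisors (n r : ℕ) : (generatorDivisors n r).Finite := by
  refine ((Set.finite_range (E : Fin r → Div r)).union
    ((Set.finite_Iic (n + 2)).image2 minimalDivisor
      (Set.finite_univ : (Set.univ : Set (Finset (Fin r))).Finite))).subset ?_
  rintro D (⟨i, rfl⟩ | ⟨k, I, -, hk, -, rfl⟩)
  · exact Or.inl ⟨i, rfl⟩
  · exact Or.inr ⟨k, Set.mem_Iic.2 (by omega), I, Set.mem_univ I, rfl⟩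

/-- The sections of `D` whose classes in the Cox ring lie in the subalgebra `A`. -/
def sectionsIn (A : Subalgebra ℂ (Cox p)) (D : Div r) : Submodule ℂ (Off p → ℂ) :=
  (A.toSubmodule.comap (DirectSum.lof ℂ (Div r) (fun D => H0 p D) D)).map (H0 p D).subtype

variable {A : Subalgebra ℂ (Cox p)}

theorem mem_sectionsIn {D : Div r} {F : Off p → ℂ} : F ∈ sectionsIn A D ↔
    ∃ h : F ∈ H0 p D, DirectSum.of (fun D => H0 p D) D ⟨F, h⟩ ∈ A := by
  rw [sectionsIn, Submodule.mem_map]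
  constructor
  · rintro ⟨⟨F, h⟩, hA, rfl⟩
    exact ⟨h, hA⟩
  · rintro ⟨h, hA⟩
    exact ⟨⟨F, h⟩, hA, rfl⟩

theorem one_mem_sectionsIn : (1 : Off p → ℂ) ∈ sectionsIn A 0 :=
  mem_sectionsIn.2 ⟨SetLike.GradedOne.one_mem, A.one_mem⟩

theorem mul_mem_sectionsIn {D D' : Div r} {F F' : Off p → ℂ} (h : F ∈ sectionsIn A D)
    (h' : F' ∈ sectionsIn A D') : F * F' ∈ sectionsIn A (D + D') := by
  obtain ⟨hF, hA⟩ := mem_sectionsIn.1 h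
  obtain ⟨hF', hA'⟩ := mem_sectionsIn.1 h'
  have hmul := A.mul_mem hA hA'
  rw [DirectSum.of_mul_of] at hmul
  exact mem_sectionsIn.2 ⟨SetLike.GradedMul.mul_mem hF hF', hmul⟩

theorem prod_mem_sectionsIn {ι : Type*} (s : Finset ι) {D : ι → Div r} {F : ι → Off p → ℂ}
    (h : ∀ i ∈ s, F i ∈ sectionsIn A (D i)) : ∏ i ∈ s, F i ∈ sectionsIn A (∑ i ∈ s, D i) := by
  classical
  induction s using Finset.induction_on with
  | empty => exact one_mem_sectionsIn
  | insert i s hi ih =>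
    rw [Finset.prod_insert hi, Finset.sum_insert hi]
    exact mul_mem_sectionsIn (h i (Finset.mem_insert_self i s))
      (ih fun j hj => h j (Finset.mem_insert_of_mem hj))

theorem one_mem_sectionsIn_sum {ι : Type*} (s : Finset ι) {D : ι → Div r}
    (h : ∀ i ∈ s, (1 : Off p → ℂ) ∈ sectionsIn A (D i)) :
    (1 : Off p → ℂ) ∈ sectionsIn A (∑ i ∈ s, D i) := by
  simpa only [Finset.prod_const_one] using prod_mem_sectionsIn s h

theorem one_mem_sectionsIn_nsmul {D : Div r} (h : (1 : Off p → ℂ) ∈ sectionsIn A D) (m : ℕ) :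
    (1 : Off p → ℂ) ∈ sectionsIn A (m • D) := by
  simpa using one_mem_sectionsIn_sum (Finset.range m) fun _ _ => h

theorem H0_le_sectionsIn_of_finrank_eq_one {D : Div r} (hD : Module.finrank ℂ (H0 p D) = 1)
    {x : H0 p D} (hx : x ≠ 0) (hA : DirectSum.of (fun D => H0 p D) D x ∈ A) :
    H0 p D ≤ sectionsIn A D := by
  intro F hF
  obtain ⟨c, hc⟩ := exists_smul_eq_of_finrank_eq_one hD hx ⟨F, hF⟩
  refine mem_sectionsIn.2 ⟨hF, ?_⟩
  rw [← hc, DirectSum.of_smul]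
  exact A.smul_mem hA c

theorem eq_top_of_forall_H0_le_sectionsIn (h : ∀ D, H0 p D ≤ sectionsIn A D) : A = ⊤ := by
  refine eq_top_iff.2 fun s _ => ?_
  induction s using DirectSum.induction_on with
  | zero => exact A.zero_mem
  | of D F => exact (mem_sectionsIn.1 (h D F.2)).2
  | add s t hs ht => exact A.add_mem (hs trivial) (ht trivial)

variable [NeZero r] {B : Vec n ≃ₗ[ℂ] Vec n} {y : Fin r → ℂ}

namespace IsMomentChart

theorem H0_le_sectionsIn (h : IsMomentChart p B y) (hn : 2 ≤ n) (hr : n + 2 ≤ r)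
    (hgen : ∀ D ∈ generatorDivisors n r, H0 p D ≤ sectionsIn A D) (D : Div r) :
    H0 p D ≤ sectionsIn A D := by
  have hE (i : Fin r) : (1 : Off p → ℂ) ∈ sectionsIn A (E i) :=
    hgen _ (Or.inl ⟨i, rfl⟩) (h.one_mem_H0_E (by omega) i)
  have hH {k : ℕ} {I : Finset (Fin r)} (hI : I.card + 2 * k = n + 2) :
      hankelSection p B y k I ∈ sectionsIn A (minimalDivisor k I) := by
    rcases Nat.eq_zero_or_pos k with rfl | hk
    · rw [hankelSection_zero]
      simpa [minimalDivisor] using one_mem_sectionsIn_sum Iᶜ fun i _ => hE i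
    · exact hgen _ (Or.inr ⟨k, I, hk, by omega, by omega, rfl⟩)
        (h.hankelSection_mem_H0 (by omega) hI)
  refine fun F hF => Submodule.span_le.2 ?_ (h.mem_span_prod_hankelSection hn hr hF)
  rintro _ ⟨N, k, I, m, hI, rfl, rfl⟩
  have hprod := prod_mem_sectionsIn Finset.univ fun j _ => hH (hI j)
  have hone := one_mem_sectionsIn_sum Finset.univ fun i _ => one_mem_sectionsIn_nsmul (hE i) (m i)
  rw [SetLike.mem_coe, ← mul_one (∏ j, _)]
  exact mul_mem_sectionsIn hprod hone

theorem adjoin_eq_top (h : IsMomentChart p B y) (hn : 2 ≤ n) (hr : n + 3 ≤ r)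
    {x : ∀ D : Div r, H0 p D} (hx : ∀ D ∈ generatorDivisors n r, x D ≠ 0) :
    Algebra.adjoin ℂ {s : Cox p | ∃ D ∈ generatorDivisors n r,
      s = DirectSum.of (fun D => H0 p D) D (x D)} = ⊤ :=
  eq_top_of_forall_H0_le_sectionsIn <| h.H0_le_sectionsIn hn (by omega) fun D hD =>
    H0_le_sectionsIn_of_finrank_eq_one (h.finrank_H0 hn hr hD) (hx D hD)
      (Algebra.subset_adjoin ⟨D, hD, rfl⟩)

end IsMomentChart

end Generation

theorem exists_forall_ne_zero_of_finrank_eq_one {K ι : Type*} {M : ι → Type*}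
    [DivisionRing K] [∀ i, AddCommGroup (M i)] [∀ i, Module K (M i)] {T : Set ι}
    (hT : ∀ i ∈ T, Module.finrank K (M i) = 1) : ∃ x : ∀ i, M i, ∀ i ∈ T, x i ≠ 0 := by
  have hx (i : ι) : ∃ x : M i, i ∈ T → x ≠ 0 := by
    by_cases hi : i ∈ T
    · have := Module.nontrivial_of_finrank_pos (R := K) ((hT i hi).symm ▸ one_pos)
      exact (exists_ne (0 : M i)).imp fun x hx _ => hx
    · exact ⟨0, fun h => absurd h hi⟩
  exact ⟨fun i => (hx i).choose, fun i => (hx i).choose_spec⟩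

theorem finiteType_of_adjoin_eq_top {R A ι : Type*} [CommSemiring R] [Semiring A] [Algebra R A]
    {T : Set ι} (hT : T.Finite) {f : ι → A}
    (h : Algebra.adjoin R {s | ∃ i ∈ T, s = f i} = ⊤) : Algebra.FiniteType R A :=
  ⟨Subalgebra.fg_def.2 ⟨_, (hT.image f).subset (by rintro s ⟨i, hi, rfl⟩; exact ⟨i, hi, rfl⟩), h⟩⟩

end BlowUpCox

end

theorem theorem1p2 (n r : ℕ) (hn : 2 ≤ n) (hr : n + 3 ≤ r)
    (C : Set (ℙ ℂ (BlowUpCox.Vec n))) (hC : BlowUpCox.IsRationalNormalCurve C)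
    (p : Fin r → ℙ ℂ (BlowUpCox.Vec n)) (hp : Function.Injective p) (hpC : ∀ i, p i ∈ C) :
    (∀ D ∈ BlowUpCox.generatorDivisors n r, Module.finrank ℂ (BlowUpCox.H0 p D) = 1) ∧
    (∀ x : ∀ D : BlowUpCox.Div r, BlowUpCox.H0 p D,
      (∀ D ∈ BlowUpCox.generatorDivisors n r, x D ≠ 0) →
      Algebra.adjoin ℂ {s : BlowUpCox.Cox p | ∃ D ∈ BlowUpCox.generatorDivisors n r,
        s = DirectSum.of (fun D => BlowUpCox.H0 p D) D (x D)} = ⊤) ∧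
    Algebra.FiniteType ℂ (BlowUpCox.Cox p) := by
  have : NeZero r := ⟨by omega⟩
  obtain ⟨B, y, h⟩ := hC.exists_isMomentChart hp hpC
  have hrank : ∀ D ∈ BlowUpCox.generatorDivisors n r, Module.finrank ℂ (BlowUpCox.H0 p D) = 1 :=
    fun D hD => h.finrank_H0 hn hr hD
  obtain ⟨x, hx⟩ := BlowUpCox.exists_forall_ne_zero_of_finrank_eq_one hrank
  exact ⟨hrank, fun x hx => h.adjoin_eq_top hn hr hx,
    BlowUpCox.finiteType_of_adjoin_eq_top (BlowUpCox.finite_generatorDivisors n r)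
      (h.adjoin_eq_top hn hr hx)⟩
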